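/- Let $m\ge 1$ be an integer. For $a\in\mathbb C$ with $\operatorname{Re}(a)>\tfrac12(m-1)$ let $$\Gamma_m(a)=\int_{R>0}(\det R)^{a-\frac12(m+1)}\,e^{-\operatorname{tr}R}\,dR$$ be the multivariate gamma function, where $R$ runs over the real positive definite $m\times m$ matrices and $dR=\prod_{i\le j}dr_{ij}$. For a partition $\kappa=(k_1\ge\dots\ge k_m\ge 0)$ of weight $|\kappa|=k_1+\dots+k_m$ put $[a]_\kappa=\prod_{j=1}^m\prod_{i=0}^{k_j-1}\bigl(a-\tfrac12(j-1)+i\bigr)$. For a real symmetric $m\times m$ matrix $Y$ with leading principal minors $\det_j(Y)$ let $$C_\kappa(Y)=C_\kappa(I_m)\int_{O(m)}(\det Y)^{k_m}\prod_{j=1}^{m-1}\bigl({\det}_j(HYH^{-1})\bigr)^{k_j-k_{j+1}}\,dH$$ be the zonal polynomials, where $dH$ is the normalized Haar measure on the orthogonal group $O(m)$ and the constants $C_\kappa(I_m)$ are normalized so that $(\operatorname{tr}Y)^k=\sum_{|\kappa|=k}C_\kappa(Y)$ for all $k\ge 0$ and all symmetric $Y$. Let $\nu\in\mathbb C$ with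 $\operatorname{Re}(\nu)>\tfrac12(m-2)$. The Bessel function of matrix argument of order $\nu$ is $$A_\nu(Y)=\frac{1}{\Gamma_m(\nu+\frac12(m+1))}\sum_{k=0}^\infty\frac{(-1)^k}{k!}\sum_{|\kappa|=k}\frac{C_\kappa(Y)}{[\nu+\frac12(m+1)]_\kappa},$$ and the Hankel transform of order $\nu$ of a positive definite random $m\times m$ matrix $X$ is $$\mathcal H_{X,\nu}(T)=E\bigl[\Gamma_m(\nu+\tfrac12(m+1))\,A_\nu(T^{1/2}XT^{1/2})\bigr],\qquad T>0 .$$ Theorem. Let $X$ and $Y$ be (almost surely) positive definite random $m\times m$ matrices, possibly defined on different probability spaces. Then $\mathcal H_{X,\nu}(T)=\mathcal H_{Y,\nu}(T)$ for all positive definite $T$ if and only if $X$ and $Y$ have the same distribution. -/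

import Mathlib

open MeasureTheory ProbabilityTheory
open scoped MatrixOrder

namespace MatrixHankel

/-- The entrywise (product) measurable structure on real matrices. -/
instance matrixMeasurableSpace (m : ℕ) : MeasurableSpace (Matrix (Fin m) (Fin m) ℝ) :=
  inferInstanceAs (MeasurableSpace (Fin m → Fin m → ℝ))

instance matrixBorelSpace (m : ℕ) : BorelSpace (Matrix (Fin m) (Fin m) ℝ) :=
  inferInstanceAs (BorelSpace (Fin m → Fin m → ℝ))

/-- The orthogonal group `O(m)` is compact. -/
instance orthogonalCompactSpace (m : ℕ) :
    CompactSpace (Matrix.orthogonalGroup (Fin m) ℝ) := by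
  refine isCompact_iff_compactSpace.mp ?_
  have hbox : IsCompact
      (Set.univ.pi fun _ : Fin m => Set.univ.pi fun _ : Fin m => Set.Icc (-1 : ℝ) 1) :=
    isCompact_univ_pi fun _ => isCompact_univ_pi fun _ => isCompact_Icc
  refine IsCompact.of_isClosed_subset hbox ?_ ?_
  · have h : ((Matrix.orthogonalGroup (Fin m) ℝ : Submonoid _) :
        Set (Matrix (Fin m) (Fin m) ℝ)) = {A | A * A.transpose = 1} := by
      ext A
      exact Matrix.mem_orthogonalGroup_iff (Fin m) ℝ
    rw [h]
    exact isClosed_eq (continuous_id.matrix_mul continuous_id.matrix_transpose) continuous_const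
  · intro A hA i _ j _
    have h := entry_norm_bound_of_unitary (𝕜 := ℝ) hA i j
    rw [Real.norm_eq_abs, abs_le] at h
    exact h

/-- The normalized Haar measure on the orthogonal group `O(m)`. -/
noncomputable def orthogonalHaar (m : ℕ) : Measure (Matrix.orthogonalGroup (Fin m) ℝ) :=
  Measure.haarMeasure ⊤

/-- The symmetric matrix whose entries on and above the diagonal are the given numbers. -/
def symmetricOfUpper {m : ℕ} (r : {p : Fin m × Fin m // p.1 ≤ p.2} → ℝ) :
    Matrix (Fin m) (Fin m) ℝ :=
  Matrix.of fun i j => r ⟨(min i j, max i j), min_le_max⟩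

/-- The multivariate gamma function
`Γ_m(a) = ∫_{R > 0} (det R)^(a - (m+1)/2) exp(-tr R) dR`, where `dR = ∏_{i ≤ j} dr_ij` is
Lebesgue measure on the space of symmetric matrices. -/
noncomputable def multivariateGamma (m : ℕ) (a : ℂ) : ℂ :=
  ∫ r in {r : {p : Fin m × Fin m // p.1 ≤ p.2} → ℝ | (symmetricOfUpper r).PosDef},
    ((symmetricOfUpper r).det : ℂ) ^ (a - ((m : ℂ) + 1) / 2) *
      Complex.exp (-((symmetricOfUpper r).trace : ℂ))

/-- The partitions `κ = (k_1 ≥ ⋯ ≥ k_m ≥ 0)` of weight `k` with at most `m` nonzero parts. -/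
def partitions (m k : ℕ) : Finset (Fin m → ℕ) :=
  {κ ∈ Finset.piAntidiag Finset.univ k | ∀ i j : Fin m, i ≤ j → κ j ≤ κ i}

/-- The partitional shifted factorial `[a]_κ = ∏_{j=1}^m (a - (j-1)/2)_{k_j}`
(the index `j : Fin m` starts at `0`). -/
noncomputable def partitionalFactorial {m : ℕ} (a : ℂ) (κ : Fin m → ℕ) : ℂ :=
  ∏ j : Fin m, (ascPochhammer ℂ (κ j)).eval (a - (j : ℂ) / 2)

/-- The leading principal minor of order `j + 1`. -/
noncomputable def leadingMinor {m : ℕ} (Y : Matrix (Fin m) (Fin m) ℝ) (j : Fin m) : ℝ :=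
  (Y.submatrix (Fin.castLE j.isLt) (Fin.castLE j.isLt) : Matrix (Fin (j + 1)) (Fin (j + 1)) ℝ).det

/-- The part of `κ` following position `j`, which is `0` after the last position. -/
def nextPart {m : ℕ} (κ : Fin m → ℕ) (j : Fin m) : ℕ :=
  if h : (j : ℕ) + 1 < m then κ ⟨j + 1, h⟩ else 0

/-- The generalized power function `(det Y)^{k_m} ∏_{j=1}^{m-1} det_j(Y)^{k_j - k_{j+1}}`
(the factor with last index `j` is `(det Y)^{k_m}`). -/
noncomputable def generalizedPower {m : ℕ} (κ : Fin m → ℕ) (Y : Matrix (Fin m) (Fin m) ℝ) : ℝ :=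
  ∏ j : Fin m, leadingMinor Y j ^ (κ j - nextPart κ j)

/-- The average of the generalized power function over `O(m)`, i.e. `C_κ(Y) / C_κ(I_m)`.
The inverse of an orthogonal matrix is its transpose. -/
noncomputable def sphericalPolynomial {m : ℕ} (κ : Fin m → ℕ) (Y : Matrix (Fin m) (Fin m) ℝ) : ℝ :=
  ∫ H, generalizedPower κ
    ((H : Matrix (Fin m) (Fin m) ℝ) * Y * (H : Matrix (Fin m) (Fin m) ℝ).transpose)
    ∂(orthogonalHaar m)

/-- The normalizing constants `C_κ(I_m)` of the zonal polynomials: the coefficients for which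
`(tr Y)^k = ∑_{|κ| = k} C_κ(Y)` for all `k` and all symmetric `Y`. -/
noncomputable def zonalAtOne (m : ℕ) : (Fin m → ℕ) → ℝ :=
  Classical.epsilon fun c : (Fin m → ℕ) → ℝ =>
    ∀ (k : ℕ) (Y : Matrix (Fin m) (Fin m) ℝ), Y.IsSymm →
      Y.trace ^ k = ∑ κ ∈ partitions m k, c κ * sphericalPolynomial κ Y

/-- The zonal polynomial `C_κ`. -/
noncomputable def zonalPolynomial {m : ℕ} (κ : Fin m → ℕ) (Y : Matrix (Fin m) (Fin m) ℝ) : ℝ :=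
  zonalAtOne m κ * sphericalPolynomial κ Y

/-- The Bessel function (of the first kind) of order `ν` of matrix argument,
`A_ν(Y) = Γ_m(ν + (m+1)/2)⁻¹ ∑_k (-1)^k / k! ∑_{|κ| = k} C_κ(Y) / [ν + (m+1)/2]_κ`. -/
noncomputable def besselA {m : ℕ} (ν : ℂ) (Y : Matrix (Fin m) (Fin m) ℝ) : ℂ :=
  1 / multivariateGamma m (ν + ((m : ℂ) + 1) / 2) *
    ∑' k : ℕ, (-1 : ℂ) ^ k / (k.factorial : ℂ) *
      ∑ κ ∈ partitions m k,
        1 / partitionalFactorial (ν + ((m : ℂ) + 1) / 2) κ * (zonalPolynomial κ Y : ℂ)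

/-- The Hankel transform of order `ν` of a positive definite random matrix `X`, at `T > 0`:
`E[Γ_m(ν + (m+1)/2) A_ν(TX)]`, where `A_ν(TX)` stands for `A_ν(T^{1/2} X T^{1/2})`. -/
noncomputable def hankelTransform {m : ℕ} {Ω : Type*} [MeasurableSpace Ω] (P : Measure Ω)
    (X : Ω → Matrix (Fin m) (Fin m) ℝ) (ν : ℂ) (T : Matrix (Fin m) (Fin m) ℝ) : ℂ :=
  ∫ ω, multivariateGamma m (ν + ((m : ℂ) + 1) / 2) *
    besselA ν (CFC.sqrt T * X ω * CFC.sqrt T) ∂P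

end MatrixHankel

namespace MatrixHankel

open Matrix

open scoped Kronecker

/-! ### Positive definite matrices and their square roots -/

section MatrixFacts

variable {n : Type*} [Fintype n] [DecidableEq n]

/-! Put a = ν + (m+1)/2. The theorem is reduced to uniqueness of Laplace transforms. For S > 0,
integrating H_X(S^{1/2} R S^{1/2}) against (det R)^ν exp(-tr R) over the cone R > 0 gives Γ_m(a) E
exp(-tr SX) (`integral_coneDensity_hankel`). So the Hankel transform determines the Laplace
transform at all S > 0, and this determines the law by Stone–Weierstrass (`ext_of_laplace`). The
converse holds because the Hankel transform is an integral against the law.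

Fubini needs a bounded Bessel function. The bound comes from an integral over the matrix ball QQᵀ <
1: for invertible M, Γ_m(a) A_ν(MMᵀ) is a constant times ∫ cos(2 tr MQ) det(1 - QQᵀ)^{ν - m/2} dQ
(`besselA_mul_transpose`), absolutely convergent since Re ν > (m-2)/2. The substitution R = S + NNᵀ,
N = R^{1/2} Q, with N Gaussian and S on the cone, relates cone, ball and Gaussian integrals
(`integral_cone_ball`). Applied to a cosine, it turns the Fourier transform of a Gaussian into the
Laplace integral of the Bessel function.

The ball integral is matched with the zonal series term by term. Write Φ_κ for `sphericalPolynomial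
κ`. The functions Φ_κ(MMᵀ) are eigenfunctions of f ↦ ∫ f(MQ) ρ(Q) dQ whenever ρ is left
O(m)-invariant with all moments (`integral_sphericalPolynomial_conj`). The ball eigenvalue is the
Gaussian one times Γ_m(a - m/2) / ([a]_κ Γ_m(a)), by the same substitution and Gindikin's integral
(`powerMoment_ballDensity`). The O(m)-average of (tr MH)^{2k} is a combination of the Φ_κ(MMᵀ); its
Gaussian integral is a multiple of (tr MMᵀ)^k = ∑ C_κ(MMᵀ), which identifies the coefficients, and
passing to the ball then divides each C_κ by [a]_κ.

This uses that the Φ_κ(MMᵀ), |κ| = k, form a basis of the bi-invariant homogeneous polynomials of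
degree 2k. They are independent because for suitable a the ball eigenvalues are pairwise distinct
(`sphericalPolynomial_independent`). They span because a bi-invariant polynomial is even and
symmetric on diagonal matrices, hence fixed by one coefficient per partition
(`IsBiInvariant.exists_expansion`). The same basis shows that the constants C_κ(I_m) exist. -/

theorem posDef_sqrt {A : Matrix n n ℝ} (hA : A.PosDef) :
    (CFC.sqrt A).PosDef ∧ (CFC.sqrt A)ᵀ = CFC.sqrt A ∧ CFC.sqrt A * CFC.sqrt A = A := by
  have h0 : 0 ≤ A := Matrix.nonneg_iff_posSemidef.2 hA.posSemidef
  have h1 : CFC.sqrt A * CFC.sqrt A = A := CFC.sqrt_mul_sqrt_self A h0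
  have h2 : (CFC.sqrt A).PosSemidef := Matrix.nonneg_iff_posSemidef.1 (CFC.sqrt_nonneg A)
  refine ⟨h2.posDef_iff_det_ne_zero.2 fun h => ?_, ?_, h1⟩
  · have := congrArg Matrix.det h1
    rw [Matrix.det_mul, h, zero_mul] at this
    exact hA.det_pos.ne this
  · have := h2.1
    rwa [Matrix.IsHermitian, Matrix.conjTranspose_eq_transpose_of_trivial] at this

theorem posDef_conj_iff {A U : Matrix n n ℝ} (hU : IsUnit U) :
    (U * A * Uᵀ).PosDef ↔ A.PosDef := by
  have := Matrix.IsUnit.posDef_star_right_conjugate_iff (x := A) hU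
  rwa [Matrix.star_eq_conjTranspose, Matrix.conjTranspose_eq_transpose_of_trivial] at this

theorem posDef_isUnit_det {A : Matrix n n ℝ} (hA : A.PosDef) : IsUnit A.det :=
  hA.det_pos.ne'.isUnit

omit [DecidableEq n] in
theorem posSemidef_mul_transpose {l : Type*} [Fintype l] (A : Matrix n l ℝ) :
    (A * Aᵀ).PosSemidef := by
  simpa [Matrix.conjTranspose_eq_transpose_of_trivial] using
    Matrix.posSemidef_self_mul_conjTranspose A

end MatrixFacts

theorem measurableSet_posDef (m : ℕ) :
    MeasurableSet {A : Matrix (Fin m) (Fin m) ℝ | A.PosDef} := by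
  have : {A : Matrix (Fin m) (Fin m) ℝ | A.PosDef} =
      {A | A.PosSemidef} ∩ {A | A.det ≠ 0} := by
    ext A
    exact ⟨fun h => ⟨h.posSemidef, h.det_pos.ne'⟩, fun h => h.1.posDef_iff_det_ne_zero.2 h.2⟩
  rw [this]
  refine MeasurableSet.inter (IsClosed.measurableSet ?_) ?_
  · have : {A : Matrix (Fin m) (Fin m) ℝ | A.PosSemidef} =
        {A | Aᵀ = A} ∩ ⋂ x : Fin m → ℝ, {A | 0 ≤ x ⬝ᵥ (A *ᵥ x)} := by
      ext A
      simp [Matrix.posSemidef_iff_dotProduct_mulVec, Matrix.IsHermitian,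
        Matrix.conjTranspose_eq_transpose_of_trivial]
    rw [this]
    refine (isClosed_eq (by fun_prop) continuous_id).inter (isClosed_iInter fun x => ?_)
    exact isClosed_le continuous_const (by fun_prop)
  · exact (IsOpen.measurableSet (isOpen_ne_fun (by fun_prop) continuous_const))

/-- The index set of the entries on and above the diagonal. -/
abbrev Upper (m : ℕ) := {p : Fin m × Fin m // p.1 ≤ p.2}

theorem continuous_symmetricOfUpper (m : ℕ) :
    Continuous (symmetricOfUpper : (Upper m → ℝ) → Matrix (Fin m) (Fin m) ℝ) := by
  refine continuous_pi fun i => continuous_pi fun j => ?_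
  exact continuous_apply _

theorem symmetricOfUpper_transpose {m : ℕ} (r : Upper m → ℝ) :
    (symmetricOfUpper r)ᵀ = symmetricOfUpper r := by
  ext i j
  simp only [symmetricOfUpper, Matrix.transpose_apply, Matrix.of_apply]
  congr 1
  simp [min_comm, max_comm]

theorem measurableSet_posDef_upper (m : ℕ) :
    MeasurableSet {r : Upper m → ℝ | (symmetricOfUpper r).PosDef} :=
  (continuous_symmetricOfUpper m).measurable (measurableSet_posDef m)

/-! ### Bordered symmetric matrices and the Schur complement -/

section Border

/-- The leading block of order `m`. -/
def leadingBlock {m : ℕ} (R : Matrix (Fin (m + 1)) (Fin (m + 1)) ℝ) : Matrix (Fin m) (Fin m) ℝ :=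
  R.submatrix Fin.castSucc Fin.castSucc

/-- The last column above the diagonal. -/
def lastColumn {m : ℕ} (R : Matrix (Fin (m + 1)) (Fin (m + 1)) ℝ) : Fin m → ℝ :=
  fun i => R i.castSucc (Fin.last m)

/-- The Schur complement of the leading block of order `m`. -/
noncomputable def lastPivot {m : ℕ} (R : Matrix (Fin (m + 1)) (Fin (m + 1)) ℝ) : ℝ :=
  R (Fin.last m) (Fin.last m) - lastColumn R ⬝ᵥ ((leadingBlock R)⁻¹ *ᵥ lastColumn R)

variable {m : ℕ} {R : Matrix (Fin (m + 1)) (Fin (m + 1)) ℝ}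

theorem submatrix_eq_fromBlocks (hR : Rᵀ = R) :
    R.submatrix finSumFinEquiv finSumFinEquiv =
      Matrix.fromBlocks (leadingBlock R) (Matrix.replicateCol (Fin 1) (lastColumn R))
        (Matrix.replicateCol (Fin 1) (lastColumn R))ᴴ
        (Matrix.of fun _ _ : Fin 1 => R (Fin.last m) (Fin.last m)) := by
  have hlast : ∀ i : Fin 1, Fin.natAdd m i = Fin.last m := by
    intro i; ext; simp
  ext i j
  rcases i with i | i <;> rcases j with j | j
  · simp [leadingBlock]; rfl
  · simp [lastColumn, hlast]; rfl
  · simp [lastColumn, hlast]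
    conv_lhs => rw [← hR]
    rfl
  · simp [hlast]

theorem schur_block_eq :
    (Matrix.of fun _ _ : Fin 1 => R (Fin.last m) (Fin.last m)) -
      (Matrix.replicateCol (Fin 1) (lastColumn R))ᴴ * (leadingBlock R)⁻¹ *
        Matrix.replicateCol (Fin 1) (lastColumn R) = Matrix.of fun _ _ : Fin 1 => lastPivot R := by
  ext i j
  rw [Matrix.mul_assoc]
  simp [lastPivot, Matrix.mul_apply, Matrix.mulVec, dotProduct]

theorem det_eq_mul_lastPivot (hR : Rᵀ = R) (h : (leadingBlock R).det ≠ 0) :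
    R.det = (leadingBlock R).det * lastPivot R := by
  have hinv : Invertible (leadingBlock R) :=
    Matrix.invertibleOfIsUnitDet _ h.isUnit
  rw [← Matrix.det_submatrix_equiv_self finSumFinEquiv R, submatrix_eq_fromBlocks hR,
    Matrix.det_fromBlocks₁₁, Matrix.invOf_eq_nonsing_inv, schur_block_eq]
  simp

theorem posDef_iff_lastPivot (hR : Rᵀ = R) :
    R.PosDef ↔ (leadingBlock R).PosDef ∧ 0 < lastPivot R := by
  constructor
  · intro h
    have hA : (leadingBlock R).PosDef := h.submatrix (Fin.castSucc_injective m)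
    refine ⟨hA, ?_⟩
    have := det_eq_mul_lastPivot hR hA.det_pos.ne'
    have h2 := h.det_pos
    rw [this] at h2
    exact (pos_iff_pos_of_mul_pos h2).1 hA.det_pos
  · rintro ⟨hA, hp⟩
    have hinv : Invertible (leadingBlock R) :=
      Matrix.invertibleOfIsUnitDet _ hA.det_pos.ne'.isUnit
    have hs : R.PosSemidef := by
      rw [← Matrix.posSemidef_submatrix_equiv (e := finSumFinEquiv) (M := R),
        submatrix_eq_fromBlocks hR, Matrix.PosDef.fromBlocks₁₁ _ _ hA, schur_block_eq]
      have : (Matrix.of fun _ _ : Fin 1 => lastPivot R) = Matrix.diagonal fun _ => lastPivot R := by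
        ext i j
        simp [Subsingleton.elim i j]
      rw [this]
      exact Matrix.PosSemidef.diagonal fun _ => hp.le
    rw [hs.posDef_iff_det_ne_zero, det_eq_mul_lastPivot hR hA.det_pos.ne']
    exact (mul_pos hA.det_pos hp).ne'

/-- The index set `Upper (m + 1)` split into leading block, last column, and corner. -/
def upperSucc (m : ℕ) : Upper m ⊕ (Fin m ⊕ Unit) → Upper (m + 1)
  | .inl p => ⟨(p.1.1.castSucc, p.1.2.castSucc), Fin.castSucc_le_castSucc_iff.2 p.2⟩
  | .inr (.inl i) => ⟨(i.castSucc, Fin.last m), Fin.le_last _⟩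
  | .inr (.inr ()) => ⟨(Fin.last m, Fin.last m), le_rfl⟩

theorem upperSucc_bijective (m : ℕ) : Function.Bijective (upperSucc m) := by
  constructor
  · rintro (⟨⟨i, j⟩, h⟩ | i | ⟨⟩) (⟨⟨i', j'⟩, h'⟩ | i' | ⟨⟩) heq <;>
      simp_all [upperSucc, Fin.ext_iff] <;> omega
  · rintro ⟨⟨i, j⟩, h⟩
    induction j using Fin.lastCases with
    | last =>
      induction i using Fin.lastCases with
      | last => exact ⟨.inr (.inr ()), rfl⟩
      | cast i => exact ⟨.inr (.inl i), rfl⟩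
    | cast j =>
      induction i using Fin.lastCases with
      | last => exact absurd h (by simp [Fin.le_def])
      | cast i => exact ⟨.inl ⟨(i, j), Fin.castSucc_le_castSucc_iff.1 h⟩, rfl⟩

/-- Splitting the coordinates of a symmetric matrix into those of the leading block, the last
column, and the corner. -/
noncomputable def borderEquiv (m : ℕ) :
    (Upper (m + 1) → ℝ) ≃ᵐ (Upper m → ℝ) × ((Fin m → ℝ) × ℝ) :=
  ((MeasurableEquiv.piCongrLeft (fun _ : Upper (m + 1) => ℝ)
    (Equiv.ofBijective _ (upperSucc_bijective m))).symm.trans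
    (MeasurableEquiv.sumPiEquivProdPi fun _ => ℝ)).trans
    (MeasurableEquiv.prodCongr (MeasurableEquiv.refl _)
      ((MeasurableEquiv.sumPiEquivProdPi fun _ => ℝ).trans
        (MeasurableEquiv.prodCongr (MeasurableEquiv.refl _) (MeasurableEquiv.funUnique Unit ℝ))))

theorem borderEquiv_apply (r : Upper (m + 1) → ℝ) :
    borderEquiv m r = (fun p => r (upperSucc m (.inl p)), fun i => r (upperSucc m (.inr (.inl i))),
      r (upperSucc m (.inr (.inr ())))) := rfl

theorem measurePreserving_borderEquiv (m : ℕ) : MeasurePreserving (borderEquiv m) := by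
  have h1 := (volume_measurePreserving_piCongrLeft (fun _ : Upper (m + 1) => ℝ)
    (Equiv.ofBijective _ (upperSucc_bijective m))).symm
  have h2 := volume_measurePreserving_sumPiEquivProdPi (fun _ : Upper m ⊕ (Fin m ⊕ Unit) => ℝ)
  have h3 := volume_measurePreserving_sumPiEquivProdPi (fun _ : Fin m ⊕ Unit => ℝ)
  have h4 := volume_preserving_funUnique Unit ℝ
  have h5 := (MeasurePreserving.id (volume : Measure (Fin m → ℝ))).prod h4
  have h6 := (MeasurePreserving.id (volume : Measure (Upper m → ℝ))).prod (h5.comp h3)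
  exact (h6.comp (h2.comp h1))

theorem leadingBlock_symmetricOfUpper (r : Upper (m + 1) → ℝ) :
    leadingBlock (symmetricOfUpper r) = symmetricOfUpper (borderEquiv m r).1 := by
  ext i j
  simp only [leadingBlock, symmetricOfUpper, Matrix.submatrix_apply, Matrix.of_apply,
    borderEquiv_apply, upperSucc]
  congr 2

theorem lastColumn_symmetricOfUpper (r : Upper (m + 1) → ℝ) :
    lastColumn (symmetricOfUpper r) = (borderEquiv m r).2.1 := by
  ext i
  simp only [lastColumn, symmetricOfUpper, Matrix.of_apply, borderEquiv_apply, upperSucc]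
  congr 3
  · exact min_eq_left (Fin.le_last _)
  · exact max_eq_right (Fin.le_last _)

theorem corner_symmetricOfUpper (r : Upper (m + 1) → ℝ) :
    symmetricOfUpper r (Fin.last m) (Fin.last m) = (borderEquiv m r).2.2 := by
  simp [symmetricOfUpper, borderEquiv_apply, upperSucc]

theorem trace_eq_leadingBlock (R : Matrix (Fin (m + 1)) (Fin (m + 1)) ℝ) :
    R.trace = (leadingBlock R).trace + R (Fin.last m) (Fin.last m) := by
  simp [Matrix.trace, Fin.sum_univ_castSucc, leadingBlock]

end Border

/-! ### Linear substitutions and Gaussian integrals -/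

section LinearChange

variable {ι : Type*} [Fintype ι]

section

variable [DecidableEq ι]

theorem measurableEmbedding_mulVec {M : Matrix ι ι ℝ} (hM : M.det ≠ 0) :
    MeasurableEmbedding fun v : ι → ℝ => M *ᵥ v := by
  refine Continuous.measurableEmbedding (by fun_prop) ?_
  exact Matrix.mulVec_injective_iff_isUnit.2 ((Matrix.isUnit_iff_isUnit_det M).2 hM.isUnit)

theorem map_mulVec_volume {M : Matrix ι ι ℝ} (hM : M.det ≠ 0) :
    (volume : Measure (ι → ℝ)).map (fun v => M *ᵥ v) = ENNReal.ofReal |M.det⁻¹| • volume :=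
  Real.map_matrix_volume_pi_eq_smul_volume_pi hM

theorem integral_comp_mulVec {E : Type*} [NormedAddCommGroup E] [NormedSpace ℝ E]
    {M : Matrix ι ι ℝ} (hM : M.det ≠ 0) (f : (ι → ℝ) → E) :
    ∫ v, f (M *ᵥ v) = |M.det|⁻¹ • ∫ v, f v := by
  rw [← (measurableEmbedding_mulVec hM).integral_map, map_mulVec_volume hM, integral_smul_measure,
    ENNReal.toReal_ofReal (abs_nonneg _), abs_inv]

theorem integrable_comp_mulVec {E : Type*} [NormedAddCommGroup E]
    {M : Matrix ι ι ℝ} (hM : M.det ≠ 0) {f : (ι → ℝ) → E} :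
    Integrable (fun v => f (M *ᵥ v)) ↔ Integrable f := by
  have h : Integrable (fun v => f (M *ᵥ v)) ↔
      Integrable f ((volume : Measure (ι → ℝ)).map fun v => M *ᵥ v) :=
    ((measurableEmbedding_mulVec hM).integrable_map_iff).symm
  rw [h, map_mulVec_volume hM, integrable_smul_measure]
  · simpa using hM
  · exact ENNReal.ofReal_ne_top

end

theorem integrable_exp_neg_dotProduct : Integrable fun v : ι → ℝ => Real.exp (-(v ⬝ᵥ v)) := by
  have : (fun v : ι → ℝ => Real.exp (-(v ⬝ᵥ v))) = fun v => ∏ i, Real.exp (-1 * v i ^ 2) := by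
    ext v
    rw [← Real.exp_sum, dotProduct, ← Finset.sum_neg_distrib]
    simp [sq]
  rw [this]
  exact Integrable.fintype_prod (f := fun _ x => Real.exp (-1 * x ^ 2))
    fun _ => integrable_exp_neg_mul_sq one_pos

theorem integral_exp_neg_dotProduct :
    ∫ v : ι → ℝ, Real.exp (-(v ⬝ᵥ v)) = √Real.pi ^ Fintype.card ι := by
  have : (fun v : ι → ℝ => Real.exp (-(v ⬝ᵥ v))) = fun v => ∏ i, Real.exp (-1 * v i ^ 2) := by
    ext v
    rw [← Real.exp_sum, dotProduct, ← Finset.sum_neg_distrib]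
    simp [sq]
  rw [this, integral_fintype_prod_volume_eq_pow (fun x => Real.exp (-1 * x ^ 2)),
    integral_gaussian, div_one]

variable [DecidableEq ι]

theorem dotProduct_inv_mulVec_sqrt {A : Matrix ι ι ℝ} (hA : A.PosDef) (v : ι → ℝ) :
    (CFC.sqrt A *ᵥ v) ⬝ᵥ (A⁻¹ *ᵥ (CFC.sqrt A *ᵥ v)) = v ⬝ᵥ v := by
  obtain ⟨hB, hBt, hBB⟩ := posDef_sqrt hA
  have hu := posDef_isUnit_det hB
  generalize CFC.sqrt A = B at *
  subst hBB
  rw [Matrix.mul_inv_rev, Matrix.mulVec_mulVec, Matrix.mul_assoc, Matrix.nonsing_inv_mul _ hu,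
    Matrix.mul_one, Matrix.dotProduct_mulVec, ← Matrix.mulVec_transpose, Matrix.mulVec_mulVec,
    Matrix.transpose_nonsing_inv, hBt, Matrix.nonsing_inv_mul _ hu, Matrix.one_mulVec]

theorem det_sqrt_posDef {A : Matrix ι ι ℝ} (hA : A.PosDef) : (CFC.sqrt A).det = √A.det := by
  obtain ⟨hB, -, hBB⟩ := posDef_sqrt hA
  rw [eq_comm, Real.sqrt_eq_iff_mul_self_eq_of_pos hB.det_pos, ← Matrix.det_mul, hBB]

theorem integrable_exp_neg_inv {A : Matrix ι ι ℝ} (hA : A.PosDef) :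
    Integrable fun v : ι → ℝ => Real.exp (-(v ⬝ᵥ (A⁻¹ *ᵥ v))) := by
  rw [← integrable_comp_mulVec (posDef_sqrt hA).1.det_pos.ne']
  simpa only [dotProduct_inv_mulVec_sqrt hA] using integrable_exp_neg_dotProduct

theorem integral_exp_neg_inv {A : Matrix ι ι ℝ} (hA : A.PosDef) :
    ∫ v : ι → ℝ, Real.exp (-(v ⬝ᵥ (A⁻¹ *ᵥ v))) = √A.det * √Real.pi ^ Fintype.card ι := by
  have h := integral_comp_mulVec (posDef_sqrt hA).1.det_pos.ne'
    fun v : ι → ℝ => Real.exp (-(v ⬝ᵥ (A⁻¹ *ᵥ v)))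
  simp only [dotProduct_inv_mulVec_sqrt hA, integral_exp_neg_dotProduct] at h
  have hp := (posDef_sqrt hA).1.det_pos
  rw [← det_sqrt_posDef hA, h, smul_eq_mul, abs_of_pos hp, mul_inv_cancel_left₀ hp.ne']

end LinearChange

/-! ### Recursion for generalized powers -/

section Minors

variable {m : ℕ}

theorem leadingMinor_castSucc (R : Matrix (Fin (m + 1)) (Fin (m + 1)) ℝ) (j : Fin m) :
    leadingMinor R j.castSucc = leadingMinor (leadingBlock R) j := rfl

theorem leadingMinor_last (R : Matrix (Fin (m + 1)) (Fin (m + 1)) ℝ) :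
    leadingMinor R (Fin.last m) = R.det := rfl

theorem nextPart_castSucc_castSucc (κ : Fin (m + 2) → ℕ) (j : Fin m) :
    nextPart κ j.castSucc.castSucc = nextPart (fun i => κ i.castSucc) j.castSucc := by
  have h : (j : ℕ) + 1 < m + 1 := by omega
  simp only [nextPart, Fin.val_castSucc]
  rw [dif_pos (by omega), dif_pos h]
  rfl

theorem nextPart_last (κ : Fin (m + 1) → ℕ) : nextPart κ (Fin.last m) = 0 := by
  simp [nextPart]

theorem nextPart_last_castSucc (κ : Fin (m + 2) → ℕ) :
    nextPart κ (Fin.last m).castSucc = κ (Fin.last (m + 1)) := by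
  simp [nextPart]
  rfl

/-- The exponents telescope: writing det R as the determinant of the leading block times the last
pivot moves a factor with exponent equal to the last part onto that block, which turns its exponent
from a difference of consecutive parts into the part itself. Monotonicity makes the truncated
subtraction exact. -/
theorem generalizedPower_succ {κ : Fin (m + 1) → ℕ} (hκ : Antitone κ)
    {R : Matrix (Fin (m + 1)) (Fin (m + 1)) ℝ} (hR : Rᵀ = R) (h : (leadingBlock R).det ≠ 0) :
    generalizedPower κ R =
      generalizedPower (fun i => κ i.castSucc) (leadingBlock R) * lastPivot R ^ κ (Fin.last m) := by
  cases m with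
  | zero =>
    have h1 : leadingMinor R 0 = lastPivot R := by
      rw [show leadingMinor R 0 = R.det from rfl, det_eq_mul_lastPivot hR h]
      simp
    simp [generalizedPower, h1, nextPart]
  | succ m =>
    rw [generalizedPower, generalizedPower, Fin.prod_univ_castSucc, Fin.prod_univ_castSucc,
      Fin.prod_univ_castSucc]
    simp only [leadingMinor_last, leadingMinor_castSucc, nextPart_castSucc_castSucc, nextPart_last,
      nextPart_last_castSucc, det_eq_mul_lastPivot hR h, mul_pow, Nat.sub_zero]
    have hle : κ (Fin.last (m + 1)) ≤ κ (Fin.last m).castSucc := hκ (Fin.le_last _)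
    conv_rhs => rw [← Nat.sub_add_cancel hle, pow_add]
    ring

end Minors

/-! ### Gindikin's integral over the cone -/

section ConeIntegral

variable {m : ℕ}

/-- The density `(det R)^(a - (m+1)/2) exp(-tr R)` on the cone of positive definite matrices. -/
noncomputable def coneDensity (a : ℂ) : (Upper m → ℝ) → ℂ :=
  {r | (symmetricOfUpper r).PosDef}.indicator fun r =>
    ((symmetricOfUpper r).det : ℂ) ^ (a - ((m : ℂ) + 1) / 2) *
      Complex.exp (-((symmetricOfUpper r).trace : ℂ))

theorem multivariateGamma_eq_integral (a : ℂ) :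
    multivariateGamma m a = ∫ r : Upper m → ℝ, coneDensity a r :=
  (integral_indicator (measurableSet_posDef_upper m)).symm

theorem measurable_coneDensity (a : ℂ) : Measurable (coneDensity a : (Upper m → ℝ) → ℂ) := by
  have h := (continuous_symmetricOfUpper m)
  refine Measurable.indicator ?_ (measurableSet_posDef_upper m)
  refine Measurable.mul (Measurable.pow_const ?_ _) ?_
  · exact (Complex.continuous_ofReal.comp h.matrix_det).measurable
  · exact (Complex.continuous_exp.comp (Complex.continuous_ofReal.comp h.matrix_trace).neg).measurable

theorem measurable_inv_matrix :
    Measurable fun A : Matrix (Fin m) (Fin m) ℝ => A⁻¹ := by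
  have : (fun A : Matrix (Fin m) (Fin m) ℝ => A⁻¹) = fun A => A.det⁻¹ • A.adjugate := by
    ext A; rw [Matrix.inv_def, Ring.inverse_eq_inv']
  rw [this]
  refine measurable_pi_lambda _ fun i => measurable_pi_lambda _ fun j => ?_
  have h1 : Measurable fun A : Matrix (Fin m) (Fin m) ℝ => A.det :=
    (Continuous.matrix_det continuous_id).measurable
  have h2 : Measurable fun A : Matrix (Fin m) (Fin m) ℝ => A.adjugate i j :=
    ((Continuous.matrix_adjugate continuous_id).matrix_elem i j).measurable
  exact h1.inv.mul h2

theorem measurable_dotProduct_inv :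
    Measurable fun x : (Upper m → ℝ) × (Fin m → ℝ) =>
      x.2 ⬝ᵥ ((symmetricOfUpper x.1)⁻¹ *ᵥ x.2) := by
  have h : Measurable fun x : (Upper m → ℝ) × (Fin m → ℝ) => (symmetricOfUpper x.1)⁻¹ :=
    measurable_inv_matrix.comp ((continuous_symmetricOfUpper m).measurable.comp measurable_fst)
  have h' : ∀ i j, Measurable fun x : (Upper m → ℝ) × (Fin m → ℝ) =>
      (symmetricOfUpper x.1)⁻¹ i j := fun i j =>
    (measurable_pi_apply j).comp ((measurable_pi_apply i).comp h)
  simp only [dotProduct, Matrix.mulVec]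
  refine Finset.measurable_sum _ fun i _ => Measurable.mul (by fun_prop) ?_
  exact Finset.measurable_sum _ fun j _ => (h' i j).mul (by fun_prop)

theorem measurePreserving_sub_snd {X : Type*} [MeasureSpace X] [SFinite (volume : Measure X)]
    {q : X → ℝ} (hq : Measurable q) :
    MeasurePreserving (fun p : X × ℝ => (p.1, p.2 - q p.1)) := by
  refine (MeasurePreserving.id (volume : Measure X)).skew_product (g := fun x t => t - q x)
    (by fun_prop) (ae_of_all _ fun x => ?_)
  exact (measurePreserving_sub_right volume (q x)).map_eq

/-- The density of the last column and the last pivot, conditionally on the leading block. -/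
noncomputable def borderDensity (τ : ℝ → ℂ) (x : Upper m → ℝ) (y : (Fin m → ℝ) × ℝ) : ℂ :=
  (((√(symmetricOfUpper x).det)⁻¹ *
      Real.exp (-(y.1 ⬝ᵥ ((symmetricOfUpper x)⁻¹ *ᵥ y.1))) : ℝ) : ℂ) *
    τ (y.2 - y.1 ⬝ᵥ ((symmetricOfUpper x)⁻¹ *ᵥ y.1))

/-- A shear in the corner entry makes the density a product, and (det A)^{-1/2} cancels the
determinant from the Gaussian integral in the last column. The fibre integral therefore does not
depend on the leading block. -/
theorem borderDensity_fiber {τ : ℝ → ℂ} (hτ : Integrable τ) (x : Upper m → ℝ)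
    (hx : (symmetricOfUpper x).PosDef) :
    Integrable (borderDensity τ x) ∧ ∫ y, borderDensity τ x y = √Real.pi ^ m * ∫ t, τ t := by
  set A := symmetricOfUpper x
  set h : (Fin m → ℝ) → ℂ := fun b =>
    (((√A.det)⁻¹ * Real.exp (-(b ⬝ᵥ (A⁻¹ *ᵥ b))) : ℝ) : ℂ) with hh
  have hq : Measurable fun b : Fin m → ℝ => b ⬝ᵥ (A⁻¹ *ᵥ b) :=
    Continuous.measurable (by fun_prop)
  have hs := measurePreserving_sub_snd hq
  have hi : Integrable h := ((integrable_exp_neg_inv hx).const_mul _).ofReal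
  have hprod : Integrable fun z : (Fin m → ℝ) × ℝ => h z.1 * τ z.2 := hi.mul_prod hτ
  have heq : borderDensity τ x = (fun z : (Fin m → ℝ) × ℝ => h z.1 * τ z.2) ∘
      fun p => (p.1, p.2 - p.1 ⬝ᵥ (A⁻¹ *ᵥ p.1)) := rfl
  have hpos : 0 < √A.det := Real.sqrt_pos.2 hx.det_pos
  constructor
  · rw [heq]
    exact (hs.integrable_comp hprod.aestronglyMeasurable).2 hprod
  · rw [heq]
    have := integral_map hs.measurable.aemeasurable (f := fun z : (Fin m → ℝ) × ℝ => h z.1 * τ z.2)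
      (by rw [hs.map_eq]; exact hprod.aestronglyMeasurable)
    rw [hs.map_eq] at this
    simp only [Function.comp_def]
    rw [← this, Measure.volume_eq_prod, integral_prod_mul]
    congr 1
    simp only [hh]
    rw [integral_complex_ofReal, integral_const_mul, integral_exp_neg_inv hx, ← mul_assoc,
      inv_mul_cancel₀ hpos.ne', one_mul]
    simp

/-- The norm is again a border density, so the fibre formula also computes the integral of norms
required by the Fubini criterion. -/
theorem norm_borderDensity {τ : ℝ → ℂ} (x : Upper m → ℝ) (y : (Fin m → ℝ) × ℝ) :
    ((‖borderDensity τ x y‖ : ℝ) : ℂ) = borderDensity (fun t => (‖τ t‖ : ℂ)) x y := by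
  simp only [borderDensity, norm_mul, Complex.norm_real, Complex.ofReal_mul]
  rw [Real.norm_of_nonneg (inv_nonneg.2 (Real.sqrt_nonneg _)),
    Real.norm_of_nonneg (Real.exp_pos _).le]

theorem integral_border {u : (Upper m → ℝ) → ℂ} (hu : Integrable u)
    (hu0 : ∀ x, ¬(symmetricOfUpper x).PosDef → u x = 0) {τ : ℝ → ℂ} (hτm : Measurable τ)
    (hτ : Integrable τ) :
    Integrable (fun z : (Upper m → ℝ) × ((Fin m → ℝ) × ℝ) => u z.1 * borderDensity τ z.1 z.2) ∧
      ∫ z : (Upper m → ℝ) × ((Fin m → ℝ) × ℝ), u z.1 * borderDensity τ z.1 z.2 =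
        (∫ x, u x) * (√Real.pi ^ m * ∫ t, τ t) := by
  have hd : Measurable fun x : Upper m → ℝ => (symmetricOfUpper x).det :=
    ((continuous_symmetricOfUpper m).matrix_det).measurable
  have hmeas : Measurable fun z : (Upper m → ℝ) × ((Fin m → ℝ) × ℝ) =>
      borderDensity τ z.1 z.2 := by
    have hq := (measurable_dotProduct_inv (m := m)).comp
      (measurable_fst.prodMk (measurable_fst.comp measurable_snd) :
        Measurable fun z : (Upper m → ℝ) × ((Fin m → ℝ) × ℝ) => (z.1, z.2.1))
    refine Measurable.mul (Complex.measurable_ofReal.comp (Measurable.mul ?_ ?_)) ?_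
    · exact (hd.comp measurable_fst).sqrt.inv
    · exact hq.neg.exp
    · exact hτm.comp ((measurable_snd.comp measurable_snd).sub hq)
  have hF : AEStronglyMeasurable (fun z : (Upper m → ℝ) × ((Fin m → ℝ) × ℝ) =>
      u z.1 * borderDensity τ z.1 z.2) (volume.prod volume) :=
    hu.aestronglyMeasurable.comp_fst.mul hmeas.aestronglyMeasurable
  have hint : Integrable (fun z : (Upper m → ℝ) × ((Fin m → ℝ) × ℝ) =>
      u z.1 * borderDensity τ z.1 z.2) (volume.prod volume) := by
    rw [integrable_prod_iff hF]
    constructor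
    · refine ae_of_all _ fun x => ?_
      by_cases hx : (symmetricOfUpper x).PosDef
      · exact (borderDensity_fiber hτ x hx).1.const_mul (u x)
      · simp [hu0 x hx]
    · have : (fun x => ∫ y, ‖u x * borderDensity τ x y‖) =
          fun x => ‖u x‖ * (√Real.pi ^ m * ∫ t, ‖τ t‖) := by
        ext x
        by_cases hx : (symmetricOfUpper x).PosDef
        · simp only [norm_mul]
          rw [integral_const_mul]
          congr 1
          have h2 := (borderDensity_fiber (τ := fun t => (‖τ t‖ : ℂ)) hτ.norm.ofReal x hx).2
          simp only [← norm_borderDensity] at h2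
          rw [integral_complex_ofReal, integral_complex_ofReal] at h2
          exact_mod_cast h2
        · simp [hu0 x hx]
      rw [this]
      exact hu.norm.mul_const _
  refine ⟨hint, ?_⟩
  rw [Measure.volume_eq_prod, integral_prod _ hint, ← integral_mul_const]
  congr 1
  ext x
  by_cases hx : (symmetricOfUpper x).PosDef
  · simp only []
    rw [integral_const_mul, (borderDensity_fiber hτ x hx).2]
  · simp [hu0 x hx]

/-- The density of the gamma distribution. -/
noncomputable def gammaDensity (s : ℂ) : ℝ → ℂ :=
  (Set.Ioi 0).indicator fun t => (t : ℂ) ^ (s - 1) * Complex.exp (-(t : ℂ))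

theorem measurable_gammaDensity (s : ℂ) : Measurable (gammaDensity s) :=
  Measurable.indicator (by fun_prop) measurableSet_Ioi

theorem integrable_gammaDensity {s : ℂ} (hs : 0 < s.re) : Integrable (gammaDensity s) := by
  rw [gammaDensity, integrable_indicator_iff measurableSet_Ioi]
  have := Complex.GammaIntegral_convergent hs
  refine this.congr (ae_of_all _ fun t => ?_)
  simp [mul_comm]

theorem integral_gammaDensity {s : ℂ} (hs : 0 < s.re) : ∫ t, gammaDensity s t = Complex.Gamma s := by
  rw [gammaDensity, integral_indicator measurableSet_Ioi, Complex.Gamma_eq_integral hs,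
    Complex.GammaIntegral]
  congr 1
  ext t
  simp [mul_comm]

/-- With leading block A, pivot t and quadratic form q of the last column, det R = t det A and tr R
= tr A + t + q. Raising the size by one lowers the exponent of det A by 1/2, which is the
normalizing factor of the border density; the powers of t combine to a gamma density with parameter
a + κ_last - m/2. -/
theorem generalizedPower_mul_coneDensity_succ (a : ℂ) {κ : Fin (m + 1) → ℕ} (hκ : Antitone κ)
    (r : Upper (m + 1) → ℝ) :
    (generalizedPower κ (symmetricOfUpper r) : ℂ) * coneDensity a r =
      ((generalizedPower (fun i => κ i.castSucc) (symmetricOfUpper (borderEquiv m r).1) : ℂ) *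
          coneDensity a (borderEquiv m r).1) *
        borderDensity (gammaDensity (a + κ (Fin.last m) - m / 2)) (borderEquiv m r).1
          (borderEquiv m r).2 := by
  set R := symmetricOfUpper r with hRdef
  have hRt : Rᵀ = R := symmetricOfUpper_transpose r
  set z := borderEquiv m r with hz
  have hA : leadingBlock R = symmetricOfUpper z.1 := leadingBlock_symmetricOfUpper r
  have hp : lastPivot R = z.2.2 - z.2.1 ⬝ᵥ ((symmetricOfUpper z.1)⁻¹ *ᵥ z.2.1) := by
    rw [lastPivot, hA, hRdef, lastColumn_symmetricOfUpper, corner_symmetricOfUpper]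
  have htr : R.trace = (symmetricOfUpper z.1).trace +
      (lastPivot R + z.2.1 ⬝ᵥ ((symmetricOfUpper z.1)⁻¹ *ᵥ z.2.1)) := by
    rw [trace_eq_leadingBlock, hA, hp, hRdef, corner_symmetricOfUpper]
    ring
  rw [borderDensity, ← hp]
  by_cases hpd : R.PosDef
  · obtain ⟨hApd, hpos⟩ := (posDef_iff_lastPivot hRt).1 hpd
    have hApd' := hApd
    rw [hA] at hApd'
    have hdet := hApd'.det_pos
    rw [generalizedPower_succ hκ hRt hApd.det_pos.ne', coneDensity, coneDensity, gammaDensity,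
      Set.indicator_of_mem (by exact hpd), Set.indicator_of_mem (by exact hApd'),
      Set.indicator_of_mem (by exact hpos), det_eq_mul_lastPivot hRt hApd.det_pos.ne', hA, htr]
    set t := lastPivot R
    set A := symmetricOfUpper z.1
    have htc : (t : ℂ) ≠ 0 := by exact_mod_cast hpos.ne'
    have hAc : (A.det : ℂ) ≠ 0 := by exact_mod_cast hdet.ne'
    have hsq : ((√A.det)⁻¹ : ℂ) = (A.det : ℂ) ^ (-(1 / 2) : ℂ) := by
      rw [Real.sqrt_eq_rpow, Complex.ofReal_cpow hdet.le, Complex.cpow_neg]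
      norm_num
    push_cast
    rw [hsq, Complex.mul_cpow_ofReal_nonneg hdet.le hpos.le]
    rw [show a - ((m : ℂ) + 1 + 1) / 2 = (a - ((m : ℂ) + 1) / 2) + (-(1 / 2)) by ring,
      Complex.cpow_add _ _ hAc,
      show a + (κ (Fin.last m) : ℂ) - m / 2 - 1 =
        (κ (Fin.last m) : ℂ) + ((a - ((m : ℂ) + 1) / 2) + (-(1 / 2))) by ring,
      Complex.cpow_add ((κ (Fin.last m) : ℂ)) _ htc, Complex.cpow_natCast, neg_add, neg_add,
      Complex.exp_add, Complex.exp_add]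
    ring
  · rw [coneDensity, Set.indicator_of_notMem (by exact hpd), mul_zero]
    by_cases hApd : (symmetricOfUpper z.1).PosDef
    · have hn : ¬ 0 < lastPivot R := fun h =>
        hpd ((posDef_iff_lastPivot hRt).2 ⟨by rw [hA]; exact hApd, h⟩)
      rw [gammaDensity, Set.indicator_of_notMem (by exact hn)]
      simp
    · rw [coneDensity, Set.indicator_of_notMem (by exact hApd)]
      simp

/-- Gindikin's integral of a generalized power over the cone. -/
theorem integral_generalizedPower_coneDensity : ∀ {m : ℕ} {a : ℂ}, ((m : ℝ) - 1) / 2 < a.re →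
    ∀ {κ : Fin m → ℕ}, Antitone κ →
    Integrable (fun r : Upper m → ℝ =>
      (generalizedPower κ (symmetricOfUpper r) : ℂ) * coneDensity a r) ∧
    ∫ r : Upper m → ℝ, (generalizedPower κ (symmetricOfUpper r) : ℂ) * coneDensity a r =
      ∏ j : Fin m, ((√Real.pi : ℂ) ^ (j : ℕ) * Complex.Gamma (a + κ j - (j : ℂ) / 2))
  | 0, a, _, κ, _ => by
    have h : ∀ r : Upper 0 → ℝ,
        (generalizedPower κ (symmetricOfUpper r) : ℂ) * coneDensity a r = 1 := by
      intro r
      have : (symmetricOfUpper r).PosDef := by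
        rw [Subsingleton.elim (symmetricOfUpper r) 1]
        exact Matrix.PosDef.one
      rw [coneDensity, Set.indicator_of_mem (by exact this)]
      simp [generalizedPower]
    -- With no coordinates, Lebesgue measure is a unit point mass.
    have hv : (volume : Measure (Upper 0 → ℝ)) Set.univ = 1 := by
      rw [volume_pi, Measure.pi_of_empty]
      simp
    have : IsFiniteMeasure (volume : Measure (Upper 0 → ℝ)) := ⟨by rw [hv]; simp⟩
    simp only [h]
    exact ⟨integrable_const _, by simp [Measure.real, hv]⟩
  | m + 1, a, ha, κ, hκ => by
    push_cast at ha
    obtain ⟨ih1, ih2⟩ := integral_generalizedPower_coneDensity (m := m) (a := a) (by linarith)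
      (κ := fun i => κ i.castSucc) fun i j hij => hκ (Fin.castSucc_le_castSucc_iff.2 hij)
    have hs : 0 < (a + (κ (Fin.last m) : ℂ) - (m : ℂ) / 2).re := by
      have : ((m : ℂ) / 2).re = m / 2 := by
        rw [show (m : ℂ) / 2 = ((m / 2 : ℝ) : ℂ) by push_cast; rfl, Complex.ofReal_re]
      rw [Complex.sub_re, Complex.add_re, this, Complex.natCast_re]
      have : (0 : ℝ) ≤ κ (Fin.last m) := Nat.cast_nonneg _
      linarith
    obtain ⟨h1, h2⟩ := integral_border ih1 (fun x hx => by
      rw [coneDensity, Set.indicator_of_notMem (by exact hx), mul_zero])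
      (measurable_gammaDensity _) (integrable_gammaDensity hs)
    have hmp := measurePreserving_borderEquiv m
    simp only [generalizedPower_mul_coneDensity_succ a hκ]
    constructor
    · exact (hmp.integrable_comp_emb (borderEquiv m).measurableEmbedding).2 h1
    · have := hmp.integral_comp (borderEquiv m).measurableEmbedding
        fun z : (Upper m → ℝ) × ((Fin m → ℝ) × ℝ) =>
          ((generalizedPower (fun i => κ i.castSucc) (symmetricOfUpper z.1) : ℂ) *
            coneDensity a z.1) *
            borderDensity (gammaDensity (a + κ (Fin.last m) - m / 2)) z.1 z.2
      rw [this, h2, ih2, integral_gammaDensity hs, Fin.prod_univ_castSucc]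
      simp

end ConeIntegral

/-! ### The multivariate gamma function as a product -/

section GammaFunction

variable {m : ℕ}

theorem generalizedPower_zero (Y : Matrix (Fin m) (Fin m) ℝ) : generalizedPower 0 Y = 1 := by
  simp [generalizedPower]

theorem natCast_div_two_re (n : ℕ) : ((n : ℂ) / 2).re = n / 2 := by
  rw [show (n : ℂ) / 2 = ((n / 2 : ℝ) : ℂ) by push_cast; rfl, Complex.ofReal_re]

theorem shifted_re_pos {a : ℂ} (ha : ((m : ℝ) - 1) / 2 < a.re) (j : Fin m) :
    0 < (a - (j : ℂ) / 2).re := by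
  rw [Complex.sub_re, natCast_div_two_re]
  have : (j : ℝ) + 1 ≤ m := by exact_mod_cast j.2
  linarith

theorem integrable_coneDensity {a : ℂ} (ha : ((m : ℝ) - 1) / 2 < a.re) :
    Integrable (coneDensity a : (Upper m → ℝ) → ℂ) := by
  simpa [generalizedPower_zero] using
    (integral_generalizedPower_coneDensity ha (κ := 0) antitone_const).1

theorem multivariateGamma_eq_prod {a : ℂ} (ha : ((m : ℝ) - 1) / 2 < a.re) :
    multivariateGamma m a =
      ∏ j : Fin m, ((√Real.pi : ℂ) ^ (j : ℕ) * Complex.Gamma (a - (j : ℂ) / 2)) := by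
  simpa [generalizedPower_zero, multivariateGamma_eq_integral] using
    (integral_generalizedPower_coneDensity ha (κ := 0) antitone_const).2

theorem multivariateGamma_ne_zero {a : ℂ} (ha : ((m : ℝ) - 1) / 2 < a.re) :
    multivariateGamma m a ≠ 0 := by
  rw [multivariateGamma_eq_prod ha]
  refine Finset.prod_ne_zero_iff.2 fun j _ => mul_ne_zero (pow_ne_zero _ ?_)
    (Complex.Gamma_ne_zero_of_re_pos (shifted_re_pos ha j))
  exact_mod_cast (Real.sqrt_pos.2 Real.pi_pos).ne'

theorem gamma_add_natCast {s : ℂ} (hs : 0 < s.re) (n : ℕ) :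
    Complex.Gamma (s + n) = (ascPochhammer ℂ n).eval s * Complex.Gamma s := by
  rw [← Complex.Gamma_add_nat_div_Gamma_eq s fun k hk => ?_,
    div_mul_cancel₀ _ (Complex.Gamma_ne_zero_of_re_pos hs)]
  rw [hk] at hs
  simp at hs
  have : (0 : ℝ) ≤ k := Nat.cast_nonneg k
  linarith

theorem partitionalFactorial_ne_zero {a : ℂ} (ha : ((m : ℝ) - 1) / 2 < a.re) (κ : Fin m → ℕ) :
    partitionalFactorial a κ ≠ 0 := by
  refine Finset.prod_ne_zero_iff.2 fun j _ => ?_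
  have h := gamma_add_natCast (shifted_re_pos ha j) (κ j)
  intro h0
  rw [h0, zero_mul] at h
  refine Complex.Gamma_ne_zero_of_re_pos ?_ h
  have := shifted_re_pos ha j
  rw [Complex.add_re, Complex.natCast_re]
  positivity

theorem integral_generalizedPower_eq_partitionalFactorial {a : ℂ} (ha : ((m : ℝ) - 1) / 2 < a.re)
    {κ : Fin m → ℕ} (hκ : Antitone κ) :
    ∫ r : Upper m → ℝ, (generalizedPower κ (symmetricOfUpper r) : ℂ) * coneDensity a r =
      partitionalFactorial a κ * multivariateGamma m a := by
  rw [(integral_generalizedPower_coneDensity ha hκ).2, multivariateGamma_eq_prod ha,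
    partitionalFactorial, ← Finset.prod_mul_distrib]
  refine Finset.prod_congr rfl fun j _ => ?_
  rw [show a + κ j - (j : ℂ) / 2 = (a - (j : ℂ) / 2) + κ j by ring,
    gamma_add_natCast (shifted_re_pos ha j)]
  ring

end GammaFunction

/-! ### Integration over square matrices -/

section Entries

variable {m : ℕ}

/-- The square matrix with the given entries. -/
def ofEntries (q : Fin m × Fin m → ℝ) : Matrix (Fin m) (Fin m) ℝ := Matrix.of fun i j => q (i, j)

theorem continuous_ofEntries : Continuous (ofEntries (m := m)) :=
  continuous_pi fun _ => continuous_pi fun _ => continuous_apply _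

/-- Exhibits Q ↦ AQB as a linear map on the entries, whose Jacobian is then a Kronecker determinant.
-/
theorem ofEntries_kronecker_mulVec (A B : Matrix (Fin m) (Fin m) ℝ) (q : Fin m × Fin m → ℝ) :
    ofEntries ((A ⊗ₖ Bᵀ) *ᵥ q) = A * ofEntries q * B := by
  ext i j
  simp only [ofEntries, Matrix.of_apply, Matrix.mulVec, dotProduct, Matrix.mul_apply,
    Matrix.kroneckerMap_apply, Matrix.transpose_apply, Finset.sum_mul]
  rw [Fintype.sum_prod_type_right]
  refine Finset.sum_congr rfl fun k _ => Finset.sum_congr rfl fun l _ => ?_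
  ring

theorem det_kronecker_transpose (A B : Matrix (Fin m) (Fin m) ℝ) :
    (A ⊗ₖ Bᵀ).det = (A.det * B.det) ^ m := by
  rw [Matrix.det_kronecker, Matrix.det_transpose, mul_pow, Fintype.card_fin]

theorem integral_comp_mul_mul {E : Type*} [NormedAddCommGroup E] [NormedSpace ℝ E]
    {A B : Matrix (Fin m) (Fin m) ℝ} (hA : A.det ≠ 0) (hB : B.det ≠ 0)
    (f : Matrix (Fin m) (Fin m) ℝ → E) :
    ∫ q, f (A * ofEntries q * B) = |(A.det * B.det) ^ m|⁻¹ • ∫ q, f (ofEntries q) := by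
  have h := integral_comp_mulVec (M := A ⊗ₖ Bᵀ)
    (by rw [det_kronecker_transpose]; exact pow_ne_zero _ (mul_ne_zero hA hB))
    fun q => f (ofEntries q)
  simpa only [ofEntries_kronecker_mulVec, det_kronecker_transpose] using h

theorem integrable_comp_mul_mul {E : Type*} [NormedAddCommGroup E]
    {A B : Matrix (Fin m) (Fin m) ℝ} (hA : A.det ≠ 0) (hB : B.det ≠ 0)
    {f : Matrix (Fin m) (Fin m) ℝ → E} :
    Integrable (fun q => f (A * ofEntries q * B)) ↔ Integrable fun q => f (ofEntries q) := by
  have h := integrable_comp_mulVec (M := A ⊗ₖ Bᵀ)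
    (by rw [det_kronecker_transpose]; exact pow_ne_zero _ (mul_ne_zero hA hB))
    (f := fun q => f (ofEntries q))
  simpa only [ofEntries_kronecker_mulVec] using h

theorem trace_mul_transpose_ofEntries (q : Fin m × Fin m → ℝ) :
    (ofEntries q * (ofEntries q)ᵀ).trace = q ⬝ᵥ q := by
  simp only [Matrix.trace, Matrix.diag_apply, Matrix.mul_apply, Matrix.transpose_apply, dotProduct,
    Fintype.sum_prod_type, ofEntries, Matrix.of_apply]

/-- The density `det (1 - QQᵀ) ^ c` on the matrix ball `QQᵀ < 1`. -/
noncomputable def ballDensity (c : ℂ) (Q : Matrix (Fin m) (Fin m) ℝ) : ℂ :=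
  {Q : Matrix (Fin m) (Fin m) ℝ | (1 - Q * Qᵀ).PosDef}.indicator
    (fun Q => ((1 - Q * Qᵀ).det : ℂ) ^ c) Q

/-- The density `exp (-tr QQᵀ)`. -/
noncomputable def gaussianDensity (Q : Matrix (Fin m) (Fin m) ℝ) : ℂ :=
  Complex.exp (-((Q * Qᵀ).trace : ℂ))

theorem measurable_ballDensity (c : ℂ) :
    Measurable (ballDensity c : Matrix (Fin m) (Fin m) ℝ → ℂ) := by
  have h : Continuous fun Q : Matrix (Fin m) (Fin m) ℝ => 1 - Q * Qᵀ := by fun_prop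
  exact Measurable.indicator
    ((Complex.continuous_ofReal.comp h.matrix_det).measurable.pow_const _)
    (h.measurable (measurableSet_posDef m))

theorem continuous_gaussianDensity :
    Continuous (gaussianDensity : Matrix (Fin m) (Fin m) ℝ → ℂ) := by
  have h : Continuous fun Q : Matrix (Fin m) (Fin m) ℝ => Q * Qᵀ := by fun_prop
  exact Complex.continuous_exp.comp (Complex.continuous_ofReal.comp h.matrix_trace).neg

theorem gaussianDensity_ofEntries (q : Fin m × Fin m → ℝ) :
    gaussianDensity (ofEntries q) = (Real.exp (-(q ⬝ᵥ q)) : ℝ) := by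
  rw [gaussianDensity, trace_mul_transpose_ofEntries]
  push_cast
  rfl

theorem integrable_gaussianDensity :
    Integrable fun q : Fin m × Fin m → ℝ => gaussianDensity (ofEntries q) := by
  simp only [gaussianDensity_ofEntries]
  exact integrable_exp_neg_dotProduct.ofReal

end Entries

/-! ### Cone, ball and Gaussian integrals -/

section BallIntegral

variable {m : ℕ}

/-- The entries on and above the diagonal. -/
def upperEntries (S : Matrix (Fin m) (Fin m) ℝ) : Upper m → ℝ := fun p => S p.1.1 p.1.2

theorem symmetricOfUpper_upperEntries {S : Matrix (Fin m) (Fin m) ℝ} (hS : Sᵀ = S) :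
    symmetricOfUpper (upperEntries S) = S := by
  ext i j
  rcases le_total i j with h | h
  · simp [symmetricOfUpper, upperEntries, h]
  · simp only [symmetricOfUpper, upperEntries, Matrix.of_apply, min_eq_right h, max_eq_left h]
    conv_rhs => rw [← hS]
    rfl

theorem symmetricOfUpper_sub (r s : Upper m → ℝ) :
    symmetricOfUpper (r - s) = symmetricOfUpper r - symmetricOfUpper s := rfl

theorem measurePreserving_sub_snd_group {X G : Type*} [MeasureSpace X]
    [SFinite (volume : Measure X)] [MeasureSpace G] [AddGroup G] [MeasurableAdd₂ G]
    [MeasurableNeg G] [SFinite (volume : Measure G)]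
    [(volume : Measure G).IsAddRightInvariant] {q : X → G} (hq : Measurable q) :
    MeasurePreserving (fun p : X × G => (p.1, p.2 - q p.1)) := by
  refine (MeasurePreserving.id (volume : Measure X)).skew_product (g := fun x t => t - q x)
    (by simp only [sub_eq_add_neg]; fun_prop) (ae_of_all _ fun x => ?_)
  simp only [sub_eq_add_neg]
  exact (measurePreserving_add_right volume (-q x)).map_eq

/-- The joint density of a Gaussian matrix `N` and `R = S + NNᵀ`, with `S` on the cone. -/
noncomputable def jointDensity (b : ℂ) (f : Matrix (Fin m) (Fin m) ℝ → ℂ)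
    (z : (Fin m × Fin m → ℝ) × (Upper m → ℝ)) : ℂ :=
  (f (ofEntries z.1) * gaussianDensity (ofEntries z.1)) *
    coneDensity b (z.2 - upperEntries (ofEntries z.1 * (ofEntries z.1)ᵀ))

/-- Translating R by -NNᵀ for fixed N preserves volume and turns the joint density into a product.
-/
theorem integral_jointDensity {b : ℂ} (hb : ((m : ℝ) - 1) / 2 < b.re)
    {f : Matrix (Fin m) (Fin m) ℝ → ℂ}
    (hf : Integrable fun q => f (ofEntries q) * gaussianDensity (ofEntries q)) :
    Integrable (jointDensity b f) ∧ ∫ z, jointDensity b f z =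
      (∫ q, f (ofEntries q) * gaussianDensity (ofEntries q)) * multivariateGamma m b := by
  have hs := measurePreserving_sub_snd_group (X := Fin m × Fin m → ℝ) (G := Upper m → ℝ)
    (q := fun q => upperEntries (ofEntries q * (ofEntries q)ᵀ)) (by
      refine Continuous.measurable (continuous_pi fun p => ?_)
      have h := continuous_ofEntries (m := m)
      exact (h.matrix_mul h.matrix_transpose).matrix_elem _ _)
  have hprod : Integrable fun z : (Fin m × Fin m → ℝ) × (Upper m → ℝ) =>
      (f (ofEntries z.1) * gaussianDensity (ofEntries z.1)) * coneDensity b z.2 :=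
    hf.mul_prod (integrable_coneDensity hb)
  constructor
  · exact (hs.integrable_comp hprod.aestronglyMeasurable).2 hprod
  · have := integral_map hs.measurable.aemeasurable
      (f := fun z : (Fin m × Fin m → ℝ) × (Upper m → ℝ) =>
        (f (ofEntries z.1) * gaussianDensity (ofEntries z.1)) * coneDensity b z.2)
      (by rw [hs.map_eq]; exact hprod.aestronglyMeasurable)
    rw [hs.map_eq] at this
    rw [multivariateGamma_eq_integral]
    refine this.symm.trans ?_
    rw [Measure.volume_eq_prod]
    exact integral_prod_mul (fun q => f (ofEntries q) * gaussianDensity (ofEntries q))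
      (coneDensity b)

/-- If S = R - NNᵀ is positive definite, then so is R, being S plus a positive semidefinite matrix.
-/
theorem jointDensity_of_not_posDef (b : ℂ) (f : Matrix (Fin m) (Fin m) ℝ → ℂ)
    {r : Upper m → ℝ} (hr : ¬(symmetricOfUpper r).PosDef) (q : Fin m × Fin m → ℝ) :
    jointDensity b f (q, r) = 0 := by
  rw [jointDensity, coneDensity, Set.indicator_of_notMem, mul_zero]
  intro h
  simp only [Set.mem_ofPred_eq] at h
  rw [symmetricOfUpper_sub, symmetricOfUpper_upperEntries (by simp)] at h
  apply hr
  have := h.add_posSemidef (posSemidef_mul_transpose (ofEntries q))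
  rwa [sub_add_cancel] at this

/-- The joint density as a function of a matrix. -/
theorem jointDensity_sqrt (a : ℂ) (f : Matrix (Fin m) (Fin m) ℝ → ℂ)
    {r : Upper m → ℝ} (hr : (symmetricOfUpper r).PosDef) (q : Fin m × Fin m → ℝ)
    {Q : Matrix (Fin m) (Fin m) ℝ} (hq : ofEntries q = CFC.sqrt (symmetricOfUpper r) * Q) :
    jointDensity (a - m / 2) f (q, r) =
      (((symmetricOfUpper r).det : ℂ) ^ (a - m - 1 / 2) *
        Complex.exp (-((symmetricOfUpper r).trace : ℂ))) *
      (f (CFC.sqrt (symmetricOfUpper r) * Q) * ballDensity (a - m - 1 / 2) Q) := by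
  obtain ⟨hB, hBt, hBB⟩ := posDef_sqrt hr
  have hdet := det_sqrt_posDef hr
  have hrd := hr.det_pos
  set R := symmetricOfUpper r
  set B := CFC.sqrt R
  -- Under N = R^{1/2} Q the cone variable S = R - NNᵀ becomes R^{1/2} (1 - QQᵀ) R^{1/2}, so S > 0
  -- is the condition that Q lies in the ball.
  have hsub : symmetricOfUpper (r - upperEntries (ofEntries q * (ofEntries q)ᵀ)) =
      B * (1 - Q * Qᵀ) * Bᵀ := by
    rw [symmetricOfUpper_sub, symmetricOfUpper_upperEntries (by simp), hq, Matrix.transpose_mul,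
      hBt, Matrix.mul_sub, Matrix.sub_mul, Matrix.mul_one, hBB]
    simp only [Matrix.mul_assoc]
    rfl
  have hiff : (B * (1 - Q * Qᵀ) * Bᵀ).PosDef ↔ (1 - Q * Qᵀ).PosDef :=
    posDef_conj_iff hB.isUnit
  rw [jointDensity, coneDensity, ballDensity, hq]
  by_cases hQ : (1 - Q * Qᵀ).PosDef
  · rw [Set.indicator_of_mem (by rw [Set.mem_ofPred_eq, ← hq, hsub]; exact hiff.2 hQ),
      Set.indicator_of_mem (by exact hQ), ← hq, hsub]
    have hd : (B * (1 - Q * Qᵀ) * Bᵀ).det = R.det * (1 - Q * Qᵀ).det := by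
      rw [Matrix.det_mul, Matrix.det_mul, Matrix.det_transpose, ← hBB, Matrix.det_mul]; ring
    have htr : (B * (1 - Q * Qᵀ) * Bᵀ).trace = R.trace - (ofEntries q * (ofEntries q)ᵀ).trace := by
      rw [← hsub, symmetricOfUpper_sub, symmetricOfUpper_upperEntries (by simp),
        Matrix.trace_sub]
    -- The Gaussian factor exp(-tr NNᵀ) combines with exp(-tr S) to exp(-tr R), so no exponential in
    -- Q survives.
    rw [hd, htr, gaussianDensity, Complex.ofReal_mul,
      Complex.mul_cpow_ofReal_nonneg hrd.le hQ.det_pos.le,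
      show a - (m : ℂ) / 2 - ((m : ℂ) + 1) / 2 = a - m - 1 / 2 by ring, Complex.ofReal_sub,
      neg_sub, Complex.exp_sub, Complex.exp_neg, Complex.exp_neg]
    have := Complex.exp_ne_zero (((ofEntries q * (ofEntries q)ᵀ).trace : ℝ) : ℂ)
    field_simp
  · rw [Set.indicator_of_notMem (by rw [Set.mem_ofPred_eq, ← hq, hsub]; exact fun h => hQ (hiff.1 h)),
      Set.indicator_of_notMem (by exact hQ)]
    simp

/-- The family of entries of a square matrix. -/
def entriesOf (Q : Matrix (Fin m) (Fin m) ℝ) : Fin m × Fin m → ℝ := fun p => Q p.1 p.2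

theorem ofEntries_entriesOf (Q : Matrix (Fin m) (Fin m) ℝ) : ofEntries (entriesOf Q) = Q := rfl

/-- The Jacobian of Q ↦ R^{1/2} Q is (det R)^{m/2}. It raises the exponent a - m - 1/2 of det R to a
- (m+1)/2, the one in the cone density with parameter a. -/
theorem jointDensity_fiber (a : ℂ) (f : Matrix (Fin m) (Fin m) ℝ → ℂ)
    {r : Upper m → ℝ} (hr : (symmetricOfUpper r).PosDef) :
    (Integrable (fun q => jointDensity (a - m / 2) f (q, r)) ↔
      Integrable fun q => f (CFC.sqrt (symmetricOfUpper r) * ofEntries q) *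
        ballDensity (a - m - 1 / 2) (ofEntries q)) ∧
    ∫ q, jointDensity (a - m / 2) f (q, r) = coneDensity a r *
      ∫ q, f (CFC.sqrt (symmetricOfUpper r) * ofEntries q) *
        ballDensity (a - m - 1 / 2) (ofEntries q) := by
  have hB := (posDef_sqrt hr).1
  have hBd := det_sqrt_posDef hr
  have hone : (1 : Matrix (Fin m) (Fin m) ℝ).det ≠ 0 := by simp
  have hrd := hr.det_pos
  have hmem : r ∈ {r : Upper m → ℝ | (symmetricOfUpper r).PosDef} := hr
  have hcone : coneDensity a r = ((symmetricOfUpper r).det : ℂ) ^ (a - ((m : ℂ) + 1) / 2) *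
      Complex.exp (-((symmetricOfUpper r).trace : ℂ)) := Set.indicator_of_mem hmem _
  rw [hcone]
  have key := fun q => jointDensity_sqrt a f hr
    (entriesOf (CFC.sqrt (symmetricOfUpper r) * ofEntries q * 1)) (Q := ofEntries q)
    (by rw [ofEntries_entriesOf, Matrix.mul_one])
  set R := symmetricOfUpper r
  set B := CFC.sqrt R
  set F : Matrix (Fin m) (Fin m) ℝ → ℂ := fun Q =>
    jointDensity (a - m / 2) f (entriesOf Q, r) with hF
  have hF' : (fun q => jointDensity (a - m / 2) f (q, r)) = fun q => F (ofEntries q) := rfl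
  have hRc : (R.det : ℂ) ≠ 0 := by exact_mod_cast hrd.ne'
  rw [hF']
  constructor
  · rw [← integrable_comp_mul_mul hB.det_pos.ne' hone]
    simp only [hF, key]
    rw [integrable_const_mul_iff]
    exact (mul_ne_zero (by rw [Complex.cpow_def_of_ne_zero hRc]; exact Complex.exp_ne_zero _)
      (Complex.exp_ne_zero _)).isUnit
  · have h := integral_comp_mul_mul hB.det_pos.ne' hone F
    have hpos : 0 < |(B.det * (1 : Matrix (Fin m) (Fin m) ℝ).det) ^ m| :=
      abs_pos.2 (pow_ne_zero _ (mul_ne_zero hB.det_pos.ne' hone))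
    rw [eq_inv_smul_iff₀ hpos.ne'] at h
    rw [← h]
    simp only [hF, key]
    rw [integral_const_mul, Matrix.det_one, mul_one, abs_of_pos (pow_pos hB.det_pos m), hBd,
      Complex.real_smul, ← mul_assoc, ← mul_assoc]
    congr 2
    rw [Complex.ofReal_pow, Real.sqrt_eq_rpow, Complex.ofReal_cpow hrd.le, ← Complex.cpow_nat_mul,
      ← Complex.cpow_add _ _ hRc]
    congr 1
    push_cast
    ring

/-- The joint density is integrated in both orders: over R first it gives a Gaussian integral times
a gamma function, over N first the ball integral. This identity is used twice, with a generalized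
power for the eigenvalues and with a cosine for the Laplace integral. -/
theorem integral_cone_ball {a : ℂ} (ha : ((m : ℝ) - 1) / 2 < (a - (m : ℂ) / 2).re)
    {f : Matrix (Fin m) (Fin m) ℝ → ℂ}
    (hf : Integrable fun q => f (ofEntries q) * gaussianDensity (ofEntries q)) :
    Integrable (fun r : Upper m → ℝ => coneDensity a r *
      ∫ q, f (CFC.sqrt (symmetricOfUpper r) * ofEntries q) *
        ballDensity (a - m - 1 / 2) (ofEntries q)) ∧
    ∫ r : Upper m → ℝ, coneDensity a r *
      ∫ q, f (CFC.sqrt (symmetricOfUpper r) * ofEntries q) *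
        ballDensity (a - m - 1 / 2) (ofEntries q) =
    (∫ q, f (ofEntries q) * gaussianDensity (ofEntries q)) *
      multivariateGamma m (a - (m : ℂ) / 2) := by
  obtain ⟨h1, h2⟩ := integral_jointDensity ha hf
  have heq : (fun r : Upper m → ℝ => coneDensity a r *
      ∫ q, f (CFC.sqrt (symmetricOfUpper r) * ofEntries q) *
        ballDensity (a - m - 1 / 2) (ofEntries q)) =
      fun r => ∫ q, jointDensity (a - m / 2) f (q, r) := by
    ext r
    by_cases hr : (symmetricOfUpper r).PosDef
    · rw [(jointDensity_fiber a f hr).2]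
    · simp only [jointDensity_of_not_posDef _ f hr, integral_zero]
      rw [coneDensity, Set.indicator_of_notMem (by exact hr), zero_mul]
  rw [heq]
  rw [Measure.volume_eq_prod] at h1 h2
  exact ⟨h1.integral_prod_right, by rw [← h2, integral_prod_symm _ h1]⟩

theorem half_re_sub {a : ℂ} (ha : ((m : ℝ) - 1) / 2 < (a - (m : ℂ) / 2).re) :
    ((m : ℝ) - 1) / 2 < a.re := by
  rw [Complex.sub_re, natCast_div_two_re] at ha
  have : (0 : ℝ) ≤ m := Nat.cast_nonneg m
  linarith

/-- The joint density with f = 1 is integrable, so almost every fibre is. A fibre over R > 0 is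
integrable only if the ball density is; were it not, almost every R would lie off the cone and
Γ_m(a) would vanish. -/
theorem integrable_ballDensity {a : ℂ} (ha : ((m : ℝ) - 1) / 2 < (a - (m : ℂ) / 2).re) :
    Integrable fun q : Fin m × Fin m → ℝ => ballDensity (a - m - 1 / 2) (ofEntries q) := by
  have h1 := (integral_jointDensity (f := fun _ => 1) ha
    (by simpa using integrable_gaussianDensity)).1
  rw [Measure.volume_eq_prod] at h1
  have h2 := h1.prod_left_ae
  by_contra hcon
  refine multivariateGamma_ne_zero (half_re_sub ha) ?_
  rw [multivariateGamma_eq_integral]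
  refine integral_eq_zero_of_ae ?_
  filter_upwards [h2] with r hr
  by_cases hpd : (symmetricOfUpper r).PosDef
  · exact absurd (by simpa using ((jointDensity_fiber a _ hpd).1.1 hr)) hcon
  · exact Set.indicator_of_notMem (by exact hpd) _

end BallIntegral

/-! ### Triangular factorization and generalized powers -/

section Triangular

variable {m : ℕ}

/-- The first k rows of a lower triangular matrix vanish outside the first k columns. -/
theorem submatrix_lower_mul {L : Matrix (Fin m) (Fin m) ℝ} (hL : ∀ i j, i < j → L i j = 0)
    {l : Type*} {k : ℕ} (hk : k ≤ m) (W : Matrix (Fin m) (Fin m) ℝ) (g : l → Fin m) :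
    (L * W).submatrix (Fin.castLE hk) g =
      L.submatrix (Fin.castLE hk) (Fin.castLE hk) * W.submatrix (Fin.castLE hk) g := by
  ext i j
  simp only [Matrix.submatrix_apply, Matrix.mul_apply]
  refine (Fintype.sum_of_injective (Fin.castLE hk) (Fin.castLE_injective hk) _ _ ?_ ?_).symm
  · intro a ha
    rw [hL, zero_mul]
    by_contra hlt
    refine ha ⟨⟨a, ?_⟩, rfl⟩
    have h1 : (a : ℕ) ≤ i := by simpa [Fin.le_def] using not_lt.1 hlt
    exact h1.trans_lt i.2
  · intro a
    rfl

theorem leadingMinor_lower_conj {L : Matrix (Fin m) (Fin m) ℝ} (hL : ∀ i j, i < j → L i j = 0)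
    (Z : Matrix (Fin m) (Fin m) ℝ) (j : Fin m) :
    leadingMinor (L * Z * Lᵀ) j = leadingMinor L j ^ 2 * leadingMinor Z j := by
  have h1 := submatrix_lower_mul hL (Nat.succ_le_of_lt j.2) (Z * Lᵀ)
    (Fin.castLE (Nat.succ_le_of_lt j.2))
  have h2 := congrArg Matrix.transpose (submatrix_lower_mul hL (Nat.succ_le_of_lt j.2) Zᵀ
    (Fin.castLE (Nat.succ_le_of_lt j.2)))
  simp only [Matrix.transpose_mul, Matrix.transpose_submatrix, Matrix.transpose_transpose] at h2
  rw [← Matrix.mul_assoc, h2] at h1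
  simp only [leadingMinor]
  rw [h1, Matrix.det_mul, Matrix.det_mul, ← Matrix.transpose_submatrix, Matrix.det_transpose]
  ring

theorem leadingMinor_one (j : Fin m) : leadingMinor (1 : Matrix (Fin m) (Fin m) ℝ) j = 1 := by
  rw [leadingMinor, Matrix.submatrix_one _ (Fin.castLE_injective _), Matrix.det_one]

theorem generalizedPower_one (κ : Fin m → ℕ) :
    generalizedPower κ (1 : Matrix (Fin m) (Fin m) ℝ) = 1 := by
  simp [generalizedPower, leadingMinor_one]

/-- Leading minors are multiplicative under conjugation by lower triangular matrices. This is the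
property that makes the averaged powers eigenfunctions. -/
theorem generalizedPower_lower_conj {L : Matrix (Fin m) (Fin m) ℝ}
    (hL : ∀ i j, i < j → L i j = 0) (κ : Fin m → ℕ) (Z : Matrix (Fin m) (Fin m) ℝ) :
    generalizedPower κ (L * Z * Lᵀ) = generalizedPower κ (L * Lᵀ) * generalizedPower κ Z := by
  simp only [generalizedPower]
  rw [← Finset.prod_mul_distrib]
  refine Finset.prod_congr rfl fun j _ => ?_
  have h := leadingMinor_lower_conj hL 1 j
  rw [Matrix.mul_one, leadingMinor_one, mul_one] at h
  rw [leadingMinor_lower_conj hL, h, mul_pow]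

theorem mem_orthogonal_of_mul_transpose {H : Matrix (Fin m) (Fin m) ℝ} (h : H * Hᵀ = 1) :
    H ∈ Matrix.orthogonalGroup (Fin m) ℝ :=
  (Matrix.mem_orthogonalGroup_iff (Fin m) ℝ).2 h

theorem orthogonal_mul_transpose (H : Matrix.orthogonalGroup (Fin m) ℝ) :
    (H : Matrix (Fin m) (Fin m) ℝ) * (H : Matrix (Fin m) (Fin m) ℝ)ᵀ = 1 :=
  (Matrix.mem_orthogonalGroup_iff (Fin m) ℝ).1 H.2

theorem orthogonal_transpose_mul (H : Matrix.orthogonalGroup (Fin m) ℝ) :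
    (H : Matrix (Fin m) (Fin m) ℝ)ᵀ * (H : Matrix (Fin m) (Fin m) ℝ) = 1 :=
  (Matrix.mem_orthogonalGroup_iff' (Fin m) ℝ).1 H.2

/-- Two square roots of the same matrix differ by an orthogonal factor. -/
theorem exists_orthogonal_of_mul_transpose_eq {K M : Matrix (Fin m) (Fin m) ℝ} (hK : IsUnit K.det)
    (h : M * Mᵀ = K * Kᵀ) :
    ∃ H : Matrix.orthogonalGroup (Fin m) ℝ, M = K * H := by
  refine ⟨⟨K⁻¹ * M, mem_orthogonal_of_mul_transpose ?_⟩, ?_⟩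
  · rw [Matrix.transpose_mul, Matrix.mul_assoc, ← Matrix.mul_assoc M, h, Matrix.mul_assoc K,
      ← Matrix.mul_assoc, Matrix.nonsing_inv_mul _ hK, Matrix.one_mul, ← Matrix.transpose_mul,
      Matrix.nonsing_inv_mul _ hK, Matrix.transpose_one]
  · simp only [← Matrix.mul_assoc, Matrix.mul_nonsing_inv _ hK, Matrix.one_mul]

theorem posDef_mul_transpose {K : Matrix (Fin m) (Fin m) ℝ} (hK : IsUnit K.det) :
    (K * Kᵀ).PosDef := by
  have := (posDef_conj_iff (A := 1) ((Matrix.isUnit_iff_isUnit_det K).2 hK)).2 Matrix.PosDef.one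
  rwa [Matrix.mul_one] at this

/-- The LDL decomposition gives a lower triangular U with U S Uᵀ = D diagonal and positive; the
factor is U⁻¹ √D. -/
theorem exists_cholesky {S : Matrix (Fin m) (Fin m) ℝ} (hS : S.PosDef) :
    ∃ L : Matrix (Fin m) (Fin m) ℝ, (∀ i j, i < j → L i j = 0) ∧ IsUnit L.det ∧ L * Lᵀ = S := by
  set U := LDL.lowerInv hS with hU
  have hUinv : Invertible U := LDL.invertibleLowerInv hS
  have hUdet : IsUnit U.det := Matrix.isUnit_det_of_invertible U
  have hUtri : U.BlockTriangular OrderDual.toDual := fun i j hij => LDL.lowerInv_triangular hS hij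
  have hD : Matrix.diagonal (LDL.diagEntries hS) = U * S * Uᵀ := by
    have := LDL.diag_eq_lowerInv_conj hS
    rwa [LDL.diag, Matrix.conjTranspose_eq_transpose_of_trivial] at this
  have hDpos : ∀ i, 0 < LDL.diagEntries hS i := by
    have : (Matrix.diagonal (LDL.diagEntries hS)).PosDef := by
      rw [hD]
      exact (posDef_conj_iff ((Matrix.isUnit_iff_isUnit_det U).2 hUdet)).2 hS
    exact Matrix.posDef_diagonal_iff.1 this
  have hinv : U⁻¹.BlockTriangular OrderDual.toDual :=
    Matrix.blockTriangular_inv_of_blockTriangular hUtri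
  have hprod : (U⁻¹ * Matrix.diagonal fun i => √(LDL.diagEntries hS i)) *
      (U⁻¹ * Matrix.diagonal fun i => √(LDL.diagEntries hS i))ᵀ = S := by
    have hsq : (Matrix.diagonal fun i => √(LDL.diagEntries hS i)) *
        (Matrix.diagonal fun i => √(LDL.diagEntries hS i)) = U * S * Uᵀ := by
      rw [← hD, Matrix.diagonal_mul_diagonal]
      congr 1
      ext i
      exact Real.mul_self_sqrt (hDpos i).le
    rw [Matrix.transpose_mul, Matrix.diagonal_transpose, Matrix.mul_assoc,
      ← Matrix.mul_assoc (Matrix.diagonal _), hsq, Matrix.transpose_nonsing_inv]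
    have hUt : IsUnit Uᵀ.det := by rwa [Matrix.det_transpose]
    rw [Matrix.mul_assoc, Matrix.mul_nonsing_inv _ hUt, Matrix.mul_one, ← Matrix.mul_assoc,
      Matrix.nonsing_inv_mul _ hUdet, Matrix.one_mul]
  refine ⟨U⁻¹ * Matrix.diagonal fun i => √(LDL.diagEntries hS i), fun i j hij => ?_, ?_, hprod⟩
  · rw [Matrix.mul_diagonal, hinv (by simpa using hij), zero_mul]
  · have h := congrArg Matrix.det hprod
    rw [Matrix.det_mul, Matrix.det_transpose] at h
    exact isUnit_of_mul_isUnit_left (h ▸ posDef_isUnit_det hS)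

end Triangular

/-! ### Growth bounds for integrability -/

section Bounds

variable {m : ℕ}

theorem continuous_generalizedPower (κ : Fin m → ℕ) :
    Continuous (generalizedPower κ : Matrix (Fin m) (Fin m) ℝ → ℝ) := by
  refine continuous_finsetProd _ fun j _ => Continuous.pow ?_ _
  exact Continuous.matrix_det (continuous_id.matrix_submatrix _ _)

/-- Every eigenvalue is nonnegative and at most the sum of all of them. -/
theorem det_le_trace_pow {n : ℕ} {A : Matrix (Fin n) (Fin n) ℝ} (hA : A.PosSemidef) :
    A.det ≤ A.trace ^ n := by
  have h1 : A.det = ∏ i, hA.1.eigenvalues i := by simpa using hA.1.det_eq_prod_eigenvalues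
  have h2 : A.trace = ∑ i, hA.1.eigenvalues i := by simpa using hA.1.trace_eq_sum_eigenvalues
  calc A.det ≤ ∏ _i : Fin n, A.trace := by
        rw [h1]
        refine Finset.prod_le_prod (fun i _ => hA.eigenvalues_nonneg i) fun i _ => ?_
        rw [h2]
        exact Finset.single_le_sum (fun j _ => hA.eigenvalues_nonneg j) (Finset.mem_univ i)
    _ = A.trace ^ n := by simp

theorem leadingMinor_nonneg {Z : Matrix (Fin m) (Fin m) ℝ} (hZ : Z.PosSemidef) (j : Fin m) :
    0 ≤ leadingMinor Z j := (hZ.submatrix _).det_nonneg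

theorem leadingMinor_le {Z : Matrix (Fin m) (Fin m) ℝ} (hZ : Z.PosSemidef) (j : Fin m) :
    leadingMinor Z j ≤ Z.trace ^ ((j : ℕ) + 1) := by
  refine (det_le_trace_pow (hZ.submatrix _)).trans
    (pow_le_pow_left₀ (hZ.submatrix _).trace_nonneg ?_ _)
  simp only [Matrix.trace, Matrix.diag_apply, Matrix.submatrix_apply]
  have := Finset.sum_map Finset.univ (Fin.castLEEmb (Nat.succ_le_of_lt j.2)) fun i => Z i i
  refine (this.symm.le).trans ?_
  exact Finset.sum_le_sum_of_subset_of_nonneg (Finset.subset_univ _)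
    fun i _ _ => hZ.diag_nonneg

theorem generalizedPower_nonneg (κ : Fin m → ℕ) {Z : Matrix (Fin m) (Fin m) ℝ}
    (hZ : Z.PosSemidef) : 0 ≤ generalizedPower κ Z :=
  Finset.prod_nonneg fun j _ => pow_nonneg (leadingMinor_nonneg hZ j) _

theorem exists_generalizedPower_le (κ : Fin m → ℕ) :
    ∃ n : ℕ, ∀ Z : Matrix (Fin m) (Fin m) ℝ, Z.PosSemidef →
      generalizedPower κ Z ≤ Z.trace ^ n := by
  refine ⟨∑ j : Fin m, ((j : ℕ) + 1) * (κ j - nextPart κ j), fun Z hZ => ?_⟩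
  rw [← Finset.prod_pow_eq_pow_sum]
  refine Finset.prod_le_prod (fun j _ => pow_nonneg (leadingMinor_nonneg hZ j) _) fun j _ => ?_
  rw [pow_mul]
  exact pow_le_pow_left₀ (leadingMinor_nonneg hZ j) (leadingMinor_le hZ j) _

/-- Submultiplicativity of the Frobenius norm, from Cauchy–Schwarz on each entry. -/
theorem trace_mul_mul_transpose_le (M Q : Matrix (Fin m) (Fin m) ℝ) :
    (M * Q * (M * Q)ᵀ).trace ≤ (M * Mᵀ).trace * (Q * Qᵀ).trace := by
  have h : ∀ A : Matrix (Fin m) (Fin m) ℝ, (A * Aᵀ).trace = ∑ i, ∑ j, A i j ^ 2 := by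
    intro A
    simp [Matrix.trace, Matrix.mul_apply, sq]
  rw [h, h, h]
  calc ∑ i, ∑ j, (M * Q) i j ^ 2
      ≤ ∑ i, ∑ j, (∑ k, M i k ^ 2) * ∑ k, Q k j ^ 2 := by
        refine Finset.sum_le_sum fun i _ => Finset.sum_le_sum fun j _ => ?_
        rw [Matrix.mul_apply]
        exact Finset.sum_mul_sq_le_sq_mul_sq _ _ _
    _ = (∑ i, ∑ k, M i k ^ 2) * ∑ k, ∑ j, Q k j ^ 2 := by
        rw [Finset.sum_comm (f := fun k j => Q k j ^ 2), Finset.sum_mul_sum]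

theorem trace_orthogonal_conj (H : Matrix.orthogonalGroup (Fin m) ℝ)
    (Z : Matrix (Fin m) (Fin m) ℝ) :
    ((H : Matrix (Fin m) (Fin m) ℝ) * Z * (H : Matrix (Fin m) (Fin m) ℝ)ᵀ).trace = Z.trace := by
  rw [Matrix.trace_mul_comm, ← Matrix.mul_assoc, orthogonal_transpose_mul, Matrix.one_mul]

end Bounds

/-! ### Haar measure on the orthogonal group -/

section Haar

variable {m : ℕ}

instance isProbabilityMeasure_orthogonalHaar : IsProbabilityMeasure (orthogonalHaar m) :=
  ⟨Measure.haarMeasure_self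
    (K₀ := (⊤ : TopologicalSpace.PositiveCompacts (Matrix.orthogonalGroup (Fin m) ℝ)))⟩

instance isHaarMeasure_orthogonalHaar : (orthogonalHaar m).IsHaarMeasure :=
  Measure.isHaarMeasure_haarMeasure _

/-- A right translate of Haar measure is again a Haar probability measure, and such a measure is
unique. -/
instance isMulRightInvariant_orthogonalHaar : (orthogonalHaar m).IsMulRightInvariant := by
  refine ⟨fun g => ?_⟩
  have hp : IsProbabilityMeasure ((orthogonalHaar m).map (· * g)) :=
    Measure.isProbabilityMeasure_map (measurable_mul_const g).aemeasurable
  have hh : ((orthogonalHaar m).map (· * g)).IsHaarMeasure :=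
    Measure.isHaarMeasure_map_mul_right _ g
  exact Measure.isHaarMeasure_eq_of_isProbabilityMeasure _ _

theorem sphericalPolynomial_conj (κ : Fin m → ℕ) (G : Matrix.orthogonalGroup (Fin m) ℝ)
    (Y : Matrix (Fin m) (Fin m) ℝ) :
    sphericalPolynomial κ ((G : Matrix (Fin m) (Fin m) ℝ) * Y *
      (G : Matrix (Fin m) (Fin m) ℝ)ᵀ) = sphericalPolynomial κ Y := by
  have h := integral_mul_right_eq_self (μ := orthogonalHaar m)
    (fun H : Matrix.orthogonalGroup (Fin m) ℝ => generalizedPower κ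
      ((H : Matrix (Fin m) (Fin m) ℝ) * Y * (H : Matrix (Fin m) (Fin m) ℝ)ᵀ)) G
  rw [sphericalPolynomial, sphericalPolynomial, ← h]
  congr 1
  ext H
  simp [Matrix.mul_assoc, Matrix.transpose_mul]

theorem continuous_orthogonal_val :
    Continuous fun H : Matrix.orthogonalGroup (Fin m) ℝ => (H : Matrix (Fin m) (Fin m) ℝ) :=
  continuous_subtype_val

theorem sphericalPolynomial_one (κ : Fin m → ℕ) :
    sphericalPolynomial κ (1 : Matrix (Fin m) (Fin m) ℝ) = 1 := by
  simp [sphericalPolynomial, orthogonal_mul_transpose, generalizedPower_one]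

end Haar

/-! ### Spherical polynomials as eigenfunctions -/

section Eigenfunctions

variable {m : ℕ}

/-- A density on square matrices that is invariant under the orthogonal group on the left and has
moments of all orders. -/
structure IsOrthogonalDensity (ρ : Matrix (Fin m) (Fin m) ℝ → ℂ) : Prop where
  left_inv : ∀ (H : Matrix.orthogonalGroup (Fin m) ℝ) (Q : Matrix (Fin m) (Fin m) ℝ),
    ρ ((H : Matrix (Fin m) (Fin m) ℝ) * Q) = ρ Q
  moments : ∀ n : ℕ, Integrable fun q : Fin m × Fin m → ℝ =>
    (((q ⬝ᵥ q) ^ n : ℝ) : ℂ) * ρ (ofEntries q)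
  measurable : Measurable ρ

/-- The integral of a generalized power of `QQᵀ`. -/
noncomputable def powerMoment (κ : Fin m → ℕ) (ρ : Matrix (Fin m) (Fin m) ℝ → ℂ) : ℂ :=
  ∫ q : Fin m × Fin m → ℝ,
    (generalizedPower κ (ofEntries q * (ofEntries q)ᵀ) : ℂ) * ρ (ofEntries q)

variable {ρ : Matrix (Fin m) (Fin m) ℝ → ℂ}

theorem det_orthogonal_ne_zero (H : Matrix.orthogonalGroup (Fin m) ℝ) :
    (H : Matrix (Fin m) (Fin m) ℝ).det ≠ 0 := by
  intro h
  have := congrArg Matrix.det (orthogonal_mul_transpose H)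
  rw [Matrix.det_mul, h, zero_mul, Matrix.det_one] at this
  exact zero_ne_one this

theorem abs_det_orthogonal (H : Matrix.orthogonalGroup (Fin m) ℝ) :
    |(H : Matrix (Fin m) (Fin m) ℝ).det| = 1 := by
  have := congrArg Matrix.det (orthogonal_mul_transpose H)
  rw [Matrix.det_mul, Matrix.det_transpose, Matrix.det_one] at this
  rcases mul_self_eq_one_iff.1 this with h | h <;> simp [h]

theorem integral_orthogonal_mul {E : Type*} [NormedAddCommGroup E] [NormedSpace ℝ E]
    (f : Matrix (Fin m) (Fin m) ℝ → E) (G H : Matrix.orthogonalGroup (Fin m) ℝ) :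
    ∫ q, f ((G : Matrix (Fin m) (Fin m) ℝ) * ofEntries q * (H : Matrix (Fin m) (Fin m) ℝ)) =
      ∫ q, f (ofEntries q) := by
  rw [integral_comp_mul_mul (det_orthogonal_ne_zero G) (det_orthogonal_ne_zero H), abs_pow,
    abs_mul, abs_det_orthogonal, abs_det_orthogonal]
  simp

theorem IsOrthogonalDensity.integrable_of_le (hρ : IsOrthogonalDensity ρ)
    {f : (Fin m × Fin m → ℝ) → ℂ} (hf : Measurable f) {C : ℝ} {n : ℕ}
    (hle : ∀ q, ‖f q‖ ≤ C * (q ⬝ᵥ q) ^ n) :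
    Integrable fun q => f q * ρ (ofEntries q) := by
  refine ((hρ.moments n).const_mul (C : ℂ)).mono
    (hf.mul (hρ.measurable.comp continuous_ofEntries.measurable)).aestronglyMeasurable
    (ae_of_all _ fun q => ?_)
  rw [norm_mul, norm_mul, norm_mul, ← mul_assoc]
  refine mul_le_mul_of_nonneg_right ((hle q).trans ?_) (norm_nonneg _)
  rw [← norm_mul, ← Complex.ofReal_mul, Complex.norm_real]
  exact Real.le_norm_self _

/-- Factor K = LH with L lower triangular and H orthogonal. Left invariance of ρ absorbs H, and L
comes out of the generalized power as a scalar. -/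
theorem integral_generalizedPower_conj (hρ : IsOrthogonalDensity ρ) (κ : Fin m → ℕ)
    {K : Matrix (Fin m) (Fin m) ℝ} (hK : IsUnit K.det) :
    ∫ q : Fin m × Fin m → ℝ,
      (generalizedPower κ (K * ofEntries q * (K * ofEntries q)ᵀ) : ℂ) * ρ (ofEntries q) =
    generalizedPower κ (K * Kᵀ) * powerMoment κ ρ := by
  obtain ⟨L, hL, hLu, hLK⟩ := exists_cholesky (posDef_mul_transpose hK)
  obtain ⟨H, hH⟩ := exists_orthogonal_of_mul_transpose_eq hLu hLK.symm
  have h := integral_orthogonal_mul (fun Q : Matrix (Fin m) (Fin m) ℝ =>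
    (generalizedPower κ (L * Q * (L * Q)ᵀ) : ℂ) * ρ Q) H 1
  have h2 : ∀ q : Fin m × Fin m → ℝ,
      (generalizedPower κ (K * ofEntries q * (K * ofEntries q)ᵀ) : ℂ) * ρ (ofEntries q) =
      (generalizedPower κ (L * ((H : Matrix (Fin m) (Fin m) ℝ) * ofEntries q *
        ((1 : Matrix.orthogonalGroup (Fin m) ℝ) : Matrix (Fin m) (Fin m) ℝ)) *
        (L * ((H : Matrix (Fin m) (Fin m) ℝ) * ofEntries q *
        ((1 : Matrix.orthogonalGroup (Fin m) ℝ) : Matrix (Fin m) (Fin m) ℝ)))ᵀ) : ℂ) *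
        ρ ((H : Matrix (Fin m) (Fin m) ℝ) * ofEntries q *
          ((1 : Matrix.orthogonalGroup (Fin m) ℝ) : Matrix (Fin m) (Fin m) ℝ)) := by
    intro q
    rw [OneMemClass.coe_one, Matrix.mul_one, hρ.left_inv, hH]
    simp only [Matrix.mul_assoc]
  simp only [h2]
  rw [h, powerMoment, ← integral_const_mul]
  congr 1
  ext q
  rw [Matrix.transpose_mul, Matrix.mul_assoc, ← Matrix.mul_assoc (ofEntries q),
    ← Matrix.mul_assoc, generalizedPower_lower_conj hL, hLK]
  push_cast
  ring

/-- The previous identity with K = HM, averaged over H. The eigenvalue `powerMoment κ ρ` does not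
depend on M. -/
theorem integral_sphericalPolynomial_conj (hρ : IsOrthogonalDensity ρ) (κ : Fin m → ℕ)
    {M : Matrix (Fin m) (Fin m) ℝ} (hM : IsUnit M.det) :
    ∫ q : Fin m × Fin m → ℝ,
      (sphericalPolynomial κ (M * ofEntries q * (M * ofEntries q)ᵀ) : ℂ) * ρ (ofEntries q) =
    sphericalPolynomial κ (M * Mᵀ) * powerMoment κ ρ := by
  set F : Matrix.orthogonalGroup (Fin m) ℝ → (Fin m × Fin m → ℝ) → ℂ := fun H q =>
    (generalizedPower κ ((H : Matrix (Fin m) (Fin m) ℝ) * (M * ofEntries q * (M * ofEntries q)ᵀ) *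
      (H : Matrix (Fin m) (Fin m) ℝ)ᵀ) : ℂ) * ρ (ofEntries q) with hF
  obtain ⟨n, hn⟩ := exists_generalizedPower_le κ
  have hcont : Continuous fun z : Matrix.orthogonalGroup (Fin m) ℝ × (Fin m × Fin m → ℝ) =>
      (generalizedPower κ ((z.1 : Matrix (Fin m) (Fin m) ℝ) *
        (M * ofEntries z.2 * (M * ofEntries z.2)ᵀ) * (z.1 : Matrix (Fin m) (Fin m) ℝ)ᵀ) : ℂ) := by
    have h1 := continuous_orthogonal_val (m := m)
    have h2 := continuous_ofEntries (m := m)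
    exact Complex.continuous_ofReal.comp ((continuous_generalizedPower κ).comp (by fun_prop))
  -- The generalized power is at most a power of the trace, which conjugation by H does not change;
  -- this gives a dominating function independent of H.
  have hFint : Integrable (Function.uncurry F) ((orthogonalHaar m).prod volume) := by
    have hdom : Integrable (fun z : Matrix.orthogonalGroup (Fin m) ℝ × (Fin m × Fin m → ℝ) =>
        (1 : ℂ) * (((((M * Mᵀ).trace ^ n : ℝ)) : ℂ) *
          ((((z.2 ⬝ᵥ z.2) ^ n : ℝ) : ℂ) * ρ (ofEntries z.2)))) ((orthogonalHaar m).prod volume) :=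
      (integrable_const (μ := orthogonalHaar m) (1 : ℂ)).mul_prod ((hρ.moments n).const_mul _)
    refine hdom.mono ?_ (ae_of_all _ ?_)
    · exact (hcont.measurable.mul ((hρ.measurable.comp
        continuous_ofEntries.measurable).comp measurable_snd)).aestronglyMeasurable
    · rintro ⟨H, q⟩
      simp only [Function.uncurry, hF, one_mul]
      rw [← mul_assoc ((((M * Mᵀ).trace ^ n : ℝ)) : ℂ), norm_mul, norm_mul, ← Complex.ofReal_mul,
        Complex.norm_real, Complex.norm_real]
      refine mul_le_mul_of_nonneg_right ?_ (norm_nonneg _)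
      have hpsd : ((H : Matrix (Fin m) (Fin m) ℝ) * (M * ofEntries q * (M * ofEntries q)ᵀ) *
          (H : Matrix (Fin m) (Fin m) ℝ)ᵀ).PosSemidef := by
        have := posSemidef_mul_transpose ((H : Matrix (Fin m) (Fin m) ℝ) * (M * ofEntries q))
        rwa [Matrix.transpose_mul (H : Matrix (Fin m) (Fin m) ℝ), ← Matrix.mul_assoc,
          Matrix.mul_assoc (H : Matrix (Fin m) (Fin m) ℝ)] at this
      rw [Real.norm_of_nonneg (generalizedPower_nonneg κ hpsd)]
      refine ((hn _ hpsd).trans ?_).trans (Real.le_norm_self _)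
      rw [trace_orthogonal_conj, ← mul_pow, ← trace_mul_transpose_ofEntries]
      exact pow_le_pow_left₀ (posSemidef_mul_transpose _).trace_nonneg
        (trace_mul_mul_transpose_le _ _) n
  have hswap := integral_integral_swap hFint
  have hl : ∀ H : Matrix.orthogonalGroup (Fin m) ℝ, ∫ q, F H q =
      (generalizedPower κ ((H : Matrix (Fin m) (Fin m) ℝ) * (M * Mᵀ) *
        (H : Matrix (Fin m) (Fin m) ℝ)ᵀ) : ℂ) * powerMoment κ ρ := by
    intro H
    have h := integral_generalizedPower_conj hρ κ (K := (H : Matrix (Fin m) (Fin m) ℝ) * M)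
      (by rw [Matrix.det_mul]; exact (det_orthogonal_ne_zero H).isUnit.mul hM)
    simp only [Matrix.transpose_mul, Matrix.mul_assoc] at h ⊢
    simpa only [hF, Matrix.transpose_mul, Matrix.mul_assoc] using h
  simp only [hl] at hswap
  rw [integral_mul_const, integral_complex_ofReal] at hswap
  rw [sphericalPolynomial, hswap]
  congr 1
  ext q
  simp only [hF]
  rw [integral_mul_const, integral_complex_ofReal, sphericalPolynomial]

end Eigenfunctions

/-! ### The Gaussian and ball densities and their eigenvalues -/

section Densities

variable {m : ℕ}

theorem integrable_pow_dotProduct_mul_exp {ι : Type*} [Fintype ι] (n : ℕ) :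
    Integrable fun v : ι → ℝ => (v ⬝ᵥ v) ^ n * Real.exp (-(v ⬝ᵥ v)) := by
  have hhalf : Integrable fun v : ι → ℝ => Real.exp (-(1 / 2) * (v ⬝ᵥ v)) := by
    have : (fun v : ι → ℝ => Real.exp (-(1 / 2) * (v ⬝ᵥ v))) =
        fun v => ∏ i, Real.exp (-(1 / 2) * v i ^ 2) := by
      ext v
      rw [← Real.exp_sum, dotProduct, Finset.mul_sum]
      simp [sq]
    rw [this]
    exact Integrable.fintype_prod (f := fun _ x => Real.exp (-(1 / 2) * x ^ 2))
      fun _ => integrable_exp_neg_mul_sq (by norm_num)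
  refine (hhalf.const_mul (2 ^ n * n.factorial)).mono
    (Continuous.aestronglyMeasurable (by fun_prop)) (ae_of_all _ fun v => ?_)
  have h0 : 0 ≤ v ⬝ᵥ v := Finset.sum_nonneg fun i _ => mul_self_nonneg _
  rw [Real.norm_of_nonneg (by positivity), Real.norm_of_nonneg (by positivity)]
  -- The inequality s^n / n! ≤ e^s at half the squared norm costs only half of the Gaussian decay.
  have h1 := Real.pow_div_factorial_le_exp (1 / 2 * (v ⬝ᵥ v)) (by positivity) n
  rw [div_le_iff₀ (by positivity), mul_pow] at h1
  have h2 : Real.exp (-(v ⬝ᵥ v)) =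
      Real.exp (-(1 / 2) * (v ⬝ᵥ v)) * Real.exp (-(1 / 2) * (v ⬝ᵥ v)) := by
    rw [← Real.exp_add]; congr 1; ring
  have h3 : (v ⬝ᵥ v) ^ n ≤ 2 ^ n * n.factorial * Real.exp (1 / 2 * (v ⬝ᵥ v)) := by
    have : (v ⬝ᵥ v) ^ n = 2 ^ n * ((1 / 2) ^ n * (v ⬝ᵥ v) ^ n) := by
      rw [← mul_assoc, ← mul_pow]; norm_num
    rw [this]
    nlinarith [pow_pos (two_pos : (0 : ℝ) < 2) n]
  calc (v ⬝ᵥ v) ^ n * Real.exp (-(v ⬝ᵥ v))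
      ≤ (2 ^ n * n.factorial * Real.exp (1 / 2 * (v ⬝ᵥ v))) * Real.exp (-(v ⬝ᵥ v)) :=
        mul_le_mul_of_nonneg_right h3 (Real.exp_pos _).le
    _ = 2 ^ n * n.factorial * Real.exp (-(1 / 2) * (v ⬝ᵥ v)) := by
        rw [mul_assoc, ← Real.exp_add]; congr 2; ring

theorem isOrthogonalDensity_gaussianDensity :
    IsOrthogonalDensity (gaussianDensity : Matrix (Fin m) (Fin m) ℝ → ℂ) where
  left_inv H Q := by
    rw [gaussianDensity, gaussianDensity, Matrix.transpose_mul, ← Matrix.mul_assoc,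
      Matrix.mul_assoc _ Q, trace_orthogonal_conj]
  moments n := by
    simp only [gaussianDensity_ofEntries, ← Complex.ofReal_mul]
    exact (integrable_pow_dotProduct_mul_exp n).ofReal
  measurable := continuous_gaussianDensity.measurable

theorem ballDensity_of_posDef (c : ℂ) {Q : Matrix (Fin m) (Fin m) ℝ} (hQ : (1 - Q * Qᵀ).PosDef) :
    ballDensity c Q = ((1 - Q * Qᵀ).det : ℂ) ^ c :=
  Set.indicator_of_mem (s := {Q : Matrix (Fin m) (Fin m) ℝ | (1 - Q * Qᵀ).PosDef}) hQ _

theorem ballDensity_of_not_posDef (c : ℂ) {Q : Matrix (Fin m) (Fin m) ℝ}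
    (hQ : ¬(1 - Q * Qᵀ).PosDef) : ballDensity c Q = 0 :=
  Set.indicator_of_notMem (s := {Q : Matrix (Fin m) (Fin m) ℝ | (1 - Q * Qᵀ).PosDef}) hQ _

theorem ballDensity_orthogonal_mul (c : ℂ) (H : Matrix.orthogonalGroup (Fin m) ℝ)
    (Q : Matrix (Fin m) (Fin m) ℝ) :
    ballDensity c ((H : Matrix (Fin m) (Fin m) ℝ) * Q) = ballDensity c Q := by
  have h : 1 - (H : Matrix (Fin m) (Fin m) ℝ) * Q * ((H : Matrix (Fin m) (Fin m) ℝ) * Q)ᵀ =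
      (H : Matrix (Fin m) (Fin m) ℝ) * (1 - Q * Qᵀ) * (H : Matrix (Fin m) (Fin m) ℝ)ᵀ := by
    rw [Matrix.mul_sub, Matrix.sub_mul, Matrix.mul_one, orthogonal_mul_transpose,
      Matrix.transpose_mul]
    simp only [Matrix.mul_assoc]
  have hiff := posDef_conj_iff (A := 1 - Q * Qᵀ) (U := (H : Matrix (Fin m) (Fin m) ℝ))
    ((Matrix.isUnit_iff_isUnit_det _).2 (det_orthogonal_ne_zero H).isUnit)
  by_cases hQ : (1 - Q * Qᵀ).PosDef
  · rw [ballDensity_of_posDef c hQ, ballDensity_of_posDef c (by rw [h]; exact hiff.2 hQ), h,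
      Matrix.det_mul, Matrix.det_mul, mul_comm, ← mul_assoc, ← Matrix.det_mul,
      orthogonal_transpose_mul, Matrix.det_one, one_mul]
  · rw [ballDensity_of_not_posDef c hQ,
      ballDensity_of_not_posDef c (by rw [h]; exact fun h' => hQ (hiff.1 h'))]

theorem ballDensity_mul_orthogonal (c : ℂ) (H : Matrix.orthogonalGroup (Fin m) ℝ)
    (Q : Matrix (Fin m) (Fin m) ℝ) :
    ballDensity c (Q * (H : Matrix (Fin m) (Fin m) ℝ)) = ballDensity c Q := by
  have h : Q * (H : Matrix (Fin m) (Fin m) ℝ) * (Q * (H : Matrix (Fin m) (Fin m) ℝ))ᵀ =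
      Q * Qᵀ := by
    rw [Matrix.transpose_mul, Matrix.mul_assoc, ← Matrix.mul_assoc _ _ Qᵀ,
      orthogonal_mul_transpose, Matrix.one_mul]
  by_cases hQ : (1 - Q * Qᵀ).PosDef
  · rw [ballDensity_of_posDef c hQ, ballDensity_of_posDef c (by rw [h]; exact hQ), h]
  · rw [ballDensity_of_not_posDef c hQ, ballDensity_of_not_posDef c (by rw [h]; exact hQ)]

/-- On the ball tr(1 - QQᵀ) is nonnegative, so the density has bounded support. -/
theorem dotProduct_le_of_ballDensity_ne_zero {c : ℂ} {q : Fin m × Fin m → ℝ}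
    (h : ballDensity c (ofEntries q) ≠ 0) : q ⬝ᵥ q ≤ m := by
  have hQ : (1 - ofEntries q * (ofEntries q)ᵀ).PosDef := by
    by_contra hcon
    exact h (Set.indicator_of_notMem (by exact hcon) _)
  have := hQ.posSemidef.trace_nonneg
  rw [Matrix.trace_sub, trace_mul_transpose_ofEntries, Matrix.trace_one, Fintype.card_fin] at this
  linarith

theorem isOrthogonalDensity_ballDensity {a : ℂ} (ha : ((m : ℝ) - 1) / 2 < (a - (m : ℂ) / 2).re) :
    IsOrthogonalDensity (ballDensity (a - m - 1 / 2) : Matrix (Fin m) (Fin m) ℝ → ℂ) where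
  left_inv H Q := ballDensity_orthogonal_mul _ H Q
  moments n := by
    refine ((integrable_ballDensity ha).const_mul (((m : ℝ) ^ n : ℝ) : ℂ)).mono ?_
      (ae_of_all _ fun q => ?_)
    · refine Measurable.aestronglyMeasurable (Measurable.mul ?_
        ((measurable_ballDensity _).comp continuous_ofEntries.measurable))
      exact (Complex.continuous_ofReal.comp (by fun_prop)).measurable
    · rw [norm_mul, norm_mul]
      by_cases h : ballDensity (a - m - 1 / 2) (ofEntries q) = 0
      · rw [h, norm_zero, mul_zero, mul_zero]
      · refine mul_le_mul_of_nonneg_right ?_ (norm_nonneg _)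
        have h0 : 0 ≤ q ⬝ᵥ q := Finset.sum_nonneg fun i _ => mul_self_nonneg _
        rw [Complex.norm_real, Complex.norm_real, Real.norm_of_nonneg (by positivity),
          Real.norm_of_nonneg (by positivity)]
        exact pow_le_pow_left₀ h0 (dotProduct_le_of_ballDensity_ne_zero h) n
  measurable := measurable_ballDensity _

theorem IsOrthogonalDensity.integrable_generalizedPower {ρ : Matrix (Fin m) (Fin m) ℝ → ℂ}
    (hρ : IsOrthogonalDensity ρ) (κ : Fin m → ℕ) :
    Integrable fun q : Fin m × Fin m → ℝ =>
      (generalizedPower κ (ofEntries q * (ofEntries q)ᵀ) : ℂ) * ρ (ofEntries q) := by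
  obtain ⟨n, hn⟩ := exists_generalizedPower_le κ
  refine hρ.integrable_of_le (C := 1) (n := n) ?_ fun q => ?_
  · have h2 := continuous_ofEntries (m := m)
    exact (Complex.continuous_ofReal.comp
      ((continuous_generalizedPower κ).comp (by fun_prop))).measurable
  · have hp := posSemidef_mul_transpose (ofEntries q)
    rw [Complex.norm_real, Real.norm_of_nonneg (generalizedPower_nonneg κ hp), one_mul,
      ← trace_mul_transpose_ofEntries]
    exact hn _ hp

/-- In `integral_cone_ball` with f a generalized power of NNᵀ, the inner ball integral is the
eigenvalue times the generalized power of R, and Gindikin's integral evaluates the remaining cone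
integral. The ball eigenvalue thus depends on a and κ through 1/[a]_κ and the Gaussian eigenvalue.
-/
theorem powerMoment_ballDensity {a : ℂ} (ha : ((m : ℝ) - 1) / 2 < (a - (m : ℂ) / 2).re)
    {κ : Fin m → ℕ} (hκ : Antitone κ) :
    partitionalFactorial a κ * multivariateGamma m a * powerMoment κ (ballDensity (a - m - 1 / 2)) =
      powerMoment κ gaussianDensity * multivariateGamma m (a - (m : ℂ) / 2) := by
  have h := (integral_cone_ball ha (f := fun N => (generalizedPower κ (N * Nᵀ) : ℂ))
    (isOrthogonalDensity_gaussianDensity.integrable_generalizedPower κ)).2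
  rw [powerMoment, powerMoment, ← h,
    ← integral_generalizedPower_eq_partitionalFactorial (half_re_sub ha) hκ, ← integral_mul_const]
  congr 1
  ext r
  by_cases hr : (symmetricOfUpper r).PosDef
  · obtain ⟨hB, hBt, hBB⟩ := posDef_sqrt hr
    rw [integral_generalizedPower_conj (isOrthogonalDensity_ballDensity ha) κ
      (posDef_isUnit_det hB), hBt, hBB, powerMoment]
    ring
  · rw [coneDensity, Set.indicator_of_notMem (by exact hr)]
    simp

/-- The integrand is continuous, nonnegative, and positive at the identity matrix. -/
theorem powerMoment_gaussianDensity_ne_zero (κ : Fin m → ℕ) :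
    powerMoment κ (gaussianDensity : Matrix (Fin m) (Fin m) ℝ → ℂ) ≠ 0 := by
  have hint := (isOrthogonalDensity_gaussianDensity (m := m)).integrable_generalizedPower κ
  rw [powerMoment]
  simp only [gaussianDensity_ofEntries, ← Complex.ofReal_mul] at hint ⊢
  rw [integral_complex_ofReal]
  have h2 := continuous_ofEntries (m := m)
  have := integral_pos_of_integrable_nonneg_nonzero (μ := volume)
    (f := fun q : Fin m × Fin m → ℝ => generalizedPower κ (ofEntries q * (ofEntries q)ᵀ) *
      Real.exp (-(q ⬝ᵥ q))) (x := entriesOf 1)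
    (((continuous_generalizedPower κ).comp (by fun_prop)).mul (by fun_prop))
    hint.re
    (fun q => mul_nonneg (generalizedPower_nonneg κ (posSemidef_mul_transpose _))
      (Real.exp_pos _).le)
    (by
      rw [ofEntries_entriesOf, Matrix.transpose_one, Matrix.mul_one, generalizedPower_one, one_mul]
      exact (Real.exp_pos _).ne')
  exact_mod_cast this.ne'

end Densities

/-! ### Separating partitions by the polynomials [a]_κ -/

section Separation

open Polynomial

variable {m : ℕ}

/-- The boxes of the diagram of `κ`. -/
def boxes (κ : Fin m → ℕ) : Finset (Σ _ : Fin m, ℕ) :=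
  Finset.univ.sigma fun j => Finset.range (κ j)

/-- The content of a box, normalized so that `[a]_κ = ∏ (a - content)`. -/
noncomputable def boxContent (b : Σ _ : Fin m, ℕ) : ℂ := (b.1 : ℂ) / 2 - b.2

/-- The polynomial `a ↦ [a]_κ`. -/
noncomputable def factorialPolynomial (κ : Fin m → ℕ) : ℂ[X] :=
  ((boxes κ).val.map fun b => X - C (boxContent b)).prod

theorem ascPochhammer_eval_eq_prod (n : ℕ) (s : ℂ) :
    (ascPochhammer ℂ n).eval s = ∏ i ∈ Finset.range n, (s + i) := by
  induction n with
  | zero => simp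
  | succ n ih => rw [ascPochhammer_succ_eval, ih, Finset.prod_range_succ]

theorem eval_factorialPolynomial (κ : Fin m → ℕ) (a : ℂ) :
    (factorialPolynomial κ).eval a = partitionalFactorial a κ := by
  have : factorialPolynomial κ = ∏ b ∈ boxes κ, (X - C (boxContent b)) := rfl
  rw [this, eval_prod, boxes, Finset.prod_sigma, partitionalFactorial]
  refine Finset.prod_congr rfl fun j _ => ?_
  rw [ascPochhammer_eval_eq_prod]
  refine Finset.prod_congr rfl fun i _ => ?_
  simp only [eval_sub, eval_X, eval_C, boxContent]
  ring

theorem roots_factorialPolynomial (κ : Fin m → ℕ) :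
    (factorialPolynomial κ).roots = (boxes κ).val.map boxContent := by
  have h := roots_multiset_prod_X_sub_C ((boxes κ).val.map boxContent)
  rwa [Multiset.map_map] at h

/-- Boxes of equal content lie on a line along which i grows by half the increase of j. On rows j ≥
j₀ that line is already outside κ'; on rows j ≤ j₀ its boxes have i ≤ κ'_{j₀} < κ_{j₀} ≤ κ_j and lie
in κ. So every such box of κ' is in κ, and (j₀, κ'_{j₀}) is one more. Hence the multiset of roots of
[a]_κ determines κ. -/
theorem count_content_lt {κ κ' : Fin m → ℕ} (hκ : Antitone κ) (hκ' : Antitone κ') {j₀ : Fin m}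
    (hlt : κ' j₀ < κ j₀) :
    ((boxes κ').val.map boxContent).count (boxContent ⟨j₀, κ' j₀⟩) <
      ((boxes κ).val.map boxContent).count (boxContent ⟨j₀, κ' j₀⟩) := by
  classical
  rw [Multiset.count_map, Multiset.count_map, ← Finset.filter_val, ← Finset.filter_val,
    Finset.card_val, Finset.card_val]
  refine Finset.card_lt_card (Finset.ssubset_iff_subset_ne.2 ⟨?_, fun heq => ?_⟩)
  · rintro ⟨j, i⟩ hb
    rw [Finset.mem_filter] at hb ⊢
    simp only [boxes, Finset.mem_sigma, Finset.mem_univ, true_and,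
      Finset.mem_range, boxContent] at hb ⊢
    refine ⟨?_, hb.2⟩
    have hc : (j₀ : ℕ) + 2 * i = j + 2 * κ' j₀ := by
      have h := hb.2
      have h' : ((j₀ : ℕ) : ℂ) + 2 * (i : ℂ) = (j : ℕ) + 2 * (κ' j₀ : ℂ) := by linear_combination 2 * h
      exact_mod_cast h'
    rcases le_total j₀ j with hj | hj
    · have h1 := hκ' hj
      have h2 : (j₀ : ℕ) ≤ j := hj
      have := hb.1
      omega
    · have h1 := hκ hj
      have h2 : (j : ℕ) ≤ j₀ := hj
      omega
  · have h1 : (⟨j₀, κ' j₀⟩ : Σ _ : Fin m, ℕ) ∈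
        (boxes κ).filter fun b => boxContent ⟨j₀, κ' j₀⟩ = boxContent b := by
      simp [boxes, hlt]
    rw [← heq] at h1
    simp [boxes] at h1

theorem roots_factorialPolynomial_ne {κ κ' : Fin m → ℕ} (hκ : Antitone κ) (hκ' : Antitone κ')
    (hne : κ ≠ κ') : (factorialPolynomial κ).roots ≠ (factorialPolynomial κ').roots := by
  obtain ⟨j, hj⟩ := Function.ne_iff.1 hne
  rw [roots_factorialPolynomial, roots_factorialPolynomial]
  intro h
  rcases lt_or_gt_of_ne hj with hlt | hlt
  · exact absurd (h ▸ count_content_lt hκ' hκ hlt) (lt_irrefl _)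
  · exact absurd (h ▸ count_content_lt hκ hκ' hlt) (lt_irrefl _)

theorem antitone_of_mem_partitions {k : ℕ} {κ : Fin m → ℕ} (h : κ ∈ partitions m k) :
    Antitone κ := (Finset.mem_filter.1 h).2

/-- For some large real `a` the ratios `g κ / [a]_κ` are pairwise distinct. -/
theorem exists_separating (k : ℕ) {g : (Fin m → ℕ) → ℂ} (hg : ∀ κ, g κ ≠ 0) :
    ∃ a : ℝ, (m : ℝ) < a ∧ ∀ κ ∈ partitions m k, ∀ κ' ∈ partitions m k, κ ≠ κ' →
      g κ * partitionalFactorial a κ' ≠ g κ' * partitionalFactorial a κ := by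
  classical
  set D : (Fin m → ℕ) × (Fin m → ℕ) → ℂ[X] := fun p =>
    C (g p.1) * factorialPolynomial p.2 - C (g p.2) * factorialPolynomial p.1 with hD
  set P : ℂ[X] := ∏ p ∈ (partitions m k ×ˢ partitions m k).filter fun p => p.1 ≠ p.2, D p with hP
  -- A zero factor would make two of the polynomials [a]_κ proportional, hence with equal roots. A
  -- nonzero P has only finitely many roots, so some real a > m avoids them.
  have hP0 : P ≠ 0 := by
    refine Finset.prod_ne_zero_iff.2 fun p hp => ?_
    simp only [Finset.mem_filter, Finset.mem_product] at hp
    intro h0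
    have h1 := congrArg Polynomial.roots (sub_eq_zero.1 h0)
    rw [roots_C_mul _ (hg _), roots_C_mul _ (hg _)] at h1
    exact roots_factorialPolynomial_ne (antitone_of_mem_partitions hp.1.1)
      (antitone_of_mem_partitions hp.1.2) hp.2 h1.symm
  have hinf : ((fun x : ℝ => (x : ℂ)) '' Set.Ioi (m : ℝ)).Infinite :=
    (Set.Ioi_infinite _).image (Complex.ofReal_injective.injOn)
  obtain ⟨z, ⟨a, ha, rfl⟩, hz⟩ : ∃ z ∈ (fun x : ℝ => (x : ℂ)) '' Set.Ioi (m : ℝ), ¬ P.IsRoot z := by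
    by_contra! hcon
    exact hP0 (Polynomial.eq_zero_of_infinite_isRoot P (hinf.mono hcon))
  refine ⟨a, ha, fun κ hκ κ' hκ' hne heq => hz ?_⟩
  rw [IsRoot.def, hP, eval_prod]
  refine Finset.prod_eq_zero (i := (κ, κ')) (by simp [hκ, hκ', hne]) ?_
  simp only [hD, eval_sub, eval_mul, eval_C, eval_factorialPolynomial]
  exact sub_eq_zero.2 heq

end Separation

/-! ### Linear independence of spherical polynomials -/

section Independence

variable {m : ℕ}

theorem continuous_sphericalPolynomial (κ : Fin m → ℕ) :
    Continuous (sphericalPolynomial κ : Matrix (Fin m) (Fin m) ℝ → ℝ) := by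
  have : FirstCountableTopology (Matrix (Fin m) (Fin m) ℝ) :=
    inferInstanceAs (FirstCountableTopology (Fin m → Fin m → ℝ))
  have : LocallyCompactSpace (Matrix (Fin m) (Fin m) ℝ) :=
    inferInstanceAs (LocallyCompactSpace (Fin m → Fin m → ℝ))
  have h1 := continuous_orthogonal_val (m := m)
  have h := continuous_parametric_integral_of_continuous (μ := orthogonalHaar m)
    (f := fun (Y : Matrix (Fin m) (Fin m) ℝ) (H : Matrix.orthogonalGroup (Fin m) ℝ) =>
      generalizedPower κ ((H : Matrix (Fin m) (Fin m) ℝ) * Y *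
        (H : Matrix (Fin m) (Fin m) ℝ)ᵀ))
    ((continuous_generalizedPower κ).comp (by fun_prop)) isCompact_univ
  rw [Measure.restrict_univ] at h
  exact h

/-- The matrix M + tI is singular only when t is an eigenvalue of -M, which excludes finitely many t
near 0. -/
theorem dense_det_ne_zero : Dense {M : Matrix (Fin m) (Fin m) ℝ | M.det ≠ 0} := by
  intro M
  have hfin : {t : ℝ | (-M).charpoly.eval t = 0}.Finite := by
    refine (-M).charpoly.roots.toFinset.finite_toSet.subset fun t ht => ?_
    simpa [(-M).charpoly_monic.ne_zero, Polynomial.IsRoot] using ht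
  have hev : ∀ᶠ t : ℝ in nhdsWithin 0 {0}ᶜ, (M + t • 1).det ≠ 0 := by
    have h1 := hfin.subset (Set.sdiff_subset (t := {0}))
    have h2 : ({t : ℝ | (-M).charpoly.eval t = 0} \ {0})ᶜ ∈ nhds (0 : ℝ) :=
      h1.isClosed.isOpen_compl.mem_nhds (by simp)
    filter_upwards [mem_nhdsWithin_of_mem_nhds h2, self_mem_nhdsWithin] with t ht ht0 hdet
    refine ht ⟨?_, ht0⟩
    rw [Set.mem_ofPred_eq, Matrix.eval_charpoly, sub_neg_eq_add, ← hdet, add_comm,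
      Matrix.scalar_apply, Matrix.smul_one_eq_diagonal]
  have htend : Filter.Tendsto (fun t : ℝ => M + t • (1 : Matrix (Fin m) (Fin m) ℝ))
      (nhdsWithin 0 {0}ᶜ) (nhds M) := by
    have : Continuous fun t : ℝ => M + t • (1 : Matrix (Fin m) (Fin m) ℝ) := by fun_prop
    have h := (this.tendsto 0).mono_left (nhdsWithin_le_nhds (s := {0}ᶜ))
    simpa using h
  exact mem_closure_of_tendsto htend hev

theorem IsOrthogonalDensity.integrable_sphericalPolynomial {ρ : Matrix (Fin m) (Fin m) ℝ → ℂ}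
    (hρ : IsOrthogonalDensity ρ) (κ : Fin m → ℕ) (M : Matrix (Fin m) (Fin m) ℝ) :
    Integrable fun q : Fin m × Fin m → ℝ =>
      (sphericalPolynomial κ (M * ofEntries q * (M * ofEntries q)ᵀ) : ℂ) * ρ (ofEntries q) := by
  obtain ⟨n, hn⟩ := exists_generalizedPower_le κ
  refine hρ.integrable_of_le (C := (M * Mᵀ).trace ^ n) (n := n) ?_ fun q => ?_
  · have h2 := continuous_ofEntries (m := m)
    exact (Complex.continuous_ofReal.comp
      ((continuous_sphericalPolynomial κ).comp (by fun_prop))).measurable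
  · rw [Complex.norm_real, sphericalPolynomial]
    refine (norm_integral_le_of_norm_le_const (C := ((M * Mᵀ).trace * (q ⬝ᵥ q)) ^ n)
      (ae_of_all _ fun H => ?_)).trans ?_
    · have hpsd : ((H : Matrix (Fin m) (Fin m) ℝ) * (M * ofEntries q * (M * ofEntries q)ᵀ) *
          (H : Matrix (Fin m) (Fin m) ℝ)ᵀ).PosSemidef := by
        have := posSemidef_mul_transpose ((H : Matrix (Fin m) (Fin m) ℝ) * (M * ofEntries q))
        rwa [Matrix.transpose_mul (H : Matrix (Fin m) (Fin m) ℝ), ← Matrix.mul_assoc,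
          Matrix.mul_assoc (H : Matrix (Fin m) (Fin m) ℝ)] at this
      rw [Real.norm_of_nonneg (generalizedPower_nonneg κ hpsd)]
      refine (hn _ hpsd).trans ?_
      rw [trace_orthogonal_conj, ← trace_mul_transpose_ofEntries]
      exact pow_le_pow_left₀ (posSemidef_mul_transpose _).trace_nonneg
        (trace_mul_mul_transpose_le _ _) n
    · rw [mul_pow]
      simp

/-- The functions `M ↦ Φ_κ(MMᵀ)`, `|κ| = k`, are linearly independent. -/
theorem sphericalPolynomial_independent (k : ℕ) {d : (Fin m → ℕ) → ℝ}
    (hd : ∀ M : Matrix (Fin m) (Fin m) ℝ,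
      ∑ κ ∈ partitions m k, d κ * sphericalPolynomial κ (M * Mᵀ) = 0) :
    ∀ κ ∈ partitions m k, d κ = 0 := by
  obtain ⟨a, ha, hsep⟩ := exists_separating k (powerMoment_gaussianDensity_ne_zero (m := m))
  have hm : (0 : ℝ) ≤ m := Nat.cast_nonneg m
  have ha' : ((m : ℝ) - 1) / 2 < ((a : ℂ) - (m : ℂ) / 2).re := by
    rw [Complex.sub_re, natCast_div_two_re, Complex.ofReal_re]
    linarith
  -- The eigenvalues of the ball average, pairwise distinct by the choice of a.
  set s : (Fin m → ℕ) → ℂ := fun κ => powerMoment κ (ballDensity ((a : ℂ) - m - 1 / 2)) with hs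
  have hρ := isOrthogonalDensity_ballDensity ha'
  have hsinj : ∀ κ ∈ partitions m k, ∀ κ' ∈ partitions m k, s κ = s κ' → κ = κ' := by
    intro κ hκ κ' hκ' heq
    by_contra hne
    refine hsep κ hκ κ' hκ' hne ?_
    have h1 := powerMoment_ballDensity ha' (antitone_of_mem_partitions hκ)
    have h2 := powerMoment_ballDensity ha' (antitone_of_mem_partitions hκ')
    have h3 : powerMoment κ (ballDensity ((a : ℂ) - m - 1 / 2)) =
      powerMoment κ' (ballDensity ((a : ℂ) - m - 1 / 2)) := heq
    rw [h3] at h1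
    have hG := multivariateGamma_ne_zero ha'
    refine mul_right_cancel₀ hG ?_
    linear_combination (-partitionalFactorial (a : ℂ) κ') * h1 + partitionalFactorial (a : ℂ) κ * h2
  -- Averaging the relation over the ball multiplies the coefficient of each Φ_κ by its eigenvalue,
  -- so the relation persists with coefficients d_κ s_κ^n.
  have hiter : ∀ n : ℕ, ∀ M : Matrix (Fin m) (Fin m) ℝ,
      ∑ κ ∈ partitions m k, (d κ : ℂ) * s κ ^ n * (sphericalPolynomial κ (M * Mᵀ) : ℂ) = 0 := by
    intro n
    induction n with
    | zero =>
      intro M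
      have := congrArg (fun x : ℝ => (x : ℂ)) (hd M)
      simpa using this
    | succ n ih =>
      have hcont : Continuous fun M : Matrix (Fin m) (Fin m) ℝ => ∑ κ ∈ partitions m k,
          (d κ : ℂ) * s κ ^ (n + 1) * (sphericalPolynomial κ (M * Mᵀ) : ℂ) := by
        refine continuous_finsetSum _ fun κ _ => continuous_const.mul ?_
        exact Complex.continuous_ofReal.comp
          ((continuous_sphericalPolynomial κ).comp (by fun_prop))
      -- The eigenvalue identity is available for invertible M only, while the next iteration
      -- evaluates the relation at all matrices MQ.
      refine fun M => congrFun (Continuous.ext_on dense_det_ne_zero hcont continuous_const ?_) M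
      intro M hM
      have h0 : ∫ q : Fin m × Fin m → ℝ, ∑ κ ∈ partitions m k, ((d κ : ℂ) * s κ ^ n) *
          ((sphericalPolynomial κ (M * ofEntries q * (M * ofEntries q)ᵀ) : ℂ) *
            ballDensity ((a : ℂ) - m - 1 / 2) (ofEntries q)) = 0 := by
        refine integral_eq_zero_of_ae (ae_of_all _ fun q => ?_)
        simp only [← mul_assoc, ← Finset.sum_mul, ih, zero_mul, Pi.zero_apply]
      rw [integral_finsetSum _ fun κ _ =>
        (hρ.integrable_sphericalPolynomial κ M).const_mul _] at h0
      rw [← h0]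
      refine Finset.sum_congr rfl fun κ _ => ?_
      rw [integral_const_mul, integral_sphericalPolynomial_conj hρ κ hM.isUnit, pow_succ]
      ring
  set e := (partitions m k).equivFin
  -- At M = 1 every Φ_κ equals 1, and what remains is a Vandermonde system with distinct nodes.
  have hv := Matrix.eq_zero_of_forall_pow_sum_mul_pow_eq_zero
    (f := fun i => s (e.symm i)) (v := fun i => (d (e.symm i) : ℂ))
    (fun i j hij => e.symm.injective (Subtype.ext
      (hsinj _ (e.symm i).2 _ (e.symm j).2 hij))) (fun i => by
      have h := hiter i 1
      rw [Matrix.transpose_one, Matrix.mul_one] at h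
      simp only [sphericalPolynomial_one, Complex.ofReal_one, mul_one] at h
      rw [← h, ← Finset.sum_coe_sort (partitions m k)]
      exact Equiv.sum_comp e.symm fun κ => (d κ : ℂ) * s κ ^ (i : ℕ))
  intro κ hκ
  have := congrFun hv (e ⟨κ, hκ⟩)
  simpa using this

end Independence

/-! ### Averages of homogeneous polynomials -/

section HomogeneousPolynomials

/-- A function of finitely many real variables given by a homogeneous polynomial. -/
def IsHomPoly {σ : Type*} (φ : (σ → ℝ) → ℝ) (n : ℕ) : Prop :=
  ∃ p : MvPolynomial σ ℝ, p.IsHomogeneous n ∧ ∀ x, MvPolynomial.eval x p = φ x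

/-- Evaluation of continuous functions at a point. -/
def evalAt {X : Type*} [TopologicalSpace X] (x : X) : C(X, ℝ) →+* ℝ where
  toFun f := f x
  map_one' := rfl
  map_mul' _ _ := rfl
  map_zero' := rfl
  map_add' _ _ := rfl

/-- A polynomial whose coefficients are continuous functions on a compact space may be integrated
coefficient by coefficient; the degree does not change. -/
theorem isHomPoly_average {σ X : Type*} [Fintype σ] [TopologicalSpace X] [CompactSpace X]
    [MeasurableSpace X] [BorelSpace X] (μ : Measure X) [IsFiniteMeasure μ]
    {P : MvPolynomial σ C(X, ℝ)} {n : ℕ} (hP : P.IsHomogeneous n) :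
    IsHomPoly (fun q => ∫ x, MvPolynomial.eval₂Hom (evalAt x) q P ∂μ) n := by
  classical
  refine ⟨∑ d ∈ P.support, MvPolynomial.monomial d (∫ x, P.coeff d x ∂μ), ?_, fun q => ?_⟩
  · refine MvPolynomial.IsHomogeneous.sum _ _ _ fun d hd => ?_
    refine MvPolynomial.isHomogeneous_monomial _ ?_
    by_contra hne
    exact (MvPolynomial.mem_support_iff.1 hd) (hP.coeff_eq_zero hne)
  · have h : ∀ x, MvPolynomial.eval₂Hom (evalAt x) q P =
        ∑ d ∈ P.support, P.coeff d x * ∏ i, q i ^ d i := fun x => by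
      rw [MvPolynomial.coe_eval₂Hom, MvPolynomial.eval₂_eq']
      rfl
    simp only [h]
    rw [integral_finsetSum]
    · simp only [map_sum, MvPolynomial.eval_monomial, integral_mul_const]
      refine Finset.sum_congr rfl fun d _ => ?_
      congr 1
      exact Finsupp.prod_fintype _ _ fun i => pow_zero _
    · intro d _
      have : Integrable (fun x => P.coeff d x) μ :=
        Continuous.integrable_of_hasCompactSupport (P.coeff d).continuous
          (HasCompactSupport.of_compactSpace _)
      exact this.mul_const _

theorem isHomogeneous_det {σ R : Type*} [CommRing R] {n d : ℕ}
    {W : Matrix (Fin n) (Fin n) (MvPolynomial σ R)} (hW : ∀ i j, (W i j).IsHomogeneous d) :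
    W.det.IsHomogeneous (d * n) := by
  rw [Matrix.det_apply']
  refine MvPolynomial.IsHomogeneous.sum _ _ _ fun τ _ => ?_
  have h1 : (((Equiv.Perm.sign τ : ℤ) : MvPolynomial σ R)).IsHomogeneous 0 := by
    have : ((Equiv.Perm.sign τ : ℤ) : MvPolynomial σ R) =
        MvPolynomial.C ((Equiv.Perm.sign τ : ℤ) : R) := by simp
    rw [this]
    exact MvPolynomial.isHomogeneous_C _ _
  have h2 := MvPolynomial.IsHomogeneous.prod Finset.univ (fun i => W (τ i) i) (fun _ => d)
    fun i _ => hW _ _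
  have h3 := h1.mul h2
  simpa [mul_comm] using h3

theorem isHomogeneous_mul_entries {σ R : Type*} [CommRing R] {n d e : ℕ}
    {V W : Matrix (Fin n) (Fin n) (MvPolynomial σ R)} (hV : ∀ i j, (V i j).IsHomogeneous d)
    (hW : ∀ i j, (W i j).IsHomogeneous e) (i j : Fin n) : ((V * W) i j).IsHomogeneous (d + e) := by
  rw [Matrix.mul_apply]
  exact MvPolynomial.IsHomogeneous.sum _ _ _ fun k _ => (hV i k).mul (hW k j)

end HomogeneousPolynomials

/-! ### Spherical polynomials and moments as polynomials in the entries -/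

section PowerPolynomials

variable {m : ℕ}

theorem leadingBlock_smul_one (t : ℝ) :
    leadingBlock (t • (1 : Matrix (Fin (m + 1)) (Fin (m + 1)) ℝ)) = t • 1 := by
  ext i j
  simp [leadingBlock, Matrix.one_apply]

theorem lastPivot_smul_one (t : ℝ) :
    lastPivot (t • (1 : Matrix (Fin (m + 1)) (Fin (m + 1)) ℝ)) = t := by
  have : lastColumn (t • (1 : Matrix (Fin (m + 1)) (Fin (m + 1)) ℝ)) = 0 := by
    ext i
    simp [lastColumn, (Fin.castSucc_lt_last i).ne]
  simp [lastPivot, this]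

theorem generalizedPower_smul_one {t : ℝ} (ht : 0 < t) : ∀ {m : ℕ} {κ : Fin m → ℕ}, Antitone κ →
    generalizedPower κ (t • (1 : Matrix (Fin m) (Fin m) ℝ)) = t ^ ∑ j, κ j
  | 0, κ, _ => by simp [generalizedPower]
  | m + 1, κ, hκ => by
    rw [generalizedPower_succ hκ (by simp) (by
      rw [leadingBlock_smul_one, Matrix.det_smul]
      simp [ht.ne']), leadingBlock_smul_one, lastPivot_smul_one,
      generalizedPower_smul_one ht fun i j hij => hκ (Fin.castSucc_le_castSucc_iff.2 hij),
      Fin.sum_univ_castSucc, pow_add]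

/-- Evaluate the generalized power at 2I in two ways, by its definition and by the recursion, and
compare exponents of 2. -/
theorem sum_mul_sub_nextPart {κ : Fin m → ℕ} (hκ : Antitone κ) :
    ∑ j : Fin m, ((j : ℕ) + 1) * (κ j - nextPart κ j) = ∑ j, κ j := by
  have h := generalizedPower_smul_one (two_pos : (0 : ℝ) < 2) hκ
  have hl : ∀ j : Fin m, leadingMinor ((2 : ℝ) • (1 : Matrix (Fin m) (Fin m) ℝ)) j =
      2 ^ ((j : ℕ) + 1) := by
    intro j
    have h1 : ((2 : ℝ) • (1 : Matrix (Fin m) (Fin m) ℝ)).submatrix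
        (Fin.castLE (Nat.succ_le_of_lt j.2)) (Fin.castLE (Nat.succ_le_of_lt j.2)) =
        (2 : ℝ) • (1 : Matrix (Fin ((j : ℕ) + 1)) (Fin ((j : ℕ) + 1)) ℝ) := by
      rw [← Matrix.submatrix_one _ (Fin.castLE_injective (Nat.succ_le_of_lt j.2))]
      rfl
    rw [leadingMinor]
    exact (congrArg Matrix.det h1).trans (by simp)
  simp only [generalizedPower, hl, ← pow_mul, Finset.prod_pow_eq_pow_sum] at h
  exact pow_right_injective₀ two_pos (by norm_num) h

/-- The generalized power of a matrix of polynomials. -/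
def powerPolynomial {R : Type*} [CommRing R] (κ : Fin m → ℕ) (W : Matrix (Fin m) (Fin m) R) : R :=
  ∏ j : Fin m, (W.submatrix (Fin.castLE (Nat.succ_le_of_lt j.2))
    (Fin.castLE (Nat.succ_le_of_lt j.2)) :
      Matrix (Fin ((j : ℕ) + 1)) (Fin ((j : ℕ) + 1)) R).det ^ (κ j - nextPart κ j)

theorem map_powerPolynomial {R : Type*} [CommRing R] (f : R →+* ℝ) (κ : Fin m → ℕ)
    (W : Matrix (Fin m) (Fin m) R) :
    f (powerPolynomial κ W) = generalizedPower κ (W.map f) := by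
  simp only [powerPolynomial, generalizedPower, leadingMinor, map_prod, map_pow, RingHom.map_det]
  rfl

theorem isHomogeneous_powerPolynomial {σ R : Type*} [CommRing R] {d : ℕ} {κ : Fin m → ℕ}
    (hκ : Antitone κ) {W : Matrix (Fin m) (Fin m) (MvPolynomial σ R)}
    (hW : ∀ i j, (W i j).IsHomogeneous d) :
    (powerPolynomial κ W).IsHomogeneous (d * ∑ j, κ j) := by
  rw [← sum_mul_sub_nextPart hκ, Finset.mul_sum]
  refine MvPolynomial.IsHomogeneous.prod _ _ _ fun j _ => ?_
  rw [← mul_assoc]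
  exact (isHomogeneous_det fun _ _ => hW _ _).pow _

/-- The generic matrix. -/
noncomputable def genericMatrix (m : ℕ) (R : Type*) [CommRing R] :
    Matrix (Fin m) (Fin m) (MvPolynomial (Fin m × Fin m) R) :=
  Matrix.of fun i j => MvPolynomial.X (i, j)

/-- The matrix of coordinate functions on the orthogonal group. -/
noncomputable def orthogonalMatrix (m : ℕ) :
    Matrix (Fin m) (Fin m)
      (MvPolynomial (Fin m × Fin m) C(Matrix.orthogonalGroup (Fin m) ℝ, ℝ)) :=
  Matrix.of fun i j => MvPolynomial.C
    ⟨fun H => (H : Matrix (Fin m) (Fin m) ℝ) i j, continuous_orthogonal_val.matrix_elem i j⟩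

theorem genericMatrix_map {R : Type*} [CommRing R] (f : R →+* ℝ) (q : Fin m × Fin m → ℝ) :
    (genericMatrix m R).map (MvPolynomial.eval₂Hom f q) = ofEntries q := by
  ext i j
  simp [genericMatrix, ofEntries]

theorem orthogonalMatrix_map (H : Matrix.orthogonalGroup (Fin m) ℝ) (q : Fin m × Fin m → ℝ) :
    (orthogonalMatrix m).map (MvPolynomial.eval₂Hom (evalAt H) q) = H := by
  ext i j
  simp only [orthogonalMatrix, Matrix.map_apply, Matrix.of_apply, MvPolynomial.eval₂Hom_C]
  rfl

theorem isHomogeneous_genericMatrix {R : Type*} [CommRing R] (i j : Fin m) :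
    (genericMatrix m R i j).IsHomogeneous 1 := MvPolynomial.isHomogeneous_X _ _

theorem isHomogeneous_orthogonalMatrix (i j : Fin m) :
    (orthogonalMatrix m i j).IsHomogeneous 0 := MvPolynomial.isHomogeneous_C _ _

theorem transpose_map_ringHom {R : Type*} [CommRing R] (f : R →+* ℝ)
    (W : Matrix (Fin m) (Fin m) R) : Wᵀ.map f = (W.map f)ᵀ := rfl

/-- Over the coefficient ring of continuous functions on O(m), the entries of H have degree 0 and
those of Y degree 1, so HYHᵀ has entries of degree 1. -/
theorem isHomPoly_sphericalPolynomial {k : ℕ} {κ : Fin m → ℕ} (hκ : κ ∈ partitions m k) :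
    IsHomPoly (fun q => sphericalPolynomial κ (ofEntries q)) k := by
  have hk : ∑ j, κ j = k := (Finset.mem_piAntidiag.1 (Finset.mem_filter.1 hκ).1).1
  have h := isHomPoly_average (orthogonalHaar m) (isHomogeneous_powerPolynomial
    (antitone_of_mem_partitions hκ) (isHomogeneous_mul_entries (isHomogeneous_mul_entries
      isHomogeneous_orthogonalMatrix isHomogeneous_genericMatrix)
      (W := (orthogonalMatrix m)ᵀ) fun i j => isHomogeneous_orthogonalMatrix j i))
  simp only [map_powerPolynomial, Matrix.map_mul, transpose_map_ringHom, genericMatrix_map,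
    orthogonalMatrix_map, hk, zero_add, add_zero, one_mul] at h
  exact h

theorem isHomPoly_sphericalPolynomial_mul_transpose {k : ℕ} {κ : Fin m → ℕ}
    (hκ : κ ∈ partitions m k) :
    IsHomPoly (fun q => sphericalPolynomial κ (ofEntries q * (ofEntries q)ᵀ)) (2 * k) := by
  have hk : ∑ j, κ j = k := (Finset.mem_piAntidiag.1 (Finset.mem_filter.1 hκ).1).1
  have h := isHomPoly_average (orthogonalHaar m) (isHomogeneous_powerPolynomial
    (antitone_of_mem_partitions hκ) (isHomogeneous_mul_entries (isHomogeneous_mul_entries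
      isHomogeneous_orthogonalMatrix (isHomogeneous_mul_entries isHomogeneous_genericMatrix
        (W := (genericMatrix m _)ᵀ) fun i j => isHomogeneous_genericMatrix j i))
      (W := (orthogonalMatrix m)ᵀ) fun i j => isHomogeneous_orthogonalMatrix j i))
  simp only [map_powerPolynomial, Matrix.map_mul, transpose_map_ringHom, genericMatrix_map,
    orthogonalMatrix_map, hk, zero_add, add_zero, Nat.reduceAdd] at h
  exact h

theorem map_trace_ringHom {R : Type*} [CommRing R] (f : R →+* ℝ) (W : Matrix (Fin m) (Fin m) R) :
    f W.trace = (W.map f).trace := by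
  simp [Matrix.trace]

theorem isHomogeneous_trace {σ R : Type*} [CommRing R] {d : ℕ}
    {W : Matrix (Fin m) (Fin m) (MvPolynomial σ R)} (hW : ∀ i j, (W i j).IsHomogeneous d) :
    W.trace.IsHomogeneous d :=
  MvPolynomial.IsHomogeneous.sum _ _ _ fun i _ => hW i i

/-- The even moments of the linear functional `H ↦ tr (MH)` on the orthogonal group. -/
noncomputable def orthogonalMoment (k : ℕ) (M : Matrix (Fin m) (Fin m) ℝ) : ℝ :=
  ∫ H, (M * (H : Matrix (Fin m) (Fin m) ℝ)).trace ^ (2 * k) ∂(orthogonalHaar m)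

theorem isHomPoly_orthogonalMoment (k : ℕ) :
    IsHomPoly (fun q : Fin m × Fin m → ℝ => orthogonalMoment k (ofEntries q)) (2 * k) := by
  have h := isHomPoly_average (orthogonalHaar m) ((isHomogeneous_trace
    (isHomogeneous_mul_entries isHomogeneous_genericMatrix
      (isHomogeneous_orthogonalMatrix (m := m)))).pow (2 * k))
  simp only [map_pow, map_trace_ringHom, Matrix.map_mul, genericMatrix_map,
    orthogonalMatrix_map, add_zero, one_mul] at h
  exact h

theorem isHomPoly_trace_pow (k : ℕ) :
    IsHomPoly (fun q : Fin m × Fin m → ℝ => (ofEntries q * (ofEntries q)ᵀ).trace ^ k) (2 * k) := by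
  refine ⟨(genericMatrix m ℝ * (genericMatrix m ℝ)ᵀ).trace ^ k,
    (isHomogeneous_trace (isHomogeneous_mul_entries isHomogeneous_genericMatrix
      (W := (genericMatrix m _)ᵀ) fun i j => isHomogeneous_genericMatrix j i)).pow k, fun q => ?_⟩
  have h := genericMatrix_map (RingHom.id ℝ) q
  change MvPolynomial.eval₂Hom (RingHom.id ℝ) q _ = _
  rw [map_pow, map_trace_ringHom, Matrix.map_mul, transpose_map_ringHom, h]

theorem isHomPoly_trace (k : ℕ) :
    IsHomPoly (fun q : Fin m × Fin m → ℝ => (ofEntries q).trace ^ k) k := by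
  have hh := (isHomogeneous_trace (isHomogeneous_genericMatrix (m := m) (R := ℝ))).pow k
  rw [one_mul] at hh
  refine ⟨(genericMatrix m ℝ).trace ^ k, hh, fun q => ?_⟩
  have h := genericMatrix_map (RingHom.id ℝ) q
  change MvPolynomial.eval₂Hom (RingHom.id ℝ) q _ = _
  rw [map_pow, map_trace_ringHom, h]

end PowerPolynomials

/-! ### Bi-invariant functions and singular values -/

section BiInvariant

variable {m : ℕ}

/-- Invariance under the orthogonal group on both sides. -/
def IsBiInvariant (φ : Matrix (Fin m) (Fin m) ℝ → ℝ) : Prop :=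
  ∀ (G H : Matrix.orthogonalGroup (Fin m) ℝ) (M : Matrix (Fin m) (Fin m) ℝ),
    φ ((G : Matrix (Fin m) (Fin m) ℝ) * M * (H : Matrix (Fin m) (Fin m) ℝ)) = φ M

/-- Orthogonal diagonalization of a real symmetric matrix. -/
theorem exists_orthogonal_diagonal {Y : Matrix (Fin m) (Fin m) ℝ} (hY : Y.IsSymm) :
    ∃ (U : Matrix.orthogonalGroup (Fin m) ℝ) (x : Fin m → ℝ),
      Y = (U : Matrix (Fin m) (Fin m) ℝ) * Matrix.diagonal x *
        (U : Matrix (Fin m) (Fin m) ℝ)ᵀ := by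
  have hH : Y.IsHermitian := by
    rw [Matrix.IsHermitian, Matrix.conjTranspose_eq_transpose_of_trivial]; exact hY
  refine ⟨hH.eigenvectorUnitary, hH.eigenvalues, ?_⟩
  have := hH.spectral_theorem
  rw [Unitary.conjStarAlgAut_apply, Matrix.star_eq_conjTranspose,
    Matrix.conjTranspose_eq_transpose_of_trivial] at this
  exact this

theorem isUnit_orthogonal (U : Matrix.orthogonalGroup (Fin m) ℝ) :
    IsUnit (U : Matrix (Fin m) (Fin m) ℝ) :=
  IsUnit.of_mul_eq_one _ (orthogonal_mul_transpose U)

/-- Singular value decomposition of an invertible matrix. -/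
theorem exists_singularValues {M : Matrix (Fin m) (Fin m) ℝ} (hM : IsUnit M.det) :
    ∃ (G H : Matrix.orthogonalGroup (Fin m) ℝ) (x : Fin m → ℝ),
      M = (G : Matrix (Fin m) (Fin m) ℝ) * Matrix.diagonal x *
        (H : Matrix (Fin m) (Fin m) ℝ) := by
  have hS := posDef_mul_transpose hM
  obtain ⟨U, x, hsp⟩ := exists_orthogonal_diagonal (Y := M * Mᵀ) (by
    rw [Matrix.IsSymm, Matrix.transpose_mul, Matrix.transpose_transpose])
  have hpos : ∀ i, 0 < x i := by
    have h := hS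
    rw [hsp, posDef_conj_iff (isUnit_orthogonal U), Matrix.posDef_diagonal_iff] at h
    exact h
  set K := (U : Matrix (Fin m) (Fin m) ℝ) * Matrix.diagonal fun i => √(x i) with hK
  have hKK : M * Mᵀ = K * Kᵀ := by
    rw [hK, Matrix.transpose_mul, Matrix.diagonal_transpose, ← Matrix.mul_assoc,
      Matrix.mul_assoc _ (Matrix.diagonal _) (Matrix.diagonal _), Matrix.diagonal_mul_diagonal, hsp]
    congr 3
    ext i
    exact (Real.mul_self_sqrt (hpos i).le).symm
  have hKu : IsUnit K.det := by
    have h := congrArg Matrix.det hKK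
    rw [Matrix.det_mul K, Matrix.det_transpose] at h
    exact isUnit_of_mul_isUnit_left (h ▸ posDef_isUnit_det hS)
  obtain ⟨H, hH⟩ := exists_orthogonal_of_mul_transpose_eq hKu hKK
  exact ⟨U, H, _, hH⟩

/-- The singular value decomposition reduces invertible matrices to diagonal ones, and invertible
matrices are dense. -/
theorem IsBiInvariant.ext {φ ψ : Matrix (Fin m) (Fin m) ℝ → ℝ} (hφ : IsBiInvariant φ)
    (hψ : IsBiInvariant ψ) (hφc : Continuous φ) (hψc : Continuous ψ)
    (h : ∀ x : Fin m → ℝ, φ (Matrix.diagonal x) = ψ (Matrix.diagonal x)) : φ = ψ := by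
  refine Continuous.ext_on dense_det_ne_zero hφc hψc fun M hM => ?_
  obtain ⟨G, H, x, rfl⟩ := exists_singularValues (isUnit_iff_ne_zero.2 hM)
  rw [hφ, hψ, h]

/-- The orthogonal matrix of a permutation. -/
def permOrthogonal (τ : Equiv.Perm (Fin m)) : Matrix.orthogonalGroup (Fin m) ℝ :=
  ⟨(1 : Matrix (Fin m) (Fin m) ℝ).submatrix τ id, mem_orthogonal_of_mul_transpose (by
    ext i j
    simp [Matrix.mul_apply, Matrix.one_apply])⟩

/-- The orthogonal matrix of a vector of signs. -/
def signOrthogonal (ε : Fin m → ℝ) (hε : ∀ i, ε i * ε i = 1) : Matrix.orthogonalGroup (Fin m) ℝ :=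
  ⟨Matrix.diagonal ε, mem_orthogonal_of_mul_transpose (by
    rw [Matrix.diagonal_transpose, Matrix.diagonal_mul_diagonal]
    simp [hε])⟩

theorem IsBiInvariant.diagonal_sign {φ : Matrix (Fin m) (Fin m) ℝ → ℝ} (hφ : IsBiInvariant φ)
    (ε : Fin m → ℝ) (hε : ∀ i, ε i * ε i = 1) (x : Fin m → ℝ) :
    φ (Matrix.diagonal fun i => ε i * x i) = φ (Matrix.diagonal x) := by
  rw [← hφ (signOrthogonal ε hε) 1 (Matrix.diagonal x)]
  simp [signOrthogonal]

theorem IsBiInvariant.diagonal_perm {φ : Matrix (Fin m) (Fin m) ℝ → ℝ} (hφ : IsBiInvariant φ)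
    (τ : Equiv.Perm (Fin m)) (x : Fin m → ℝ) :
    φ (Matrix.diagonal (x ∘ τ)) = φ (Matrix.diagonal x) := by
  rw [← hφ (permOrthogonal τ) ⟨_, (permOrthogonal τ⁻¹).2⟩ (Matrix.diagonal x)]
  congr 1
  ext i j
  simp only [permOrthogonal, Matrix.mul_apply, Matrix.submatrix_apply, Matrix.one_apply,
    Matrix.diagonal_apply, id_eq, Function.comp_apply, Equiv.Perm.inv_def]
  simp [Equiv.eq_symm_apply, eq_comm]
  split_ifs with h
  · rw [h]
  · rfl

end BiInvariant

/-! ### Even symmetric polynomials and the expansion of bi-invariant ones -/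

section EvenSymmetric

open MvPolynomial

variable {m : ℕ}

theorem aeval_C_mul_X_monomial {σ : Type*} [Fintype σ] (ε : σ → ℝ) (α : σ →₀ ℕ) (c : ℝ) :
    aeval (fun i => C (ε i) * X i) (monomial α c) =
      (monomial α (c * ∏ i, ε i ^ α i) : MvPolynomial σ ℝ) := by
  rw [aeval_monomial, Finsupp.prod_fintype _ _ fun i => pow_zero _]
  simp only [mul_pow, Finset.prod_mul_distrib, ← C_pow]
  rw [← map_prod, ← mul_assoc, algebraMap_eq, ← C_mul, monomial_eq,
    Finsupp.prod_fintype _ _ fun i => pow_zero _]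

theorem coeff_aeval_C_mul_X {σ : Type*} [Fintype σ] (ε : σ → ℝ) (p : MvPolynomial σ ℝ)
    (α : σ →₀ ℕ) :
    coeff α (aeval (fun i => C (ε i) * X i) p : MvPolynomial σ ℝ) =
      coeff α p * ∏ i, ε i ^ α i := by
  classical
  induction p using MvPolynomial.induction_on' with
  | monomial β c =>
    rw [aeval_C_mul_X_monomial, coeff_monomial, coeff_monomial]
    split_ifs with h
    · rw [h]
    · simp
  | add p q hp hq => rw [map_add, coeff_add, coeff_add, hp, hq, add_mul]

/-- Homogeneous polynomials of degree `2k` that are even in each variable and symmetric. -/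
def evenSymmetric (m k : ℕ) : Submodule ℝ (MvPolynomial (Fin m) ℝ) where
  carrier := {p | p.IsHomogeneous (2 * k) ∧
    (∀ ε : Fin m → ℝ, (∀ i, ε i * ε i = 1) → ∀ x, eval (fun i => ε i * x i) p = eval x p) ∧
    ∀ (τ : Equiv.Perm (Fin m)) (x : Fin m → ℝ), eval (x ∘ τ) p = eval x p}
  add_mem' := fun {p q} hp hq => ⟨hp.1.add hq.1, fun ε hε x => by
    rw [map_add, map_add, hp.2.1 ε hε, hq.2.1 ε hε], fun τ x => by
    rw [map_add, map_add, hp.2.2, hq.2.2]⟩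
  zero_mem' := ⟨isHomogeneous_zero _ _ _, fun _ _ _ => by simp, fun _ _ => by simp⟩
  smul_mem' := fun c p hp => ⟨by
    rw [smul_eq_C_mul]; exact hp.1.C_mul c, fun ε hε x => by
    rw [smul_eval, smul_eval, hp.2.1 ε hε], fun τ x => by
    rw [smul_eval, smul_eval, hp.2.2]⟩

theorem exists_perm_antitone (β : Fin m → ℕ) : ∃ τ : Equiv.Perm (Fin m), Antitone (β ∘ τ) := by
  refine ⟨Tuple.sort fun i => OrderDual.toDual (β i), ?_⟩
  exact Tuple.monotone_sort fun i => OrderDual.toDual (β i)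

/-- Changing the sign of one variable kills every coefficient with an odd exponent there. A
permutation makes an even exponent vector decreasing, hence of the form 2κ. So the coefficients at
the 2κ determine the polynomial, which bounds the dimension by the number of partitions. -/
theorem evenSymmetric_eq_zero {k : ℕ} {p : MvPolynomial (Fin m) ℝ} (hp : p ∈ evenSymmetric m k)
    (h : ∀ κ ∈ partitions m k, coeff (Finsupp.equivFunOnFinite.symm fun i => 2 * κ i) p = 0) :
    p = 0 := by
  obtain ⟨hhom, hsign, hperm⟩ := hp
  ext α
  rw [coeff_zero]
  by_cases hdeg : α.degree = 2 * k
  swap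
  · exact hhom.coeff_eq_zero hdeg
  by_cases hodd : ∃ i, Odd (α i)
  · obtain ⟨i, hi⟩ := hodd
    set ε : Fin m → ℝ := Function.update 1 i (-1) with hε
    have hε1 : ∀ j, ε j * ε j = 1 := by
      intro j
      by_cases hj : j = i
      · subst hj; simp [hε]
      · simp [hε, hj]
    have heq : (aeval (fun i => C (ε i) * X i) p : MvPolynomial (Fin m) ℝ) = p := by
      refine MvPolynomial.funext fun x => ?_
      rw [← hsign ε hε1 x, ← coe_aeval_eq_eval, RingHom.coe_coe, ← AlgHom.comp_apply, comp_aeval]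
      simp
    have hc := coeff_aeval_C_mul_X ε p α
    rw [heq, Finset.prod_eq_single i (fun j _ hj => by simp [hε, hj]) (by simp)] at hc
    simp only [hε, Function.update_self, hi.neg_one_pow] at hc
    linarith
  · have heven : ∀ i, 2 * (α i / 2) = α i := fun i =>
      Nat.two_mul_div_two_of_even (by simpa using not_exists.1 hodd i)
    obtain ⟨τ, hτ⟩ := exists_perm_antitone fun i => α i / 2
    set κ : Fin m → ℕ := (fun i => α i / 2) ∘ τ with hκ
    have hmem : κ ∈ partitions m k := by
      refine Finset.mem_filter.2 ⟨Finset.mem_piAntidiag.2 ⟨?_, fun _ _ => Finset.mem_univ _⟩, hτ⟩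
      have h1 : ∑ i, α i = 2 * k := by rwa [← Finsupp.degree_eq_sum]
      have h2 : ∑ i, κ i = ∑ i, α i / 2 := Equiv.sum_comp τ fun i => α i / 2
      have h3 : 2 * ∑ i, α i / 2 = ∑ i, α i := by
        rw [Finset.mul_sum]; exact Finset.sum_congr rfl fun i _ => heven i
      have : ∑ i, κ i = k := by omega
      exact this
    have hren : rename τ p = p := by
      refine MvPolynomial.funext fun x => ?_
      rw [eval_rename, hperm]
    have hc := coeff_rename_mapDomain (τ : Fin m → Fin m) τ.injective p
      (Finsupp.equivFunOnFinite.symm fun i => 2 * κ i)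
    rw [hren, h κ hmem] at hc
    rw [← hc]
    congr 1
    ext i
    rw [← Finsupp.equivMapDomain_eq_mapDomain, Finsupp.equivMapDomain_apply]
    simp [hκ, heven]

/-- Diagonal sign matrices and permutation matrices are orthogonal, so bi-invariance makes the
restriction to diagonal matrices even and symmetric. -/
theorem eval_diagonal_isHomPoly {φ : Matrix (Fin m) (Fin m) ℝ → ℝ} {k : ℕ}
    (hφ : IsHomPoly (fun q => φ (ofEntries q)) (2 * k)) (hbi : IsBiInvariant φ) :
    ∃ p ∈ evenSymmetric m k, ∀ x, eval x p = φ (Matrix.diagonal x) := by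
  obtain ⟨P, hP, hPe⟩ := hφ
  set g : Fin m × Fin m → MvPolynomial (Fin m) ℝ := fun p => if p.1 = p.2 then X p.1 else 0 with hg
  have hghom : ∀ p, (g p).IsHomogeneous 1 := by
    intro p
    simp only [hg]
    split_ifs
    · exact isHomogeneous_X _ _
    · exact isHomogeneous_zero _ _ _
  have heval : ∀ x, eval x (aeval g P : MvPolynomial (Fin m) ℝ) = φ (Matrix.diagonal x) := by
    intro x
    have h1 : eval x (aeval g P : MvPolynomial (Fin m) ℝ) = eval (fun p => eval x (g p)) P := by
      rw [← coe_aeval_eq_eval, RingHom.coe_coe, ← AlgHom.comp_apply, comp_aeval]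
      simp
    rw [h1, hPe]
    change φ (ofEntries _) = _
    congr 1
    ext i j
    by_cases hij : i = j
    · subst hij; simp [ofEntries, hg]
    · simp [ofEntries, hg, hij]
  refine ⟨aeval g P, ⟨?_, fun ε hε x => ?_, fun τ x => ?_⟩, heval⟩
  · have := hP.aeval g hghom
    rwa [one_mul] at this
  · rw [heval, heval, hbi.diagonal_sign ε hε]
  · rw [heval, heval, hbi.diagonal_perm]

theorem isBiInvariant_sphericalPolynomial (κ : Fin m → ℕ) :
    IsBiInvariant fun M => sphericalPolynomial κ (M * Mᵀ) := by
  intro G H M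
  beta_reduce
  rw [← sphericalPolynomial_conj κ G (M * Mᵀ)]
  congr 1
  simp only [Matrix.transpose_mul, Matrix.mul_assoc]
  rw [← Matrix.mul_assoc (H : Matrix (Fin m) (Fin m) ℝ), orthogonal_mul_transpose, Matrix.one_mul]

theorem IsHomPoly.continuous {φ : Matrix (Fin m) (Fin m) ℝ → ℝ} {n : ℕ}
    (hφ : IsHomPoly (fun q => φ (ofEntries q)) n) : Continuous φ := by
  obtain ⟨p, -, hp⟩ := hφ
  beta_reduce at hp
  have h : φ = fun M => eval (entriesOf M) p := by
    ext M
    rw [hp, ofEntries_entriesOf]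
  rw [h]
  refine (continuous_eval p).comp (continuous_pi fun i => ?_)
  exact continuous_id.matrix_elem _ _

/-- A bi-invariant homogeneous polynomial of degree `2k` is a linear combination of the functions
`M ↦ Φ_κ(MMᵀ)` with `|κ| = k`. -/
theorem IsBiInvariant.exists_expansion {φ : Matrix (Fin m) (Fin m) ℝ → ℝ} (hbi : IsBiInvariant φ)
    {k : ℕ} (hφ : IsHomPoly (fun q => φ (ofEntries q)) (2 * k)) :
    ∃ d : (Fin m → ℕ) → ℝ, ∀ M : Matrix (Fin m) (Fin m) ℝ,
      φ M = ∑ κ ∈ partitions m k, d κ * sphericalPolynomial κ (M * Mᵀ) := by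
  classical
  have hsph : ∀ κ : partitions m k, ∃ p ∈ evenSymmetric m k,
      ∀ x, eval x p = sphericalPolynomial (κ : Fin m → ℕ)
        (Matrix.diagonal x * (Matrix.diagonal x)ᵀ) := fun κ =>
    eval_diagonal_isHomPoly (φ := fun M => sphericalPolynomial (κ : Fin m → ℕ) (M * Mᵀ))
      (isHomPoly_sphericalPolynomial_mul_transpose κ.2) (isBiInvariant_sphericalPolynomial _)
  choose P hPmem hPeval using hsph
  obtain ⟨p, hpmem, hpeval⟩ := eval_diagonal_isHomPoly hφ hbi
  -- The coefficients at the exponents 2κ; this map is injective on even symmetric polynomials.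
  let L : MvPolynomial (Fin m) ℝ →ₗ[ℝ] (partitions m k → ℝ) :=
    LinearMap.pi fun κ => lcoeff ℝ (Finsupp.equivFunOnFinite.symm fun i => 2 * (κ : Fin m → ℕ) i)
  have hL : ∀ q ∈ evenSymmetric m k, L q = 0 → q = 0 := fun q hq hq0 =>
    evenSymmetric_eq_zero hq fun κ hκ => congrFun hq0 ⟨κ, hκ⟩
  have hcont : ∀ κ : Fin m → ℕ, Continuous fun M : Matrix (Fin m) (Fin m) ℝ =>
      sphericalPolynomial κ (M * Mᵀ) := fun κ =>
    (continuous_sphericalPolynomial κ).comp (by fun_prop)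
  have hsum : ∀ d : (Fin m → ℕ) → ℝ,
      IsBiInvariant fun M => ∑ κ ∈ partitions m k, d κ * sphericalPolynomial κ (M * Mᵀ) :=
    fun d G H M => Finset.sum_congr rfl fun κ _ =>
      congrArg (d κ * ·) (isBiInvariant_sphericalPolynomial κ G H M)
  have hsumc : ∀ d : (Fin m → ℕ) → ℝ, Continuous fun M : Matrix (Fin m) (Fin m) ℝ =>
      ∑ κ ∈ partitions m k, d κ * sphericalPolynomial κ (M * Mᵀ) := fun d =>
    continuous_finsetSum _ fun κ _ => continuous_const.mul (hcont κ)
  have hind : LinearIndependent ℝ fun κ => L (P κ) := by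
    rw [Fintype.linearIndependent_iff]
    intro c hc
    have h0 : ∑ κ, c κ • P κ = 0 := by
      refine hL _ (Submodule.sum_mem _ fun κ _ => Submodule.smul_mem _ _ (hPmem κ)) ?_
      simpa using hc
    set d : (Fin m → ℕ) → ℝ := fun κ => if h : κ ∈ partitions m k then c ⟨κ, h⟩ else 0 with hd
    have hdz := sphericalPolynomial_independent k (d := d) (by
      refine congrFun (IsBiInvariant.ext (hsum d) (ψ := fun _ => 0) (fun _ _ _ => rfl) (hsumc d)
        continuous_const fun x => ?_)
      have h1 := congrArg (eval x) h0
      simp only [map_sum, smul_eval, hPeval, map_zero] at h1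
      rw [← h1, ← Finset.sum_coe_sort (partitions m k)]
      refine Finset.sum_congr rfl fun κ _ => ?_
      simp [hd])
    intro κ
    have := hdz κ κ.2
    simpa [hd] using this
  -- The vectors L(P_κ) are independent and as many as the dimension of the target, so they span it.
  -- Injectivity of L lifts the expansion of L(p) to one of p.
  have htop := hind.span_eq_top_of_card_eq_finrank' (by simp)
  obtain ⟨c, hc⟩ := (Submodule.mem_span_range_iff_exists_fun ℝ).1
    (htop ▸ Submodule.mem_top : L p ∈ Submodule.span ℝ (Set.range fun κ => L (P κ)))
  have h0 : p - ∑ κ, c κ • P κ = 0 := by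
    refine hL _ (Submodule.sub_mem _ hpmem
      (Submodule.sum_mem _ fun κ _ => Submodule.smul_mem _ _ (hPmem κ))) ?_
    rw [map_sub, sub_eq_zero, ← hc]
    simp
  set d : (Fin m → ℕ) → ℝ := fun κ => if h : κ ∈ partitions m k then c ⟨κ, h⟩ else 0 with hd
  refine ⟨d, congrFun (IsBiInvariant.ext hbi (hsum d) hφ.continuous (hsumc d) fun x => ?_)⟩
  have h1 := congrArg (eval x) (sub_eq_zero.1 h0)
  simp only [map_sum, smul_eval, hPeval, hpeval] at h1
  rw [h1, ← Finset.sum_coe_sort (partitions m k)]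
  refine Finset.sum_congr rfl fun κ _ => ?_
  simp [hd]

end EvenSymmetric

/-! ### Existence of the zonal normalizing constants -/

section ZonalConstants

variable {m : ℕ}

theorem isBiInvariant_trace_pow (k : ℕ) :
    IsBiInvariant fun M : Matrix (Fin m) (Fin m) ℝ => (M * Mᵀ).trace ^ k := by
  intro G H M
  beta_reduce
  rw [← trace_orthogonal_conj G (M * Mᵀ)]
  congr 2
  simp only [Matrix.transpose_mul, Matrix.mul_assoc]
  rw [← Matrix.mul_assoc (H : Matrix (Fin m) (Fin m) ℝ), orthogonal_mul_transpose, Matrix.one_mul]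

theorem isBiInvariant_orthogonalMoment (k : ℕ) :
    IsBiInvariant (orthogonalMoment k : Matrix (Fin m) (Fin m) ℝ → ℝ) := by
  intro G H M
  have h1 := integral_mul_left_eq_self (μ := orthogonalHaar m)
    (fun U : Matrix.orthogonalGroup (Fin m) ℝ =>
      (M * (U : Matrix (Fin m) (Fin m) ℝ)).trace ^ (2 * k)) H
  have h2 := integral_mul_right_eq_self (μ := orthogonalHaar m)
    (fun U : Matrix.orthogonalGroup (Fin m) ℝ =>
      (M * ((H * U : Matrix.orthogonalGroup (Fin m) ℝ) : Matrix (Fin m) (Fin m) ℝ)).trace ^ (2 * k))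
      G
  rw [orthogonalMoment, orthogonalMoment, ← h1, ← h2]
  congr 1
  ext U
  congr 1
  simp only [Submonoid.coe_mul, Matrix.mul_assoc]
  rw [Matrix.trace_mul_comm]
  simp only [Matrix.mul_assoc]

theorem exists_posDef_add_smul {Y : Matrix (Fin m) (Fin m) ℝ} (hY : Y.IsSymm) :
    ∃ t₀ : ℝ, ∀ t, t₀ < t → (Y + t • (1 : Matrix (Fin m) (Fin m) ℝ)).PosDef := by
  obtain ⟨U, x, rfl⟩ := exists_orthogonal_diagonal hY
  refine ⟨∑ i, |x i|, fun t ht => ?_⟩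
  have heq : (U : Matrix (Fin m) (Fin m) ℝ) * Matrix.diagonal x * (U : Matrix (Fin m) (Fin m) ℝ)ᵀ +
      t • (1 : Matrix (Fin m) (Fin m) ℝ) = (U : Matrix (Fin m) (Fin m) ℝ) *
      (Matrix.diagonal fun i => x i + t) * (U : Matrix (Fin m) (Fin m) ℝ)ᵀ := by
    rw [← Matrix.diagonal_add, Matrix.mul_add, Matrix.add_mul, ← Matrix.smul_one_eq_diagonal,
      Matrix.mul_smul, Matrix.mul_one, Matrix.smul_mul, orthogonal_mul_transpose]
  rw [heq, posDef_conj_iff (isUnit_orthogonal U), Matrix.posDef_diagonal_iff]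
  intro i
  have h1 := neg_abs_le (x i)
  have h2 := Finset.single_le_sum (f := fun i => |x i|) (fun _ _ => abs_nonneg _)
    (Finset.mem_univ i)
  linarith

/-- A polynomial identity on positive definite matrices extends to symmetric matrices. -/
theorem isHomPoly_ext_symm {φ ψ : Matrix (Fin m) (Fin m) ℝ → ℝ} {n n' : ℕ}
    (hφ : IsHomPoly (fun q => φ (ofEntries q)) n) (hψ : IsHomPoly (fun q => ψ (ofEntries q)) n')
    (h : ∀ Y : Matrix (Fin m) (Fin m) ℝ, Y.PosDef → φ Y = ψ Y)
    {Y : Matrix (Fin m) (Fin m) ℝ} (hY : Y.IsSymm) : φ Y = ψ Y := by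
  obtain ⟨p, -, hp⟩ := hφ
  obtain ⟨p', -, hp'⟩ := hψ
  beta_reduce at hp hp'
  -- Restrict to the line Y + tI, which is positive definite for large t. The two polynomials in t
  -- agree at infinitely many points, hence also at t = 0.
  set line : Fin m × Fin m → Polynomial ℝ := fun i =>
    Polynomial.C (Y i.1 i.2) + Polynomial.X * Polynomial.C ((1 : Matrix (Fin m) (Fin m) ℝ) i.1 i.2)
  have heval : ∀ (r : MvPolynomial (Fin m × Fin m) ℝ) (t : ℝ),
      (MvPolynomial.aeval line r).eval t =
        MvPolynomial.eval (entriesOf (Y + t • (1 : Matrix (Fin m) (Fin m) ℝ))) r := by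
    intro r t
    rw [← Polynomial.coe_aeval_eq_eval, ← AlgHom.comp_apply, MvPolynomial.comp_aeval,
      ← MvPolynomial.aeval_eq_eval]
    congr 2
    ext i
    simp [line, entriesOf]
    ring
  obtain ⟨t₀, ht₀⟩ := exists_posDef_add_smul hY
  have hz : MvPolynomial.aeval line p - MvPolynomial.aeval line p' = 0 := by
    refine Polynomial.eq_zero_of_infinite_isRoot _ ((Set.Ioi_infinite t₀).mono fun t ht => ?_)
    rw [Set.mem_ofPred_eq, Polynomial.IsRoot.def, Polynomial.eval_sub, heval, heval, hp, hp',
      ofEntries_entriesOf, h _ (ht₀ t ht), sub_self]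
  have h0 := congrArg (Polynomial.eval 0) (sub_eq_zero.1 hz)
  rw [heval, heval, hp, hp', ofEntries_entriesOf, zero_smul, add_zero] at h0
  exact h0

/-- Shows that the condition in the choice of the constants can be met. The function tr(MMᵀ)^k is
bi-invariant, hence expands in the Φ_κ(MMᵀ). Every positive definite Y is such an MMᵀ, and a
polynomial identity passes from these to all symmetric Y. -/
theorem zonalAtOne_spec (k : ℕ) {Y : Matrix (Fin m) (Fin m) ℝ} (hY : Y.IsSymm) :
    Y.trace ^ k = ∑ κ ∈ partitions m k, zonalAtOne m κ * sphericalPolynomial κ Y := by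
  have hex : ∃ c : (Fin m → ℕ) → ℝ, ∀ (k : ℕ) (Y : Matrix (Fin m) (Fin m) ℝ), Y.IsSymm →
      Y.trace ^ k = ∑ κ ∈ partitions m k, c κ * sphericalPolynomial κ Y := by
    choose d hd using fun k => (isBiInvariant_trace_pow (m := m) k).exists_expansion
      (isHomPoly_trace_pow k)
    -- The expansions for different k combine into one family, since κ determines its weight.
    refine ⟨fun κ => d (∑ j, κ j) κ, fun k Y hY => ?_⟩
    have hsum : IsHomPoly (fun q => ∑ κ ∈ partitions m k,
        d (∑ j, κ j) κ * sphericalPolynomial κ (ofEntries q)) k := by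
      have hsph : ∀ κ : partitions m k, IsHomPoly
        (fun q => sphericalPolynomial (κ : Fin m → ℕ) (ofEntries q)) k := fun κ =>
        isHomPoly_sphericalPolynomial κ.2
      choose p hp hpe using hsph
      refine ⟨∑ κ : partitions m k, MvPolynomial.C (d (∑ j, (κ : Fin m → ℕ) j) κ) * p κ,
        MvPolynomial.IsHomogeneous.sum _ _ _ fun κ _ => (hp κ).C_mul _, fun q => ?_⟩
      beta_reduce
      rw [← Finset.sum_coe_sort (partitions m k)]
      simp [hpe]
    refine isHomPoly_ext_symm (φ := fun Y => Y.trace ^ k)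
      (ψ := fun Y => ∑ κ ∈ partitions m k, d (∑ j, κ j) κ * sphericalPolynomial κ Y)
      (isHomPoly_trace k) hsum (fun Z hZ => ?_) hY
    obtain ⟨hB, hBt, hBB⟩ := posDef_sqrt hZ
    have h := hd k (CFC.sqrt Z)
    rw [hBt, hBB] at h
    refine h.trans (Finset.sum_congr rfl fun κ hκ => ?_)
    rw [(Finset.mem_piAntidiag.1 (Finset.mem_filter.1 hκ).1).1]
  exact Classical.epsilon_spec hex k Y hY

end ZonalConstants

/-! ### Moments and Fourier transform of the Gaussian -/

section GaussianMoments

variable {ι : Type*} [Fintype ι]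

theorem exp_mul_exp_neg_dotProduct (c v : ι → ℝ) (t : ℝ) :
    Real.exp (t * (c ⬝ᵥ v)) * Real.exp (-(v ⬝ᵥ v)) =
      Real.exp (t ^ 2 * (c ⬝ᵥ c) / 4) *
        Real.exp (-((v - (t / 2) • c) ⬝ᵥ (v - (t / 2) • c))) := by
  rw [← Real.exp_add, ← Real.exp_add]
  congr 1
  simp only [sub_dotProduct, dotProduct_sub, smul_dotProduct, dotProduct_smul, smul_eq_mul,
    dotProduct_comm v c]
  ring

/-- The measure with density `exp (-|v|²)`. -/
noncomputable def gaussianMeasure (ι : Type*) [Fintype ι] : Measure (ι → ℝ) :=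
  volume.withDensity fun v => (Real.exp (-(v ⬝ᵥ v))).toNNReal

theorem measurable_toNNReal_exp :
    Measurable fun v : ι → ℝ => (Real.exp (-(v ⬝ᵥ v))).toNNReal := by
  have : Measurable fun v : ι → ℝ => Real.exp (-(v ⬝ᵥ v)) :=
    (by fun_prop : Continuous fun v : ι → ℝ => Real.exp (-(v ⬝ᵥ v))).measurable
  exact this.real_toNNReal

theorem integral_gaussianMeasure (f : (ι → ℝ) → ℝ) :
    ∫ v, f v ∂gaussianMeasure ι = ∫ v, f v * Real.exp (-(v ⬝ᵥ v)) := by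
  rw [gaussianMeasure, integral_withDensity_eq_integral_smul measurable_toNNReal_exp]
  refine integral_congr_ae (ae_of_all _ fun v => ?_)
  simp only [NNReal.smul_def, smul_eq_mul]
  rw [Real.coe_toNNReal _ (Real.exp_pos _).le, mul_comm]

theorem integrable_gaussianMeasure (f : (ι → ℝ) → ℝ) :
    Integrable f (gaussianMeasure ι) ↔ Integrable fun v => f v * Real.exp (-(v ⬝ᵥ v)) := by
  rw [gaussianMeasure, integrable_withDensity_iff_integrable_smul measurable_toNNReal_exp]
  refine integrable_congr (ae_of_all _ fun v => ?_)
  simp only [NNReal.smul_def, smul_eq_mul]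
  rw [Real.coe_toNNReal _ (Real.exp_pos _).le, mul_comm]

theorem integrableExpSet_gaussianMeasure (c : ι → ℝ) :
    integrableExpSet (fun v => c ⬝ᵥ v) (gaussianMeasure ι) = Set.univ := by
  refine Set.eq_univ_of_forall fun t => ?_
  change Integrable _ _
  rw [integrable_gaussianMeasure]
  simp only [exp_mul_exp_neg_dotProduct]
  exact (integrable_exp_neg_dotProduct.comp_sub_right ((t / 2) • c)).const_mul _

theorem mgf_gaussianMeasure (c : ι → ℝ) (t : ℝ) :
    mgf (fun v => c ⬝ᵥ v) (gaussianMeasure ι) t =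
      Real.exp (t ^ 2 * (c ⬝ᵥ c) / 4) * √Real.pi ^ Fintype.card ι := by
  rw [mgf, integral_gaussianMeasure]
  simp only [exp_mul_exp_neg_dotProduct]
  rw [integral_const_mul,
    integral_sub_right_eq_self (fun v : ι → ℝ => Real.exp (-(v ⬝ᵥ v))),
    integral_exp_neg_dotProduct]

/-- The even moments of a linear functional under `exp (-|v|²)`. -/
theorem integral_dotProduct_pow_mul_exp (c : ι → ℝ) (k : ℕ) :
    ∫ v : ι → ℝ, (c ⬝ᵥ v) ^ (2 * k) * Real.exp (-(v ⬝ᵥ v)) =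
      √Real.pi ^ Fintype.card ι * ((2 * k).factorial / (k.factorial * 4 ^ k)) * (c ⬝ᵥ c) ^ k := by
  set B := √Real.pi ^ Fintype.card ι with hB
  set s := (c ⬝ᵥ c) / 4 with hs
  -- The Taylor coefficients of B exp(s t²), which is the moment generating function of v ↦ c·v;
  -- only even powers of t occur.
  set coef : ℕ → ℝ := fun n => if Even n then B * (s ^ (n / 2) / (n / 2).factorial) else 0
    with hcoef
  have h1 := hasFPowerSeriesAt_mgf (X := fun v : ι → ℝ => c ⬝ᵥ v) (μ := gaussianMeasure ι)
    (v := 0) (by rw [integrableExpSet_gaussianMeasure]; simp)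
  have h2 : HasFPowerSeriesAt (mgf (fun v : ι → ℝ => c ⬝ᵥ v) (gaussianMeasure ι))
      (FormalMultilinearSeries.ofScalars ℝ coef) 0 := by
    rw [hasFPowerSeriesAt_iff]
    refine Filter.Eventually.of_forall fun t => ?_
    rw [zero_add, mgf_gaussianMeasure]
    have h3 := (NormedSpace.expSeries_div_hasSum_exp (t ^ 2 * (c ⬝ᵥ c) / 4)).mul_right B
    rw [← Real.exp_eq_exp_ℝ] at h3
    have hinj : Function.Injective fun n : ℕ => 2 * n := mul_right_injective₀ two_ne_zero
    rw [← hinj.hasSum_iff]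
    · have h4 : ((fun n => t ^ n • (FormalMultilinearSeries.ofScalars ℝ coef).coeff n) ∘
          fun n => 2 * n) = fun n => (t ^ 2 * (c ⬝ᵥ c) / 4) ^ n / n.factorial * B := by
        refine funext fun n => ?_
        simp only [Function.comp_apply, FormalMultilinearSeries.coeff_ofScalars, hcoef,
          even_two_mul, if_true, smul_eq_mul, Nat.mul_div_cancel_left n two_pos, hs]
        rw [pow_mul]
        ring
      rw [h4]
      exact h3
    · intro n hn
      rw [FormalMultilinearSeries.coeff_ofScalars, hcoef]
      have : ¬Even n := fun ⟨j, hj⟩ => hn ⟨j, by simp only; omega⟩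
      simp [this]
  -- Both power series represent the generating function at 0; their coefficients of t^{2k} give the
  -- moment.
  have h3 := congrArg (fun p => FormalMultilinearSeries.coeff p (2 * k))
    (h1.eq_formalMultilinearSeries h2)
  simp only [FormalMultilinearSeries.coeff_ofScalars, hcoef, even_two_mul, if_true, zero_mul,
    Real.exp_zero, mul_one, Nat.mul_div_cancel_left k two_pos] at h3
  rw [integral_gaussianMeasure, div_eq_iff (by positivity)] at h3
  rw [h3, hs, div_pow]
  field_simp

/-- The Fourier transform of `exp (-|v|²)`. -/
theorem integral_cos_mul_exp (c : ι → ℝ) :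
    Integrable (fun v : ι → ℝ => ((Real.cos (2 * (c ⬝ᵥ v)) * Real.exp (-(v ⬝ᵥ v)) : ℝ) : ℂ)) ∧
    ∫ v : ι → ℝ, ((Real.cos (2 * (c ⬝ᵥ v)) * Real.exp (-(v ⬝ᵥ v)) : ℝ) : ℂ) =
      (√Real.pi : ℂ) ^ Fintype.card ι * Complex.exp (-((c ⬝ᵥ c : ℝ) : ℂ)) := by
  have hpi : ((Real.pi : ℂ) / 1) ^ ((Fintype.card ι : ℂ) / 2) = (√Real.pi : ℂ) ^ Fintype.card ι := by
    rw [div_one, Real.sqrt_eq_rpow, Complex.ofReal_cpow Real.pi_pos.le, ← Complex.cpow_mul_nat]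
    congr 1
    push_cast
    ring
  -- The cosine is the mean of the exponentials for z = i and z = -i, and only z² enters the value
  -- of the integral.
  have key : ∀ z : ℂ, z ^ 2 = -1 →
      Integrable (fun v : ι → ℝ => Complex.exp (-1 * ∑ i, (v i : ℂ) ^ 2 + ∑ i, (2 * z * c i) * v i)) ∧
      ∫ v : ι → ℝ, Complex.exp (-1 * ∑ i, (v i : ℂ) ^ 2 + ∑ i, (2 * z * c i) * v i) =
        (√Real.pi : ℂ) ^ Fintype.card ι * Complex.exp (-((c ⬝ᵥ c : ℝ) : ℂ)) := by
    intro z hz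
    refine ⟨GaussianFourier.integrable_cexp_neg_mul_sum_add (b := 1) (by simp) _, ?_⟩
    rw [GaussianFourier.integral_cexp_neg_mul_sum_add (b := 1) (by simp), hpi]
    congr 2
    simp only [mul_pow, hz, dotProduct]
    push_cast
    rw [← Finset.sum_neg_distrib, Finset.sum_div]
    exact Finset.sum_congr rfl fun i _ => by ring
  have h1 := key Complex.I Complex.I_sq
  have h2 := key (-Complex.I) (by rw [neg_sq, Complex.I_sq])
  have heq : (fun v : ι → ℝ => ((Real.cos (2 * (c ⬝ᵥ v)) * Real.exp (-(v ⬝ᵥ v)) : ℝ) : ℂ)) =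
      fun v => (1 / 2 : ℂ) *
        (Complex.exp (-1 * ∑ i, (v i : ℂ) ^ 2 + ∑ i, (2 * Complex.I * c i) * v i) +
        Complex.exp (-1 * ∑ i, (v i : ℂ) ^ 2 + ∑ i, (2 * -Complex.I * c i) * v i)) := by
    ext v
    have e1 : -1 * ∑ i, (v i : ℂ) ^ 2 = ((-(v ⬝ᵥ v) : ℝ) : ℂ) := by
      simp [dotProduct, sq]
    have e2 : ∀ z : ℂ, ∑ i, (2 * z * c i) * (v i : ℂ) = ((2 * (c ⬝ᵥ v) : ℝ) : ℂ) * z := by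
      intro z
      simp only [dotProduct]
      push_cast
      rw [Finset.mul_sum, Finset.sum_mul]
      exact Finset.sum_congr rfl fun i _ => by ring
    rw [e1, e2, e2, Complex.exp_add, Complex.exp_add, Complex.ofReal_mul, Complex.ofReal_cos,
      Complex.ofReal_exp, Complex.cos, mul_neg, neg_mul]
    ring
  rw [heq]
  refine ⟨(h1.1.add h2.1).const_mul _, ?_⟩
  rw [integral_const_mul, integral_add h1.1 h2.1, h1.2, h2.2]
  ring

end GaussianMoments

/-! ### Trace moments in terms of zonal polynomials -/

section TraceMoments

variable {m : ℕ}

theorem trace_mul_ofEntries (M : Matrix (Fin m) (Fin m) ℝ) (q : Fin m × Fin m → ℝ) :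
    (M * ofEntries q).trace = entriesOf Mᵀ ⬝ᵥ q := by
  simp only [Matrix.trace, Matrix.diag_apply, Matrix.mul_apply, dotProduct,
    Fintype.sum_prod_type, ofEntries, Matrix.of_apply, entriesOf, Matrix.transpose_apply]
  exact Finset.sum_comm

theorem entriesOf_dotProduct_self (M : Matrix (Fin m) (Fin m) ℝ) :
    entriesOf M ⬝ᵥ entriesOf M = (M * Mᵀ).trace := by
  rw [← trace_mul_transpose_ofEntries, ofEntries_entriesOf]

theorem trace_mul_sq_le (M : Matrix (Fin m) (Fin m) ℝ) (q : Fin m × Fin m → ℝ) :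
    (M * ofEntries q).trace ^ 2 ≤ (M * Mᵀ).trace * (q ⬝ᵥ q) := by
  rw [trace_mul_ofEntries, Matrix.trace_mul_comm]
  have h := entriesOf_dotProduct_self Mᵀ
  rw [Matrix.transpose_transpose] at h
  rw [← h]
  simp only [dotProduct]
  have := Finset.sum_mul_sq_le_sq_mul_sq Finset.univ (entriesOf Mᵀ) q
  simpa only [sq] using this

theorem abs_trace_mul_pow_le (M : Matrix (Fin m) (Fin m) ℝ) (q : Fin m × Fin m → ℝ) (k : ℕ) :
    ‖(((M * ofEntries q).trace ^ (2 * k) : ℝ) : ℂ)‖ ≤ (M * Mᵀ).trace ^ k * (q ⬝ᵥ q) ^ k := by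
  rw [Complex.norm_real, pow_mul, norm_pow, Real.norm_of_nonneg (sq_nonneg _), ← mul_pow]
  exact pow_le_pow_left₀ (sq_nonneg _) (trace_mul_sq_le M q) k

variable {ρ : Matrix (Fin m) (Fin m) ℝ → ℂ}

/-- Averaging the trace moments over `O(m)` does not change their integral. -/
theorem integral_orthogonalMoment (hρ : IsOrthogonalDensity ρ)
    (hr : ∀ (H : Matrix.orthogonalGroup (Fin m) ℝ) (Q : Matrix (Fin m) (Fin m) ℝ),
      ρ (Q * (H : Matrix (Fin m) (Fin m) ℝ)) = ρ Q) (k : ℕ) (M : Matrix (Fin m) (Fin m) ℝ) :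
    ∫ q : Fin m × Fin m → ℝ, (orthogonalMoment k (M * ofEntries q) : ℂ) * ρ (ofEntries q) =
      ∫ q : Fin m × Fin m → ℝ, (((M * ofEntries q).trace ^ (2 * k) : ℝ) : ℂ) * ρ (ofEntries q) := by
  set F : Matrix.orthogonalGroup (Fin m) ℝ → (Fin m × Fin m → ℝ) → ℂ := fun H q =>
    (((M * ofEntries q * (H : Matrix (Fin m) (Fin m) ℝ)).trace ^ (2 * k) : ℝ) : ℂ) *
      ρ (ofEntries q) with hF
  have hcont : Continuous fun z : Matrix.orthogonalGroup (Fin m) ℝ × (Fin m × Fin m → ℝ) =>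
      (((M * ofEntries z.2 * (z.1 : Matrix (Fin m) (Fin m) ℝ)).trace ^ (2 * k) : ℝ) : ℂ) := by
    have h1 := continuous_orthogonal_val (m := m)
    have h2 := continuous_ofEntries (m := m)
    exact Complex.continuous_ofReal.comp (by fun_prop)
  have hFint : Integrable (Function.uncurry F) ((orthogonalHaar m).prod volume) := by
    have hdom : Integrable (fun z : Matrix.orthogonalGroup (Fin m) ℝ × (Fin m × Fin m → ℝ) =>
        (1 : ℂ) * (((((M * Mᵀ).trace ^ k : ℝ)) : ℂ) *
          ((((z.2 ⬝ᵥ z.2) ^ k : ℝ) : ℂ) * ρ (ofEntries z.2)))) ((orthogonalHaar m).prod volume) :=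
      (integrable_const (μ := orthogonalHaar m) (1 : ℂ)).mul_prod ((hρ.moments k).const_mul _)
    refine hdom.mono ?_ (ae_of_all _ ?_)
    · exact (hcont.measurable.mul ((hρ.measurable.comp
        continuous_ofEntries.measurable).comp measurable_snd)).aestronglyMeasurable
    · rintro ⟨H, q⟩
      simp only [Function.uncurry, hF, one_mul]
      rw [← mul_assoc ((((M * Mᵀ).trace ^ k : ℝ)) : ℂ), norm_mul, norm_mul, ← Complex.ofReal_mul,
        Complex.norm_real ((M * Mᵀ).trace ^ k * _)]
      refine mul_le_mul_of_nonneg_right (le_trans ?_ (Real.le_norm_self _)) (norm_nonneg _)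
      have h := abs_trace_mul_pow_le ((H : Matrix (Fin m) (Fin m) ℝ) * M) q k
      rw [show (H : Matrix (Fin m) (Fin m) ℝ) * M * ((H : Matrix (Fin m) (Fin m) ℝ) * M)ᵀ =
        (H : Matrix (Fin m) (Fin m) ℝ) * (M * Mᵀ) * (H : Matrix (Fin m) (Fin m) ℝ)ᵀ by
          simp only [Matrix.transpose_mul, Matrix.mul_assoc], trace_orthogonal_conj] at h
      rwa [Matrix.trace_mul_comm, ← Matrix.mul_assoc]
  have hswap := integral_integral_swap hFint
  -- By right invariance of ρ, the inner integral does not depend on H, so its average over O(m) is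
  -- itself.
  have hl : ∀ H : Matrix.orthogonalGroup (Fin m) ℝ, ∫ q, F H q =
      ∫ q : Fin m × Fin m → ℝ, (((M * ofEntries q).trace ^ (2 * k) : ℝ) : ℂ) * ρ (ofEntries q) := by
    intro H
    have h := integral_orthogonal_mul (fun Q : Matrix (Fin m) (Fin m) ℝ =>
      (((M * Q).trace ^ (2 * k) : ℝ) : ℂ) * ρ Q) 1 H
    simp only [OneMemClass.coe_one, Matrix.one_mul, hr, ← Matrix.mul_assoc] at h
    exact h
  simp only [hl] at hswap
  rw [integral_const] at hswap
  rw [probReal_univ, one_smul] at hswap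
  rw [hswap]
  congr 1
  ext q
  simp only [hF]
  rw [integral_mul_const, integral_complex_ofReal, orthogonalMoment]

theorem gaussianDensity_mul_orthogonal (H : Matrix.orthogonalGroup (Fin m) ℝ)
    (Q : Matrix (Fin m) (Fin m) ℝ) :
    gaussianDensity (Q * (H : Matrix (Fin m) (Fin m) ℝ)) = gaussianDensity Q := by
  rw [gaussianDensity, gaussianDensity, Matrix.transpose_mul, Matrix.mul_assoc,
    ← Matrix.mul_assoc _ _ Qᵀ, orthogonal_mul_transpose, Matrix.one_mul]

/-- Replacing the trace moment by its O(m)-average allows an expansion in eigenfunctions. The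
coefficients d_κ do not depend on ρ, so the Gaussian and the ball can be compared. -/
theorem integral_expansion (hρ : IsOrthogonalDensity ρ)
    (hr : ∀ (H : Matrix.orthogonalGroup (Fin m) ℝ) (Q : Matrix (Fin m) (Fin m) ℝ),
      ρ (Q * (H : Matrix (Fin m) (Fin m) ℝ)) = ρ Q) {k : ℕ} {d : (Fin m → ℕ) → ℝ}
    (hd : ∀ M : Matrix (Fin m) (Fin m) ℝ, orthogonalMoment k M =
      ∑ κ ∈ partitions m k, d κ * sphericalPolynomial κ (M * Mᵀ))
    {M : Matrix (Fin m) (Fin m) ℝ} (hM : IsUnit M.det) :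
    ∫ q : Fin m × Fin m → ℝ, (((M * ofEntries q).trace ^ (2 * k) : ℝ) : ℂ) * ρ (ofEntries q) =
      ∑ κ ∈ partitions m k, (d κ * powerMoment κ ρ) * sphericalPolynomial κ (M * Mᵀ) := by
  rw [← integral_orthogonalMoment hρ hr]
  have h : ∀ q : Fin m × Fin m → ℝ,
      (orthogonalMoment k (M * ofEntries q) : ℂ) * ρ (ofEntries q) = ∑ κ ∈ partitions m k,
        (d κ : ℂ) * ((sphericalPolynomial κ (M * ofEntries q * (M * ofEntries q)ᵀ) : ℂ) *
          ρ (ofEntries q)) := by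
    intro q
    rw [hd, Complex.ofReal_sum, Finset.sum_mul]
    exact Finset.sum_congr rfl fun κ _ => by rw [Complex.ofReal_mul, _root_.mul_assoc]
  simp only [h]
  rw [integral_finsetSum _ fun κ _ => (hρ.integrable_sphericalPolynomial κ M).const_mul _]
  refine Finset.sum_congr rfl fun κ _ => ?_
  rw [integral_const_mul, integral_sphericalPolynomial_conj hρ κ hM]
  ring

theorem sphericalPolynomial_independent_complex (k : ℕ) {d : (Fin m → ℕ) → ℂ}
    (hd : ∀ M : Matrix (Fin m) (Fin m) ℝ, IsUnit M.det →
      ∑ κ ∈ partitions m k, d κ * sphericalPolynomial κ (M * Mᵀ) = 0) :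
    ∀ κ ∈ partitions m k, d κ = 0 := by
  have hall : ∀ M : Matrix (Fin m) (Fin m) ℝ,
      ∑ κ ∈ partitions m k, d κ * sphericalPolynomial κ (M * Mᵀ) = 0 := by
    refine congrFun (Continuous.ext_on dense_det_ne_zero ?_ (continuous_const (y := (0 : ℂ)))
      fun M hM => hd M (isUnit_iff_ne_zero.2 hM))
    refine continuous_finsetSum _ fun κ _ => continuous_const.mul (Complex.continuous_ofReal.comp
      ((continuous_sphericalPolynomial κ).comp (by fun_prop)))
  have hre := sphericalPolynomial_independent (m := m) k (d := fun κ => (d κ).re) fun M => by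
    simpa using congrArg Complex.re (hall M)
  have him := sphericalPolynomial_independent (m := m) k (d := fun κ => (d κ).im) fun M => by
    simpa using congrArg Complex.im (hall M)
  exact fun κ hκ => Complex.ext (hre κ hκ) (him κ hκ)

theorem integral_trace_pow_gaussianDensity (k : ℕ) (M : Matrix (Fin m) (Fin m) ℝ) :
    ∫ q : Fin m × Fin m → ℝ,
      (((M * ofEntries q).trace ^ (2 * k) : ℝ) : ℂ) * gaussianDensity (ofEntries q) =
    (√Real.pi : ℂ) ^ (m * m) * ((2 * k).factorial / (k.factorial * 4 ^ k)) *
      ((M * Mᵀ).trace : ℂ) ^ k := by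
  have h := integral_dotProduct_pow_mul_exp (entriesOf Mᵀ) k
  rw [entriesOf_dotProduct_self, Matrix.transpose_transpose, Matrix.trace_mul_comm] at h
  simp only [gaussianDensity_ofEntries, trace_mul_ofEntries, ← Complex.ofReal_mul]
  rw [integral_complex_ofReal, h]
  simp

theorem integral_cos_gaussianDensity (M : Matrix (Fin m) (Fin m) ℝ) :
    Integrable (fun q : Fin m × Fin m → ℝ =>
      ((Real.cos (2 * (M * ofEntries q).trace) : ℝ) : ℂ) * gaussianDensity (ofEntries q)) ∧
    ∫ q : Fin m × Fin m → ℝ,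
      ((Real.cos (2 * (M * ofEntries q).trace) : ℝ) : ℂ) * gaussianDensity (ofEntries q) =
    (√Real.pi : ℂ) ^ (m * m) * Complex.exp (-((M * Mᵀ).trace : ℂ)) := by
  have h := integral_cos_mul_exp (entriesOf Mᵀ)
  rw [entriesOf_dotProduct_self, Matrix.transpose_transpose, Matrix.trace_mul_comm] at h
  simpa only [gaussianDensity_ofEntries, trace_mul_ofEntries, ← Complex.ofReal_mul,
    Fintype.card_prod, Fintype.card_fin] using h

/-- The trace moments of the density `det (1 - QQᵀ)^c` in terms of zonal polynomials. -/
theorem integral_trace_pow_ballDensity {a : ℂ} (ha : ((m : ℝ) - 1) / 2 < (a - (m : ℂ) / 2).re)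
    (k : ℕ) {M : Matrix (Fin m) (Fin m) ℝ} (hM : IsUnit M.det) :
    ∫ q : Fin m × Fin m → ℝ, (((M * ofEntries q).trace ^ (2 * k) : ℝ) : ℂ) *
      ballDensity (a - m - 1 / 2) (ofEntries q) =
    multivariateGamma m (a - (m : ℂ) / 2) / multivariateGamma m a * (√Real.pi : ℂ) ^ (m * m) *
      ((2 * k).factorial / (k.factorial * 4 ^ k)) *
      ∑ κ ∈ partitions m k, 1 / partitionalFactorial a κ * (zonalPolynomial κ (M * Mᵀ) : ℂ) := by
  obtain ⟨d, hd⟩ := (isBiInvariant_orthogonalMoment (m := m) k).exists_expansion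
    (isHomPoly_orthogonalMoment k)
  set C : ℂ := (√Real.pi : ℂ) ^ (m * m) * ((2 * k).factorial / (k.factorial * 4 ^ k)) with hC
  -- The Gaussian trace moment is C (tr MMᵀ)^k, whose expansion has coefficients C times the zonal
  -- constants. Independence identifies d_κ times the Gaussian eigenvalue with C times the zonal
  -- constant of κ.
  have hcoef := sphericalPolynomial_independent_complex (m := m) k
    (d := fun κ => d κ * powerMoment κ gaussianDensity - C * zonalAtOne m κ) fun M hM => by
      have h1 := integral_expansion isOrthogonalDensity_gaussianDensity
        gaussianDensity_mul_orthogonal hd hM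
      have h2 : ((M * Mᵀ).trace : ℂ) ^ k =
          ∑ κ ∈ partitions m k, (zonalAtOne m κ : ℂ) * sphericalPolynomial κ (M * Mᵀ) := by
        rw [← Complex.ofReal_pow, zonalAtOne_spec k (Matrix.isSymm_mul_transpose_self M)]
        push_cast
        rfl
      rw [integral_trace_pow_gaussianDensity, h2, ← hC] at h1
      simp only [sub_mul, Finset.sum_sub_distrib]
      rw [← h1, Finset.mul_sum, sub_eq_zero]
      exact Finset.sum_congr rfl fun κ _ => (mul_assoc _ _ _).symm
  rw [integral_expansion (isOrthogonalDensity_ballDensity ha) (ballDensity_mul_orthogonal _) hd hM,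
    Finset.mul_sum]
  refine Finset.sum_congr rfl fun κ hκ => ?_
  have h1 := powerMoment_ballDensity ha (antitone_of_mem_partitions hκ)
  have h2 := sub_eq_zero.1 (hcoef κ hκ)
  have h3 := partitionalFactorial_ne_zero (half_re_sub ha) κ
  have h4 := multivariateGamma_ne_zero (half_re_sub ha)
  -- Passing to the ball eigenvalue brings in the factor Γ_m(a - m/2) / ([a]_κ Γ_m(a)).
  have h5 : (d κ : ℂ) * powerMoment κ (ballDensity (a - m - 1 / 2)) =
      C * zonalAtOne m κ * multivariateGamma m (a - (m : ℂ) / 2) /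
        (partitionalFactorial a κ * multivariateGamma m a) := by
    rw [eq_div_iff (mul_ne_zero h3 h4), ← h2]
    linear_combination (d κ : ℂ) * h1
  rw [h5, hC, zonalPolynomial]
  push_cast
  field_simp

end TraceMoments

/-! ### The Bessel function as an integral over the ball -/

section BesselIntegral

variable {m : ℕ}

/-- The kernel `∫ cos (2 tr MQ) det (1 - QQᵀ)^c dQ`. -/
noncomputable def cosTransform (c : ℂ) (M : Matrix (Fin m) (Fin m) ℝ) : ℂ :=
  ∫ q : Fin m × Fin m → ℝ, ((Real.cos (2 * (M * ofEntries q).trace) : ℝ) : ℂ) *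
    ballDensity c (ofEntries q)

/-- The cosine series may be integrated termwise because tr MQ is bounded on the ball. -/
theorem hasSum_cosTransform {a : ℂ} (ha : ((m : ℝ) - 1) / 2 < (a - (m : ℂ) / 2).re)
    (M : Matrix (Fin m) (Fin m) ℝ) :
    HasSum (fun k : ℕ => (-1 : ℂ) ^ k * 4 ^ k / (2 * k).factorial *
      ∫ q : Fin m × Fin m → ℝ, (((M * ofEntries q).trace ^ (2 * k) : ℝ) : ℂ) *
        ballDensity (a - m - 1 / 2) (ofEntries q))
      (cosTransform (a - m - 1 / 2) M) := by
  have hρ := isOrthogonalDensity_ballDensity ha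
  have hce := continuous_ofEntries (m := m)
  -- By Cauchy–Schwarz (tr MQ)² ≤ tr(MMᵀ) tr(QQᵀ), and tr(QQᵀ) ≤ m on the ball. With (2k)! ≥ k! the
  -- series is dominated by that of exp(4B).
  set B : ℝ := (M * Mᵀ).trace * m with hB
  have hB0 : 0 ≤ B := mul_nonneg (posSemidef_mul_transpose M).trace_nonneg (Nat.cast_nonneg m)
  have h := hasSum_integral_of_dominated_convergence
    (F := fun (k : ℕ) (q : Fin m × Fin m → ℝ) => (-1 : ℂ) ^ k * 4 ^ k / (2 * k).factorial *
      ((((M * ofEntries q).trace ^ (2 * k) : ℝ) : ℂ) *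
        ballDensity (a - m - 1 / 2) (ofEntries q)))
    (f := fun q => ((Real.cos (2 * (M * ofEntries q).trace) : ℝ) : ℂ) *
      ballDensity (a - m - 1 / 2) (ofEntries q)) (μ := volume)
    (fun k q => (4 * B) ^ k / k.factorial * ‖ballDensity (a - m - 1 / 2) (ofEntries q)‖)
    (fun k => ?_) (fun k => ae_of_all _ fun q => ?_) (ae_of_all _ fun q => ?_) ?_
    (ae_of_all _ fun q => ?_)
  · simp only [integral_const_mul] at h
    exact h
  · refine Measurable.aestronglyMeasurable (Measurable.const_mul (Measurable.mul ?_
      ((measurable_ballDensity _).comp hce.measurable)) _)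
    exact (Complex.continuous_ofReal.comp (by fun_prop)).measurable
  · rw [← mul_assoc, norm_mul]
    by_cases hq : ballDensity (a - m - 1 / 2) (ofEntries q) = 0
    · rw [hq]; simp
    refine mul_le_mul_of_nonneg_right ?_ (norm_nonneg _)
    have h1 : ‖(((M * ofEntries q).trace ^ (2 * k) : ℝ) : ℂ)‖ ≤ B ^ k := by
      refine (abs_trace_mul_pow_le M q k).trans ?_
      rw [hB, mul_pow]
      refine mul_le_mul_of_nonneg_left (pow_le_pow_left₀ ?_
        (dotProduct_le_of_ballDensity_ne_zero hq) k)
        (pow_nonneg (posSemidef_mul_transpose M).trace_nonneg k)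
      rw [← trace_mul_transpose_ofEntries]
      exact (posSemidef_mul_transpose _).trace_nonneg
    rw [norm_mul, norm_div, norm_mul, norm_pow, norm_pow, norm_neg, norm_one, one_pow, one_mul,
      Complex.norm_natCast, Complex.norm_ofNat, mul_pow, div_mul_eq_mul_div]
    have h2 : (0 : ℝ) < k.factorial := by exact_mod_cast k.factorial_pos
    have h3 : (k.factorial : ℝ) ≤ (2 * k).factorial := by
      exact_mod_cast Nat.factorial_le (by omega)
    gcongr
  · exact (Real.summable_pow_div_factorial (4 * B)).mul_right _
  · simp only [tsum_mul_right]
    exact (integrable_ballDensity ha).norm.const_mul _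
  · have h1 := (Real.hasSum_cos (2 * (M * ofEntries q).trace)).mapL Complex.ofRealCLM
    have h2 := h1.mul_right (ballDensity (a - m - 1 / 2) (ofEntries q))
    simp only [Complex.ofRealCLM_apply] at h2
    have h3 : (fun k : ℕ => (-1 : ℂ) ^ k * 4 ^ k / (2 * k).factorial *
        ((((M * ofEntries q).trace ^ (2 * k) : ℝ) : ℂ) *
          ballDensity (a - m - 1 / 2) (ofEntries q))) = fun k : ℕ =>
        (((-1) ^ k * (2 * (M * ofEntries q).trace) ^ (2 * k) / (2 * k).factorial : ℝ) : ℂ) *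
          ballDensity (a - m - 1 / 2) (ofEntries q) := by
      refine funext fun k => ?_
      push_cast
      rw [mul_pow, pow_mul (2 : ℂ), show (2 : ℂ) ^ 2 = 4 by norm_num]
      ring
    rw [h3]
    exact h2

/-- The Bessel function of matrix argument as an integral over the matrix ball. -/
theorem besselA_eq_cosTransform {ν a : ℂ} (hνa : a = ν + ((m : ℂ) + 1) / 2)
    (ha : ((m : ℝ) - 1) / 2 < (a - (m : ℂ) / 2).re)
    {M : Matrix (Fin m) (Fin m) ℝ} (hM : IsUnit M.det) :
    multivariateGamma m (a - (m : ℂ) / 2) * (√Real.pi : ℂ) ^ (m * m) *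
      (multivariateGamma m a * besselA ν (M * Mᵀ)) =
    multivariateGamma m a * cosTransform (a - m - 1 / 2) M := by
  have h4 := multivariateGamma_ne_zero (half_re_sub ha)
  rw [← (hasSum_cosTransform ha M).tsum_eq, besselA, ← hνa, ← mul_assoc (multivariateGamma m a),
    mul_one_div_cancel h4, one_mul, ← tsum_mul_left, ← tsum_mul_left]
  refine tsum_congr fun k => ?_
  rw [integral_trace_pow_ballDensity ha k hM]
  have h2 : (k.factorial : ℂ) ≠ 0 := by exact_mod_cast k.factorial_ne_zero
  have h3 : ((2 * k).factorial : ℂ) ≠ 0 := by exact_mod_cast (2 * k).factorial_ne_zero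
  -- Only constants remain: (2k)!/(k! 4^k) from the trace moment against 4^k/(2k)! from the cosine
  -- leaves 1/k!.
  generalize ∑ κ ∈ partitions m k, 1 / partitionalFactorial a κ *
    (zonalPolynomial κ (M * Mᵀ) : ℂ) = S
  field_simp

end BesselIntegral

/-! ### Measurability of the Bessel function and the square root -/

section Measurability

variable {m : ℕ}

theorem measurable_besselA (ν : ℂ) :
    Measurable (besselA ν : Matrix (Fin m) (Fin m) ℝ → ℂ) := by
  refine Measurable.const_mul (Measurable.tsum fun k => ?_) _
  refine Measurable.const_mul (Finset.measurable_fun_sum _ fun κ _ => Measurable.const_mul ?_ _) _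
  exact (Complex.continuous_ofReal.comp
    (continuous_const.mul (continuous_sphericalPolynomial κ))).measurable

theorem sqrt_mul_self_of_posDef {A : Matrix (Fin m) (Fin m) ℝ} (hA : A.PosDef) :
    CFC.sqrt (A * A) = A :=
  CFC.sqrt_mul_self A (Matrix.nonneg_iff_posSemidef.2 hA.posSemidef)

theorem posDef_mul_self {A : Matrix (Fin m) (Fin m) ℝ} (hA : A.PosDef) : (A * A).PosDef := by
  have h := posDef_mul_transpose (posDef_isUnit_det hA)
  rwa [← Matrix.conjTranspose_eq_transpose_of_trivial, hA.1.eq] at h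

/-- The square root of positive definite matrices, extended by zero. -/
noncomputable def posSqrt : Matrix (Fin m) (Fin m) ℝ → Matrix (Fin m) (Fin m) ℝ :=
  {A | A.PosDef}.indicator CFC.sqrt

theorem posSqrt_of_posDef {A : Matrix (Fin m) (Fin m) ℝ} (hA : A.PosDef) :
    posSqrt A = CFC.sqrt A :=
  Set.indicator_of_mem (s := {A : Matrix (Fin m) (Fin m) ℝ | A.PosDef}) hA _

/-- Squaring is continuous and injective on the positive definite matrices, so by the Lusin–Souslin
theorem it maps Borel sets to Borel sets. This supplies the joint measurability that Fubini
requires. -/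
theorem measurable_posSqrt : Measurable (posSqrt (m := m)) := by
  have : PolishSpace (Matrix (Fin m) (Fin m) ℝ) :=
    inferInstanceAs (PolishSpace (Fin m → Fin m → ℝ))
  have hs := measurableSet_posDef m
  intro t ht
  have him : {A : Matrix (Fin m) (Fin m) ℝ | A.PosDef} ∩ CFC.sqrt ⁻¹' t =
      (fun A => A * A) '' ({A : Matrix (Fin m) (Fin m) ℝ | A.PosDef} ∩ t) := by
    ext A
    constructor
    · rintro ⟨hA, hAt⟩
      obtain ⟨hB, -, hBB⟩ := posDef_sqrt hA
      exact ⟨CFC.sqrt A, ⟨hB, hAt⟩, hBB⟩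
    · rintro ⟨B, ⟨hB, hBt⟩, rfl⟩
      refine ⟨posDef_mul_self hB, ?_⟩
      rw [Set.mem_preimage, sqrt_mul_self_of_posDef hB]
      exact hBt
  have hm : MeasurableSet ({A : Matrix (Fin m) (Fin m) ℝ | A.PosDef} ∩ CFC.sqrt ⁻¹' t) := by
    rw [him]
    refine (hs.inter ht).image_of_continuousOn_injOn (by fun_prop) ?_
    rintro A ⟨hA, -⟩ B ⟨hB, -⟩ hAB
    rw [← sqrt_mul_self_of_posDef hA, ← sqrt_mul_self_of_posDef hB]
    exact congrArg _ hAB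
  rw [posSqrt, Set.indicator_preimage, Set.ite, Set.inter_comm (CFC.sqrt ⁻¹' t)]
  exact hm.union ((measurable_zero ht).diff hs)

theorem measurable_mul_mul_of_measurable {α : Type*} [MeasurableSpace α]
    {f : α → Matrix (Fin m) (Fin m) ℝ} (hf : Measurable f) :
    Measurable fun z : α × Matrix (Fin m) (Fin m) ℝ => f z.1 * z.2 * f z.1 := by
  have : SecondCountableTopology (Matrix (Fin m) (Fin m) ℝ) :=
    inferInstanceAs (SecondCountableTopology (Fin m → Fin m → ℝ))
  have h1 : Measurable fun z : Matrix (Fin m) (Fin m) ℝ × Matrix (Fin m) (Fin m) ℝ =>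
      z.1 * z.2 * z.1 := Continuous.measurable (by fun_prop)
  have h2 : Measurable fun z : α × Matrix (Fin m) (Fin m) ℝ => (f z.1, z.2) :=
    (hf.comp measurable_fst).prodMk measurable_snd
  exact h1.comp h2

end Measurability

/-! ### From the Hankel transform to the Laplace transform -/

section LaplaceTransform

variable {m : ℕ}

theorem besselA_orthogonal_conj (ν : ℂ) (G : Matrix.orthogonalGroup (Fin m) ℝ)
    (Y : Matrix (Fin m) (Fin m) ℝ) :
    besselA ν ((G : Matrix (Fin m) (Fin m) ℝ) * Y * (G : Matrix (Fin m) (Fin m) ℝ)ᵀ) =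
      besselA ν Y := by
  simp only [besselA, zonalPolynomial, sphericalPolynomial_conj]

/-- By the singular value decomposition MᵀM and MMᵀ are orthogonally conjugate, and the Bessel
function does not see the conjugation. -/
theorem besselA_transpose_mul (ν : ℂ) {M : Matrix (Fin m) (Fin m) ℝ} (hM : IsUnit M.det) :
    besselA ν (Mᵀ * M) = besselA ν (M * Mᵀ) := by
  obtain ⟨G, H, x, rfl⟩ := exists_singularValues hM
  conv_lhs => rw [← besselA_orthogonal_conj ν H]
  conv_rhs => rw [← besselA_orthogonal_conj ν G⁻¹]
  congr 1
  have hG : ((G⁻¹ : Matrix.orthogonalGroup (Fin m) ℝ) : Matrix (Fin m) (Fin m) ℝ) =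
      (G : Matrix (Fin m) (Fin m) ℝ)ᵀ := rfl
  have h1 := orthogonal_mul_transpose H
  have h2 := orthogonal_transpose_mul G
  rw [hG]
  simp only [Matrix.transpose_mul, Matrix.transpose_transpose, Matrix.diagonal_transpose]
  calc _ = ((H : Matrix (Fin m) (Fin m) ℝ) * (H : Matrix (Fin m) (Fin m) ℝ)ᵀ) *
        Matrix.diagonal x * ((G : Matrix (Fin m) (Fin m) ℝ)ᵀ * G) * Matrix.diagonal x *
        ((H : Matrix (Fin m) (Fin m) ℝ) * (H : Matrix (Fin m) (Fin m) ℝ)ᵀ) := by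
        simp only [Matrix.mul_assoc]
    _ = ((G : Matrix (Fin m) (Fin m) ℝ)ᵀ * G) * Matrix.diagonal x *
        ((H : Matrix (Fin m) (Fin m) ℝ) * (H : Matrix (Fin m) (Fin m) ℝ)ᵀ) * Matrix.diagonal x *
        ((G : Matrix (Fin m) (Fin m) ℝ)ᵀ * G) := by
        rw [h1, h2]
    _ = _ := by simp only [Matrix.mul_assoc]

theorem norm_cosTransform_le (c : ℂ) (M : Matrix (Fin m) (Fin m) ℝ)
    (hc : Integrable fun q : Fin m × Fin m → ℝ => ballDensity c (ofEntries q)) :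
    ‖cosTransform c M‖ ≤ ∫ q : Fin m × Fin m → ℝ, ‖ballDensity c (ofEntries q)‖ := by
  refine norm_integral_le_of_norm_le hc.norm (ae_of_all _ fun q => ?_)
  rw [norm_mul, Complex.norm_real]
  exact mul_le_of_le_one_left (norm_nonneg _) (Real.abs_cos_le_one _)

/-- The factor relating the Bessel function to the integral over the matrix ball. -/
noncomputable def besselFactor (m : ℕ) (a : ℂ) : ℂ :=
  multivariateGamma m a / (multivariateGamma m (a - (m : ℂ) / 2) * (√Real.pi : ℂ) ^ (m * m))

theorem sqrt_pi_pow_ne_zero (n : ℕ) : (√Real.pi : ℂ) ^ n ≠ 0 :=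
  pow_ne_zero _ (by exact_mod_cast (Real.sqrt_pos.2 Real.pi_pos).ne')

theorem besselA_mul_transpose {ν a : ℂ} (hνa : a = ν + ((m : ℂ) + 1) / 2)
    (ha : ((m : ℝ) - 1) / 2 < (a - (m : ℂ) / 2).re)
    {M : Matrix (Fin m) (Fin m) ℝ} (hM : IsUnit M.det) :
    multivariateGamma m a * besselA ν (M * Mᵀ) =
      besselFactor m a * cosTransform (a - m - 1 / 2) M := by
  have h := besselA_eq_cosTransform hνa ha hM
  have h1 := multivariateGamma_ne_zero ha
  have h2 := sqrt_pi_pow_ne_zero (m * m)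
  rw [besselFactor, div_mul_eq_mul_div, eq_div_iff (mul_ne_zero h1 h2), ← h]
  ring

theorem norm_besselA_le {ν a : ℂ} (hνa : a = ν + ((m : ℂ) + 1) / 2)
    (ha : ((m : ℝ) - 1) / 2 < (a - (m : ℂ) / 2).re)
    {M : Matrix (Fin m) (Fin m) ℝ} (hM : IsUnit M.det) :
    ‖multivariateGamma m a * besselA ν (M * Mᵀ)‖ ≤ ‖besselFactor m a‖ *
      ∫ q : Fin m × Fin m → ℝ, ‖ballDensity (a - m - 1 / 2) (ofEntries q)‖ := by
  rw [besselA_mul_transpose hνa ha hM, norm_mul]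
  exact mul_le_mul_of_nonneg_left (norm_cosTransform_le _ M (integrable_ballDensity ha))
    (norm_nonneg _)

theorem sqrt_conj_eq {T X : Matrix (Fin m) (Fin m) ℝ} (hT : T.PosDef) (hX : X.PosDef) :
    IsUnit (CFC.sqrt T * CFC.sqrt X).det ∧
    CFC.sqrt T * X * CFC.sqrt T =
      (CFC.sqrt T * CFC.sqrt X) * (CFC.sqrt T * CFC.sqrt X)ᵀ := by
  obtain ⟨hT1, hT2, hT3⟩ := posDef_sqrt hT
  obtain ⟨hX1, hX2, hX3⟩ := posDef_sqrt hX
  refine ⟨by rw [Matrix.det_mul]; exact (posDef_isUnit_det hT1).mul (posDef_isUnit_det hX1), ?_⟩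
  conv_lhs => rw [← hX3]
  rw [Matrix.transpose_mul, hT2, hX2]
  simp only [Matrix.mul_assoc]

theorem posDef_sqrt_conj {S R : Matrix (Fin m) (Fin m) ℝ} (hS : S.PosDef) (hR : R.PosDef) :
    (CFC.sqrt S * R * CFC.sqrt S).PosDef := by
  obtain ⟨h1, h2⟩ := sqrt_conj_eq hS hR
  rw [h2]
  exact posDef_mul_transpose h1

/-- The Bessel function at `T^{1/2} X T^{1/2}` with `T = S^{1/2} R S^{1/2}`. -/
theorem besselA_sqrt_conj (ν : ℂ) {S R X : Matrix (Fin m) (Fin m) ℝ} (hS : S.PosDef)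
    (hR : R.PosDef) (hX : X.PosDef) :
    IsUnit (CFC.sqrt X * CFC.sqrt S * CFC.sqrt R).det ∧
    besselA ν (CFC.sqrt (CFC.sqrt S * R * CFC.sqrt S) * X *
      CFC.sqrt (CFC.sqrt S * R * CFC.sqrt S)) =
    besselA ν ((CFC.sqrt X * CFC.sqrt S * CFC.sqrt R) *
      (CFC.sqrt X * CFC.sqrt S * CFC.sqrt R)ᵀ) := by
  obtain ⟨hR1, hR2, hR3⟩ := posDef_sqrt hR
  obtain ⟨hS1, hS2, hS3⟩ := posDef_sqrt hS
  obtain ⟨hX1, hX2, hX3⟩ := posDef_sqrt hX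
  have hT := posDef_sqrt_conj hS hR
  obtain ⟨hT1, hT2, hT3⟩ := posDef_sqrt hT
  refine ⟨by
    rw [Matrix.det_mul, Matrix.det_mul]
    exact ((posDef_isUnit_det hX1).mul (posDef_isUnit_det hS1)).mul (posDef_isUnit_det hR1), ?_⟩
  obtain ⟨h1, h2⟩ := sqrt_conj_eq hT hX
  -- Exchanging the two factors replaces T^{1/2} X T^{1/2} by X^{1/2} T X^{1/2}. This removes the
  -- square root of T and puts R^{1/2} last, next to the ball variable Q.
  rw [h2, ← besselA_transpose_mul ν h1]
  congr 1
  rw [Matrix.transpose_mul, hT2, hX2]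
  calc _ = CFC.sqrt X * (CFC.sqrt (CFC.sqrt S * R * CFC.sqrt S) *
        CFC.sqrt (CFC.sqrt S * R * CFC.sqrt S)) * CFC.sqrt X := by simp only [Matrix.mul_assoc]
    _ = CFC.sqrt X * (CFC.sqrt S * (CFC.sqrt R * CFC.sqrt R) * CFC.sqrt S) * CFC.sqrt X := by
        rw [hT3, hR3]
    _ = _ := by
        simp only [Matrix.transpose_mul, hR2, hS2, hX2, Matrix.mul_assoc]

/-- The Laplace-type integral of the Bessel function over the cone. -/
theorem integral_coneDensity_besselA {ν a : ℂ} (hνa : a = ν + ((m : ℂ) + 1) / 2)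
    (ha : ((m : ℝ) - 1) / 2 < (a - (m : ℂ) / 2).re) {S X : Matrix (Fin m) (Fin m) ℝ}
    (hS : S.PosDef) (hX : X.PosDef) :
    ∫ r : Upper m → ℝ, coneDensity a r * (multivariateGamma m a *
      besselA ν (CFC.sqrt (CFC.sqrt S * symmetricOfUpper r * CFC.sqrt S) * X *
        CFC.sqrt (CFC.sqrt S * symmetricOfUpper r * CFC.sqrt S))) =
    multivariateGamma m a * Complex.exp (-((S * X).trace : ℂ)) := by
  obtain ⟨hS1, hS2, hS3⟩ := posDef_sqrt hS
  obtain ⟨hX1, hX2, hX3⟩ := posDef_sqrt hX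
  obtain ⟨hc1, hc2⟩ := integral_cos_gaussianDensity (CFC.sqrt X * CFC.sqrt S)
  -- Take f(N) = cos(2 tr X^{1/2} S^{1/2} N). At N = R^{1/2} Q its ball integral is the Bessel
  -- function up to `besselFactor`, while its Gaussian integral is a multiple of exp(-tr SX).
  have hmaster := (integral_cone_ball ha (f := fun N =>
    ((Real.cos (2 * (CFC.sqrt X * CFC.sqrt S * N).trace) : ℝ) : ℂ)) hc1).2
  have htr : (CFC.sqrt X * CFC.sqrt S * (CFC.sqrt X * CFC.sqrt S)ᵀ).trace = (S * X).trace := by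
    rw [Matrix.transpose_mul, hX2, hS2, Matrix.mul_assoc, Matrix.trace_mul_comm, ← Matrix.mul_assoc,
      hS3, Matrix.mul_assoc, hX3]
  rw [hc2, htr] at hmaster
  have h1 := multivariateGamma_ne_zero ha
  have h2 := sqrt_pi_pow_ne_zero (m * m)
  have hfac : multivariateGamma m a * Complex.exp (-((S * X).trace : ℂ)) =
      besselFactor m a * ((√Real.pi : ℂ) ^ (m * m) * Complex.exp (-((S * X).trace : ℂ)) *
        multivariateGamma m (a - (m : ℂ) / 2)) := by
    rw [besselFactor]
    generalize multivariateGamma m (a - (m : ℂ) / 2) = g at h1 ⊢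
    field_simp
  rw [hfac, ← hmaster, ← integral_const_mul]
  congr 1
  ext r
  by_cases hr : (symmetricOfUpper r).PosDef
  · obtain ⟨hu, hb⟩ := besselA_sqrt_conj ν hS hr hX
    rw [hb, besselA_mul_transpose hνa ha hu, cosTransform]
    simp only [Matrix.mul_assoc]
    ring
  · rw [coneDensity, Set.indicator_of_notMem (by exact hr)]
    simp

/-- The Hankel transform of a probability measure on positive definite matrices determines its
Laplace transform. -/
theorem integral_coneDensity_hankel {ν a : ℂ} (hνa : a = ν + ((m : ℂ) + 1) / 2)
    (ha : ((m : ℝ) - 1) / 2 < (a - (m : ℂ) / 2).re) {S : Matrix (Fin m) (Fin m) ℝ}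
    (hS : S.PosDef) (μ : Measure (Matrix (Fin m) (Fin m) ℝ)) [IsProbabilityMeasure μ]
    (hμ : ∀ᵐ x ∂μ, x.PosDef) :
    ∫ r : Upper m → ℝ, coneDensity a r *
      ∫ x, multivariateGamma m a *
        besselA ν (CFC.sqrt (CFC.sqrt S * symmetricOfUpper r * CFC.sqrt S) * x *
          CFC.sqrt (CFC.sqrt S * symmetricOfUpper r * CFC.sqrt S)) ∂μ =
    multivariateGamma m a * ∫ x, Complex.exp (-((S * x).trace : ℂ)) ∂μ := by
  set ψ : (Upper m → ℝ) → Matrix (Fin m) (Fin m) ℝ := fun r =>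
    CFC.sqrt (CFC.sqrt S * symmetricOfUpper r * CFC.sqrt S) with hψ
  -- A measurable version of ψ. The two agree on the cone, and off the cone the density vanishes.
  set ψ' : (Upper m → ℝ) → Matrix (Fin m) (Fin m) ℝ := fun r =>
    posSqrt (CFC.sqrt S * symmetricOfUpper r * CFC.sqrt S) with hψ'
  have hψm : Measurable ψ' := by
    have h1 := continuous_symmetricOfUpper m
    exact measurable_posSqrt.comp (by fun_prop :
      Continuous fun r : Upper m → ℝ => CFC.sqrt S * symmetricOfUpper r * CFC.sqrt S).measurable
  set Φ : (Upper m → ℝ) → Matrix (Fin m) (Fin m) ℝ → ℂ := fun r x =>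
    coneDensity a r * (multivariateGamma m a * besselA ν (ψ' r * x * ψ' r)) with hΦ
  have hΦeq : ∀ r x, Φ r x =
      coneDensity a r * (multivariateGamma m a * besselA ν (ψ r * x * ψ r)) := by
    intro r x
    by_cases hr : (symmetricOfUpper r).PosDef
    · simp only [hΦ, hψ', hψ, posSqrt_of_posDef (posDef_sqrt_conj hS hr)]
    · simp only [hΦ, coneDensity]
      rw [Set.indicator_of_notMem (by exact hr)]
      simp
  have hmeas : Measurable (Function.uncurry Φ) := by
    have h2 : Measurable fun z : (Upper m → ℝ) × Matrix (Fin m) (Fin m) ℝ =>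
        ψ' z.1 * z.2 * ψ' z.1 := measurable_mul_mul_of_measurable hψm
    have h3 : Measurable fun z : (Upper m → ℝ) × Matrix (Fin m) (Fin m) ℝ =>
        besselA ν (ψ' z.1 * z.2 * ψ' z.1) := (measurable_besselA ν).comp h2
    exact ((measurable_coneDensity a).comp measurable_fst).mul (h3.const_mul _)
  -- A bound for the Bessel factor that is uniform over positive definite arguments, since the
  -- cosine is at most 1. The integrand is then dominated by a multiple of the cone density.
  set C : ℝ := ‖besselFactor m a‖ *
      ∫ q : Fin m × Fin m → ℝ, ‖ballDensity (a - m - 1 / 2) (ofEntries q)‖ with hC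
  have hint : Integrable (Function.uncurry Φ) (volume.prod μ) := by
    have hdom : Integrable (fun z : (Upper m → ℝ) × Matrix (Fin m) (Fin m) ℝ =>
        coneDensity a z.1 * (C : ℂ)) (volume.prod μ) :=
      (integrable_coneDensity (half_re_sub ha)).mul_prod (integrable_const (μ := μ) (C : ℂ))
    refine hdom.mono hmeas.aestronglyMeasurable ?_
    have hae : ∀ᵐ z : (Upper m → ℝ) × Matrix (Fin m) (Fin m) ℝ ∂(volume.prod μ), z.2.PosDef :=
      Measure.quasiMeasurePreserving_snd.ae hμ
    filter_upwards [hae] with z hz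
    by_cases hr : (symmetricOfUpper z.1).PosDef
    · rw [Function.uncurry, hΦeq, norm_mul, norm_mul (coneDensity a z.1) (C : ℂ)]
      refine mul_le_mul_of_nonneg_left ?_ (norm_nonneg _)
      obtain ⟨h1, h2⟩ := sqrt_conj_eq (posDef_sqrt_conj hS hr) hz
      rw [h2, Complex.norm_real]
      exact (norm_besselA_le hνa ha h1).trans (Real.le_norm_self _)
    · rw [Function.uncurry, hΦeq, coneDensity, Set.indicator_of_notMem (by exact hr)]
      simp
  have hswap := integral_integral_swap hint
  simp only [hΦeq] at hswap
  have hin : ∀ᵐ x ∂μ, ∫ r : Upper m → ℝ, coneDensity a r *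
      (multivariateGamma m a * besselA ν (ψ r * x * ψ r)) =
      multivariateGamma m a * Complex.exp (-((S * x).trace : ℂ)) := by
    filter_upwards [hμ] with x hx
    exact integral_coneDensity_besselA hνa ha hS hx
  rw [integral_congr_ae hin, integral_const_mul] at hswap
  rw [← hswap]
  exact integral_congr_ae (ae_of_all _ fun r => (integral_const_mul _ _).symm)

end LaplaceTransform

/-! ### Uniqueness of Laplace transforms on the cone -/

section LaplaceUniqueness

open scoped BoundedContinuousFunction

variable {m : ℕ}

theorem isClosed_posSemidef : IsClosed {A : Matrix (Fin m) (Fin m) ℝ | A.PosSemidef} := by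
  have h : {A : Matrix (Fin m) (Fin m) ℝ | A.PosSemidef} =
      {A | Aᵀ = A} ∩ ⋂ x : Fin m → ℝ, {A | 0 ≤ x ⬝ᵥ (A *ᵥ x)} := by
    ext A
    simp only [Set.mem_ofPred_eq, Matrix.posSemidef_iff_dotProduct_mulVec, Matrix.IsHermitian,
      Matrix.conjTranspose_eq_transpose_of_trivial, star_trivial, Set.mem_inter_iff,
      Set.mem_iInter]
  rw [h]
  exact (isClosed_eq (by fun_prop) continuous_id).inter
    (isClosed_iInter fun x => isClosed_le continuous_const (by fun_prop))

/-- The closed cone of positive semidefinite matrices. -/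
abbrev PosSemidefCone (m : ℕ) : Type := {A : Matrix (Fin m) (Fin m) ℝ | A.PosSemidef}

theorem trace_mul_nonneg_of_posDef {S x : Matrix (Fin m) (Fin m) ℝ} (hS : S = 0 ∨ S.PosDef)
    (hx : x.PosSemidef) : 0 ≤ (S * x).trace := by
  obtain rfl | hS := hS
  · simp
  obtain ⟨-, hB, hBB⟩ := posDef_sqrt hS
  have h := (hx.mul_mul_conjTranspose_same (CFC.sqrt S)).trace_nonneg
  rwa [Matrix.conjTranspose_eq_transpose_of_trivial, hB, Matrix.trace_mul_comm,
    ← Matrix.mul_assoc, hBB] at h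

/-- The exponential functions `x ↦ exp (-tr Sx)` on the cone, with `S` positive definite or zero. -/
def laplaceFunctions (m : ℕ) : Submonoid (PosSemidefCone m →ᵇ ℝ) where
  carrier := {g | ∃ S : Matrix (Fin m) (Fin m) ℝ, (S = 0 ∨ S.PosDef) ∧
    ∀ x : PosSemidefCone m, g x = Real.exp (-(S * x.1).trace)}
  one_mem' := ⟨0, Or.inl rfl, fun x => by simp⟩
  mul_mem' := by
    rintro f g ⟨S, hS, hf⟩ ⟨T, hT, hg⟩
    refine ⟨S + T, ?_, fun x => ?_⟩
    · obtain rfl | hS := hS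
      · rwa [zero_add]
      · obtain rfl | hT := hT
        · exact Or.inr (by rwa [add_zero])
        · exact Or.inr (hS.add hT)
    · rw [BoundedContinuousFunction.mul_apply, hf, hg, ← Real.exp_add, Matrix.add_mul,
        Matrix.trace_add, neg_add]

/-- On the cone tr(Sx) is nonnegative, so the exponential is bounded by 1; on all matrices it need
not be bounded. -/
theorem exists_laplaceFunction {S : Matrix (Fin m) (Fin m) ℝ} (hS : S.PosDef) :
    ∃ g ∈ laplaceFunctions m, ∀ x : PosSemidefCone m, g x = Real.exp (-(S * x.1).trace) := by
  have hc : Continuous fun x : PosSemidefCone m => Real.exp (-(S * x.1).trace) := by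
    have h1 : Continuous fun x : PosSemidefCone m => x.1 := continuous_subtype_val
    fun_prop
  refine ⟨BoundedContinuousFunction.ofNormedAddCommGroup _ hc 1 fun x => ?_,
    ⟨S, Or.inr hS, fun x => rfl⟩, fun x => rfl⟩
  rw [Real.norm_of_nonneg (Real.exp_pos _).le, Real.exp_le_one_iff]
  exact neg_nonpos.2 (trace_mul_nonneg_of_posDef (Or.inr hS) x.2)

/-- The star subalgebra spanned by the exponential functions. -/
noncomputable def laplaceAlgebra (m : ℕ) : StarSubalgebra ℝ (PosSemidefCone m →ᵇ ℝ) where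
  __ := Algebra.adjoin ℝ (laplaceFunctions m : Set (PosSemidefCone m →ᵇ ℝ))
  star_mem' := by
    intro g hg
    have : star g = g := by
      ext x
      simp
    rwa [this]

/-- With D = x - y, test against S = D + sI for two large values of s. The condition tr D² + s tr D
= 0 at both forces tr D = 0 and then tr D² = 0, that is D = 0. -/
theorem eq_of_trace_mul_eq {x y : Matrix (Fin m) (Fin m) ℝ} (hx : x.IsSymm) (hy : y.IsSymm)
    (h : ∀ S : Matrix (Fin m) (Fin m) ℝ, S.PosDef → (S * x).trace = (S * y).trace) : x = y := by
  have hD : (x - y).IsSymm := hx.sub hy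
  obtain ⟨t, ht⟩ := exists_posDef_add_smul hD
  have h1 : ∀ s, t < s → ((x - y) * (x - y)).trace + s * (x - y).trace = 0 := by
    intro s hs
    have := h _ (ht s hs)
    rw [← sub_eq_zero, ← Matrix.trace_sub, ← Matrix.mul_sub, Matrix.add_mul, Matrix.trace_add,
      Matrix.smul_mul, Matrix.one_mul, Matrix.trace_smul, smul_eq_mul] at this
    exact this
  have h2 := h1 (t + 1) (by linarith)
  have h3 := h1 (t + 2) (by linarith)
  have h4 : (x - y).trace = 0 := by linarith
  rw [h4, mul_zero, add_zero] at h2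
  rw [← sub_eq_zero, ← Matrix.trace_conjTranspose_mul_self_eq_zero_iff,
    Matrix.conjTranspose_eq_transpose_of_trivial, hD]
  exact h2

theorem separatesPoints_laplaceAlgebra :
    ((laplaceAlgebra m).map (BoundedContinuousFunction.toContinuousMapStarₐ ℝ)).SeparatesPoints := by
  intro x y hxy
  by_contra hcon
  refine hxy (Subtype.ext (eq_of_trace_mul_eq ?_ ?_ fun S hS => ?_))
  · have := x.2.1
    rwa [Matrix.IsHermitian, Matrix.conjTranspose_eq_transpose_of_trivial] at this
  · have := y.2.1
    rwa [Matrix.IsHermitian, Matrix.conjTranspose_eq_transpose_of_trivial] at this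
  · obtain ⟨g, hg, hgx⟩ := exists_laplaceFunction hS
    by_contra hne
    refine hcon ⟨g, ⟨g.toContinuousMapStarₐ ℝ, ⟨g, Algebra.subset_adjoin hg, rfl⟩, rfl⟩, ?_⟩
    rw [hgx, hgx]
    intro heq
    exact hne (neg_injective (Real.exp_injective heq))

/-- A probability measure on the cone of positive semidefinite matrices is determined by its
Laplace transform. -/
theorem ext_of_laplace {μ μ' : Measure (Matrix (Fin m) (Fin m) ℝ)} [IsProbabilityMeasure μ]
    [IsProbabilityMeasure μ'] (hμ : ∀ᵐ x ∂μ, x.PosSemidef) (hμ' : ∀ᵐ x ∂μ', x.PosSemidef)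
    (h : ∀ S : Matrix (Fin m) (Fin m) ℝ, S.PosDef →
      ∫ x, Real.exp (-(S * x).trace) ∂μ = ∫ x, Real.exp (-(S * x).trace) ∂μ') : μ = μ' := by
  have hcl := isClosed_posSemidef (m := m)
  have hms : MeasurableSet {A : Matrix (Fin m) (Fin m) ℝ | A.PosSemidef} := hcl.measurableSet
  have : PolishSpace (Matrix (Fin m) (Fin m) ℝ) :=
    inferInstanceAs (PolishSpace (Fin m → Fin m → ℝ))
  have : PolishSpace (PosSemidefCone m) := hcl.polishSpace
  have hemb := MeasurableEmbedding.subtype_coe hms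
  -- A measure concentrated on the cone is recovered from its restriction there. The cone is closed,
  -- hence Polish, and on it the exponentials are bounded.
  have hr : ∀ {ρ : Measure (Matrix (Fin m) (Fin m) ℝ)}, (∀ᵐ x ∂ρ, x.PosSemidef) →
      (ρ.comap ((↑) : PosSemidefCone m → Matrix (Fin m) (Fin m) ℝ)).map (↑) = ρ := by
    intro ρ hρ
    rw [map_comap_subtype_coe hms]
    exact Measure.restrict_eq_self_of_ae_mem 
      (s := {A : Matrix (Fin m) (Fin m) ℝ | A.PosSemidef}) hρ
  have hint : ∀ {ρ : Measure (Matrix (Fin m) (Fin m) ℝ)}, (∀ᵐ x ∂ρ, x.PosSemidef) →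
      ∀ f : Matrix (Fin m) (Fin m) ℝ → ℝ,
      ∫ x : PosSemidefCone m, f x ∂(ρ.comap (↑)) = ∫ x, f x ∂ρ := by
    intro ρ hρ f
    conv_rhs => rw [← hr hρ]
    exact (hemb.integral_map f).symm
  have hfin : ∀ (ρ : Measure (Matrix (Fin m) (Fin m) ℝ)) [IsProbabilityMeasure ρ],
      IsFiniteMeasure (ρ.comap ((↑) : PosSemidefCone m → Matrix (Fin m) (Fin m) ℝ)) := by
    intro ρ _
    refine ⟨?_⟩
    rw [comap_subtype_coe_apply hms]
    exact measure_lt_top _ _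
  have := hfin μ
  have := hfin μ'
  rw [← hr hμ, ← hr hμ']
  congr 1
  refine ext_of_forall_mem_subalgebra_integral_eq_of_polish (𝕜 := ℝ)
    separatesPoints_laplaceAlgebra fun g hg => ?_
  -- The exponentials are closed under products, so the algebra they generate is their linear span
  -- and linearity reduces the claim to a single exponential. The case S = 0 is total mass one.
  have hg' : g ∈ Submodule.span ℝ (laplaceFunctions m : Set (PosSemidefCone m →ᵇ ℝ)) := by
    rw [← Submonoid.closure_eq (laplaceFunctions m), ← Algebra.adjoin_eq_span]
    exact hg
  clear hg
  induction hg' using Submodule.span_induction with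
  | mem g hg =>
    obtain ⟨S, hS, hgS⟩ := hg
    simp only [hgS]
    rw [hint hμ fun x => Real.exp (-(S * x).trace), hint hμ' fun x => Real.exp (-(S * x).trace)]
    obtain rfl | hS := hS
    · simp
    · exact h S hS
  | zero => simp
  | add f g _ _ hf hg =>
    simp only [BoundedContinuousFunction.add_apply]
    rw [integral_add (f.integrable _) (g.integrable _),
      integral_add (f.integrable _) (g.integrable _), hf, hg]
  | smul c f _ hf =>
    simp only [BoundedContinuousFunction.smul_apply, smul_eq_mul]
    rw [integral_const_mul, integral_const_mul, hf]

end LaplaceUniqueness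

/-! ### Uniqueness for the Hankel transform -/

section HankelUniqueness

variable {m : ℕ}

theorem hankelTransform_eq_integral_map {Ω : Type*} [MeasurableSpace Ω] (P : Measure Ω)
    {X : Ω → Matrix (Fin m) (Fin m) ℝ} (hX : AEMeasurable X P) (ν : ℂ)
    (T : Matrix (Fin m) (Fin m) ℝ) :
    hankelTransform P X ν T = ∫ x, multivariateGamma m (ν + ((m : ℂ) + 1) / 2) *
      besselA ν (CFC.sqrt T * x * CFC.sqrt T) ∂(P.map X) := by
  have h1 : Measurable fun x : Matrix (Fin m) (Fin m) ℝ => CFC.sqrt T * x * CFC.sqrt T :=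
    Continuous.measurable (by fun_prop)
  have h2 : Measurable fun x : Matrix (Fin m) (Fin m) ℝ =>
      multivariateGamma m (ν + ((m : ℂ) + 1) / 2) * besselA ν (CFC.sqrt T * x * CFC.sqrt T) :=
    ((measurable_besselA ν).comp h1).const_mul _
  rw [hankelTransform, integral_map hX h2.aestronglyMeasurable]

theorem eq_of_hankel_eq {ν : ℂ} (hν : ((m : ℝ) - 2) / 2 < ν.re)
    {μ μ' : Measure (Matrix (Fin m) (Fin m) ℝ)} [IsProbabilityMeasure μ] [IsProbabilityMeasure μ']
    (hμ : ∀ᵐ x ∂μ, x.PosDef) (hμ' : ∀ᵐ x ∂μ', x.PosDef)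
    (h : ∀ T : Matrix (Fin m) (Fin m) ℝ, T.PosDef →
      ∫ x, multivariateGamma m (ν + ((m : ℂ) + 1) / 2) *
        besselA ν (CFC.sqrt T * x * CFC.sqrt T) ∂μ =
      ∫ x, multivariateGamma m (ν + ((m : ℂ) + 1) / 2) *
        besselA ν (CFC.sqrt T * x * CFC.sqrt T) ∂μ') : μ = μ' := by
  set a : ℂ := ν + ((m : ℂ) + 1) / 2 with ha
  -- Since a - m/2 = ν + 1/2, this is the hypothesis on ν.
  have har : ((m : ℝ) - 1) / 2 < (a - (m : ℂ) / 2).re := by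
    have h2 : a - (m : ℂ) / 2 = ν + ((1 / 2 : ℝ) : ℂ) := by
      rw [ha]; push_cast; ring
    rw [h2, Complex.add_re, Complex.ofReal_re]
    linarith
  refine ext_of_laplace (hμ.mono fun x hx => hx.posSemidef) (hμ'.mono fun x hx => hx.posSemidef)
    fun S hS => ?_
  have h1 := integral_coneDensity_hankel ha har hS μ hμ
  have h2 := integral_coneDensity_hankel ha har hS μ' hμ'
  have h3 : ∫ x, Complex.exp (-((S * x).trace : ℂ)) ∂μ =
      ∫ x, Complex.exp (-((S * x).trace : ℂ)) ∂μ' := by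
    refine mul_left_cancel₀ (multivariateGamma_ne_zero (half_re_sub har)) ?_
    rw [← h1, ← h2]
    refine integral_congr_ae (ae_of_all _ fun r => ?_)
    -- For R on the cone, S^{1/2} R S^{1/2} is positive definite and the hypothesis applies;
    -- elsewhere the density is zero.
    by_cases hr : (symmetricOfUpper r).PosDef
    · simp only [h _ (posDef_sqrt_conj hS hr)]
    · simp only [coneDensity]
      rw [Set.indicator_of_notMem (by exact hr)]
      simp
  simp only [← Complex.ofReal_neg, ← Complex.ofReal_exp] at h3
  rw [integral_complex_ofReal, integral_complex_ofReal] at h3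
  exact_mod_cast h3

end HankelUniqueness

end MatrixHankel

theorem theorem2p4 {m : ℕ} {ν : ℂ} (hν : ((m : ℝ) - 2) / 2 < ν.re)
    {Ω Ω' : Type*} [MeasurableSpace Ω] [MeasurableSpace Ω']
    (P : Measure Ω) [IsProbabilityMeasure P] (P' : Measure Ω') [IsProbabilityMeasure P']
    (X : Ω → Matrix (Fin m) (Fin m) ℝ) (Y : Ω' → Matrix (Fin m) (Fin m) ℝ)
    (hX : AEMeasurable X P) (hY : AEMeasurable Y P')
    (hXpos : ∀ᵐ ω ∂P, (X ω).PosDef) (hYpos : ∀ᵐ ω ∂P', (Y ω).PosDef) :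
    (∀ T : Matrix (Fin m) (Fin m) ℝ, T.PosDef →
      MatrixHankel.hankelTransform P X ν T = MatrixHankel.hankelTransform P' Y ν T) ↔
    IdentDistrib X Y P P' := by
  constructor
  · intro h
    have := Measure.isProbabilityMeasure_map (μ := P) hX
    have := Measure.isProbabilityMeasure_map (μ := P') hY
    refine ⟨hX, hY, MatrixHankel.eq_of_hankel_eq hν ?_ ?_ fun T hT => ?_⟩
    · exact (ae_map_iff hX (MatrixHankel.measurableSet_posDef m)).2 hXpos
    · exact (ae_map_iff hY (MatrixHankel.measurableSet_posDef m)).2 hYpos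
    · rw [← MatrixHankel.hankelTransform_eq_integral_map P hX,
        ← MatrixHankel.hankelTransform_eq_integral_map P' hY]
      exact h T hT
  · intro h T _
    rw [MatrixHankel.hankelTransform_eq_integral_map P hX,
      MatrixHankel.hankelTransform_eq_integral_map P' hY, h.map_eq]
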